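/- Let $M$ be a smooth manifold, $H$ a closed real 3-form on $M$, and $\mathbb{T}M=TM\oplus T^*M$ with the pairing $\langle X+\alpha,Y+\beta\rangle=\iota_X\beta+\iota_Y\alpha$ and the Courant bracket $$[X+\alpha,Y+\beta]_H=[X,Y]+\mathcal{L}_X\beta-\iota_Yd\alpha+\iota_X\iota_YH .$$ Let $(\mathbb{J}_A,\mathbb{J}_B)$ be a generalized Kähler structure on $(M,H)$: two commuting generalized complex structures (smooth complex structures on $\mathbb{T}M$ whose $+i$ eigenbundles $L_A,L_B\subset\mathbb{T}_{\mathbb{C}}M$ are maximal isotropic and involutive for $[\cdot,\cdot]_H$) such that $\langle\mathbb{J}_A\cdot,\mathbb{J}_B\cdot\rangle$ is positive definite. *Bihermitian data.* The $\pm1$ eigenbundles of $-\mathbb{J}_A\mathbb{J}_B$ are graphs $\{X+b(X)\pm g(X)\}$ of a 2-form $b$ and a Riemannian metric $g$, and transporting $\mathbb{J}_A$ from them to $TM$ gives complex structures $I_\pm$; put $\omega_\pm=gI_\pm$ (2-forms $F$ are regarded as maps $TM\to T^*M$, $X\mapsto\iota_XF$). Write $e^{F}(X+\alpha)=X+\alpha+\iota_XF$.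 (When the splitting $\mathbb{T}M=TM\oplus T^*M$ is the one determined by the generalized metric, $b=0$.) *Holomorphic Manin triples.* Over $X_\pm=(M,I_\pm)$ let $\mathcal{E}_\pm$ be the holomorphic Courant algebroid on $\mathbb{T}_{1,0}X_\pm=T_{1,0}X_\pm\oplus T^*_{1,0}X_\pm$ determined by the closed form $\mathcal{H}_\pm=\mp2i\partial_\pm\omega_\pm$ of type $(2,1)$, and let $$\mathcal{A}_+=\mathbb{T}_{1,0}X_+\cap e^{-b-i\omega_+}(\overline{L_A}),\qquad \mathcal{A}_-=\mathbb{T}_{1,0}X_-\cap e^{-b+i\omega_-}(\overline{L_A}),$$ $$\mathcal{B}_+=\mathbb{T}_{1,0}X_+\cap e^{-b-i\omega_+}(\overline{L_B}),\qquad \mathcal{B}_-=\mathbb{T}_{1,0}X_-\cap e^{-b+i\omega_-}(L_B).$$ *Real and imaginary parts.* For $\mathcal{A}\subset\mathbb{T}_{1,0}X$ let $L_{\mathcal{A}}=\mathcal{A}\oplus T_{0,1}X$ be its matched pair, and $$\mathcal{A}_R=\{X+\tfrac12(\alpha+\beta)\in\mathbb{T}M: X+\alpha\in L_{\mathcal{A}},\,X+\beta\in\overline{L_{\mathcal{A}}}\},\qquad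 \mathcal{A}_I=\{X+\tfrac1{2i}(\alpha-\beta)\in\mathbb{T}M: X+\alpha\in L_{\mathcal{A}},\,X+\beta\in\overline{L_{\mathcal{A}}}\}.$$ Put $\mathrm{Re}(\mathcal{E},\mathcal{A},\mathcal{B})=((\mathbb{T}M,\mathrm{Re}\,\mathcal{H}),\mathcal{A}_R,\mathcal{B}_R)$ and $\mathrm{Im}(\mathcal{E},\mathcal{A},\mathcal{B})=((\mathbb{T}M,\mathrm{Im}\,\mathcal{H}),\mathcal{A}_I,\mathcal{B}_I)$. Let $\pi_A,\pi_B:T^*M\to TM$ be the bivectors $\pi_A(\alpha)=\rho(\mathbb{J}_A\alpha)$, $\pi_B(\alpha)=\rho(\mathbb{J}_B\alpha)$, where $\rho:\mathbb{T}M\to TM$ is the projection, and $\mathrm{Gr}(\pi)=\{\pi(\alpha)+\alpha\}$. A (real) Manin triple $((\mathbb{T}M,H),A,B)$ consists of a closed 3-form $H$ and two Dirac structures $A,B$ (smooth, maximal isotropic, $[\cdot,\cdot]_H$-involutive subbundles) with $\mathbb{T}M=A\oplus B$; an isomorphism of Manin triples is a smooth bundle isomorphism over $\mathrm{id}_M$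 preserving the projection to $TM$, the pairing and the bracket and taking the two Dirac structures to the corresponding ones. **Statement.** All the following triples are real Manin triples, and the indicated maps are isomorphisms of Manin triples. 1. (Real parts.) $e^{b}$ is an isomorphism $$\mathrm{Re}(\mathcal{E}_\pm,\mathcal{A}_\pm,\mathcal{B}_\pm)\;\cong\;((\mathbb{T}M,H),\,\mathbb{J}_A(T^*M),\,\mathbb{J}_B(T^*M))$$ for both signs; in particular the identity is an isomorphism $\mathrm{Re}(\mathcal{E}_+,\mathcal{A}_+,\mathcal{B}_+)\cong\mathrm{Re}(\mathcal{E}_-,\mathcal{A}_-,\mathcal{B}_-)$. 2. (Imaginary parts.) $e^{\pm\omega_\pm}$ is an isomorphism $$\mathrm{Im}(\mathcal{E}_\pm,\mathcal{A}_\pm,\mathcal{B}_\pm)\;\cong\;((\mathbb{T}M,0),\,\mathrm{Gr}(-\pi_A),\,\mathrm{Gr}(\mp\pi_B)).$$ -/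

import Mathlib

open Manifold Bundle
open scoped ContDiff Manifold

noncomputable section

namespace GenKahler

/-! ## Complexification of a real vector space -/

/-- The complexification `V ⊗ ℂ` of a real vector space; `⟨u, v⟩` stands for `u + i v`. -/
@[ext] structure Cx (V : Type*) where
  re : V
  im : V

namespace Cx

variable {V W : Type*}

section AddCommMonoid

variable [AddCommMonoid V] [AddCommMonoid W]

instance : Add (Cx V) := ⟨fun u v => ⟨u.re + v.re, u.im + v.im⟩⟩
instance : Zero (Cx V) := ⟨⟨0, 0⟩⟩

@[simp] theorem add_re (u v : Cx V) : (u + v).re = u.re + v.re := rfl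
@[simp] theorem add_im (u v : Cx V) : (u + v).im = u.im + v.im := rfl
@[simp] theorem zero_re : (0 : Cx V).re = 0 := rfl
@[simp] theorem zero_im : (0 : Cx V).im = 0 := rfl

instance : AddCommMonoid (Cx V) where
  add_assoc u v w := by ext <;> simp [add_assoc]
  zero_add u := by ext <;> simp
  add_zero u := by ext <;> simp
  add_comm u v := by ext <;> simp [add_comm]
  nsmul := nsmulRec

variable [Module ℝ V] [Module ℝ W]

/-- `(a + i b)(u + i v) = (a u - b v) + i (a v + b u)`. -/
instance : SMul ℂ (Cx V) where
  smul z u := ⟨z.re • u.re + (-z.im) • u.im, z.re • u.im + z.im • u.re⟩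

@[simp] theorem smul_re (z : ℂ) (u : Cx V) : (z • u).re = z.re • u.re + (-z.im) • u.im := rfl
@[simp] theorem smul_im (z : ℂ) (u : Cx V) : (z • u).im = z.re • u.im + z.im • u.re := rfl

instance : Module ℂ (Cx V) where
  one_smul u := by ext <;> simp
  mul_smul z w u := by ext <;> simp <;> module
  smul_zero z := by ext <;> simp
  smul_add z u v := by ext <;> simp <;> module
  add_smul z w u := by ext <;> simp <;> module
  zero_smul u := by ext <;> simp

/-- The complex linear extension of a real linear map. -/
def map (f : V →ₗ[ℝ] W) : Cx V →ₗ[ℂ] Cx W where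
  toFun u := ⟨f u.re, f u.im⟩
  map_add' u v := by ext <;> simp
  map_smul' z u := by ext <;> simp

/-- The inclusion `V ⊂ V ⊗ ℂ`. -/
def ofReal (u : V) : Cx V := ⟨u, 0⟩

end AddCommMonoid

section AddCommGroup

variable [AddCommGroup V]

instance : Neg (Cx V) := ⟨fun u => ⟨-u.re, -u.im⟩⟩
instance : Sub (Cx V) := ⟨fun u v => ⟨u.re - v.re, u.im - v.im⟩⟩

@[simp] theorem neg_re (u : Cx V) : (-u).re = -u.re := rfl
@[simp] theorem neg_im (u : Cx V) : (-u).im = -u.im := rfl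
@[simp] theorem sub_re (u v : Cx V) : (u - v).re = u.re - v.re := rfl
@[simp] theorem sub_im (u v : Cx V) : (u - v).im = u.im - v.im := rfl

instance : AddCommGroup (Cx V) where
  neg_add_cancel u := by ext <;> simp
  sub_eq_add_neg u v := by ext <;> simp [sub_eq_add_neg]
  zsmul := zsmulRec
  add_comm := add_comm

variable [Module ℝ V]

/-- Complex conjugation. -/
def conj (u : Cx V) : Cx V := ⟨u.re, -u.im⟩

/-- The complex conjugate of a complex subspace. -/
def conjSubmodule (L : Submodule ℂ (Cx V)) : Submodule ℂ (Cx V) where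
  carrier := {u | conj u ∈ L}
  add_mem' {u v} hu hv := by
    have h : conj (u + v) = conj u + conj v := by
      ext
      · rfl
      · simp [conj, add_comm]
    simpa [h] using L.add_mem hu hv
  zero_mem' := by
    have h : conj (0 : Cx V) = 0 := by ext <;> simp [conj]
    simp [h]
  smul_mem' z u hu := by
    have h : conj (z • u) = (starRingEnd ℂ z) • conj u := by
      ext <;> (simp [conj]; try module)
    simpa [h] using L.smul_mem _ hu

end AddCommGroup

end Cx

/-! ## Linear algebra of `𝕋V = V ⊕ V*` -/

section LinearAlgebra

/-- `𝕋V = V ⊕ V*`. -/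
abbrev Gen (V : Type*) [AddCommGroup V] [Module ℝ V] [TopologicalSpace V] : Type _ :=
  V × (V →L[ℝ] ℝ)

variable {V : Type*} [AddCommGroup V] [Module ℝ V] [TopologicalSpace V]

/-- `⟨X + α, Y + β⟩ = β(X) + α(Y)`. -/
def pairing (u v : Gen V) : ℝ := v.2 u.1 + u.2 v.1

/-- The complex bilinear extension of the pairing to `𝕋V ⊗ ℂ`. -/
def pairingC (u v : Cx (Gen V)) : ℂ :=
  ⟨pairing u.re v.re - pairing u.im v.im, pairing u.re v.im + pairing u.im v.re⟩

/-- `L = L^⊥`; as the pairing on `𝕋V` is split, this says that `L` is maximal isotropic. -/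
def IsLagrangian (L : Submodule ℝ (Gen V)) : Prop :=
  ∀ u, u ∈ L ↔ ∀ v ∈ L, pairing u v = 0

/-- `L = L^⊥` in `𝕋V ⊗ ℂ`: `L` is maximal isotropic. -/
def IsLagrangianC (L : Submodule ℂ (Cx (Gen V))) : Prop :=
  ∀ u, u ∈ L ↔ ∀ v ∈ L, pairingC u v = 0

/-- The tangent component `V ⊕ V* → V`, complexified. -/
def tangentC : Cx (Gen V) →ₗ[ℂ] Cx V := Cx.map (LinearMap.fst ℝ V (V →L[ℝ] ℝ))

/-- The cotangent component of `V ⊕ V*`, complexified. -/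
def formC : Cx (Gen V) →ₗ[ℂ] Cx (V →L[ℝ] ℝ) := Cx.map (LinearMap.snd ℝ V (V →L[ℝ] ℝ))

/-- The real part `½(L + L̄) ∩ 𝕋V` of a complex subspace `L` of `𝕋V ⊗ ℂ`: all real
`X + ½(α + β)` with `X + α ∈ L` and `X + β ∈ L̄`. -/
def realPart (L : Submodule ℂ (Cx (Gen V))) : Submodule ℝ (Gen V) where
  carrier := {u | ∃ w ∈ L, ∃ w' ∈ Cx.conjSubmodule L,
    tangentC w = Cx.ofReal u.1 ∧ tangentC w' = Cx.ofReal u.1 ∧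
    (1 / 2 : ℂ) • (formC w + formC w') = Cx.ofReal u.2}
  add_mem' := by
    rintro u v ⟨w, hw, w', hw', h1, h2, h3⟩ ⟨z, hz, z', hz', k1, k2, k3⟩
    refine ⟨w + z, L.add_mem hw hz, w' + z', Submodule.add_mem _ hw' hz', ?_, ?_, ?_⟩
    · rw [map_add, h1, k1]; ext <;> simp [Cx.ofReal]
    · rw [map_add, h2, k2]; ext <;> simp [Cx.ofReal]
    · rw [map_add, map_add, add_add_add_comm, smul_add, h3, k3]
      apply Cx.ext <;> simp [Cx.ofReal, -Complex.coe_smul]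
  zero_mem' := ⟨0, L.zero_mem, 0, Submodule.zero_mem _, by rw [map_zero]; rfl,
    by rw [map_zero]; rfl, by rw [map_zero, add_zero, smul_zero]; rfl⟩
  smul_mem' := by
    rintro c u ⟨w, hw, w', hw', h1, h2, h3⟩
    refine ⟨(c : ℂ) • w, L.smul_mem _ hw, (c : ℂ) • w', Submodule.smul_mem _ _ hw', ?_, ?_, ?_⟩
    · rw [map_smul, h1]; apply Cx.ext <;> simp [Cx.ofReal, -Complex.coe_smul]
    · rw [map_smul, h2]; apply Cx.ext <;> simp [Cx.ofReal, -Complex.coe_smul]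
    · rw [map_smul, map_smul, ← smul_add, smul_comm, h3]
      apply Cx.ext <;> simp [Cx.ofReal, -Complex.coe_smul]

/-- The imaginary part `(1/2i)(L - L̄) ∩ 𝕋V` of a complex subspace `L` of `𝕋V ⊗ ℂ`: all real
`X + (1/2i)(α - β)` with `X + α ∈ L` and `X + β ∈ L̄`. -/
def imagPart (L : Submodule ℂ (Cx (Gen V))) : Submodule ℝ (Gen V) where
  carrier := {u | ∃ w ∈ L, ∃ w' ∈ Cx.conjSubmodule L,
    tangentC w = Cx.ofReal u.1 ∧ tangentC w' = Cx.ofReal u.1 ∧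
    (1 / (2 * Complex.I) : ℂ) • (formC w - formC w') = Cx.ofReal u.2}
  add_mem' := by
    rintro u v ⟨w, hw, w', hw', h1, h2, h3⟩ ⟨z, hz, z', hz', k1, k2, k3⟩
    refine ⟨w + z, L.add_mem hw hz, w' + z', Submodule.add_mem _ hw' hz', ?_, ?_, ?_⟩
    · rw [map_add, h1, k1]; ext <;> simp [Cx.ofReal]
    · rw [map_add, h2, k2]; ext <;> simp [Cx.ofReal]
    · rw [map_add, map_add, add_sub_add_comm, smul_add, h3, k3]
      apply Cx.ext <;> simp [Cx.ofReal, -Complex.coe_smul]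
  zero_mem' := ⟨0, L.zero_mem, 0, Submodule.zero_mem _, by rw [map_zero]; rfl,
    by rw [map_zero]; rfl, by rw [map_zero, sub_zero, smul_zero]; rfl⟩
  smul_mem' := by
    rintro c u ⟨w, hw, w', hw', h1, h2, h3⟩
    refine ⟨(c : ℂ) • w, L.smul_mem _ hw, (c : ℂ) • w', Submodule.smul_mem _ _ hw', ?_, ?_, ?_⟩
    · rw [map_smul, h1]; apply Cx.ext <;> simp [Cx.ofReal, -Complex.coe_smul]
    · rw [map_smul, h2]; apply Cx.ext <;> simp [Cx.ofReal, -Complex.coe_smul]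
    · have e : (c : ℂ) • formC w - (c : ℂ) • formC w' = (c : ℂ) • (formC w - formC w') :=
        (smul_sub _ _ _).symm
      rw [map_smul, map_smul, e, smul_comm, h3]
      apply Cx.ext <;> simp [Cx.ofReal, -Complex.coe_smul]

/-- The `+i` eigenspace in `𝕋V ⊗ ℂ` of an endomorphism `J` of `𝕋V`. -/
def eigenC (J : Gen V →L[ℝ] Gen V) : Submodule ℂ (Cx (Gen V)) :=
  Module.End.eigenspace (Cx.map (J : Gen V →ₗ[ℝ] Gen V)) Complex.I

/-- `J(V*) ⊂ 𝕋V`. -/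
def imageCotangent (J : Gen V →L[ℝ] Gen V) : Submodule ℝ (Gen V) :=
  (LinearMap.range (LinearMap.inr ℝ V (V →L[ℝ] ℝ))).map (J : Gen V →ₗ[ℝ] Gen V)

/-- `Gr(P) = {P(α) + α : α ∈ V*}`. -/
def graph (P : (V →L[ℝ] ℝ) →ₗ[ℝ] V) : Submodule ℝ (Gen V) :=
  LinearMap.range (P.prod LinearMap.id)

/-- `T_{0,1} ⊂ 𝕋V ⊗ ℂ`: the `-i` eigenspace of the complex structure `I` on `V`. -/
def T01 (I : V →L[ℝ] V) : Submodule ℂ (Cx (Gen V)) :=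
  (Module.End.eigenspace (Cx.map (I : V →ₗ[ℝ] V)) (-Complex.I)).comap tangentC ⊓
    LinearMap.ker formC

/-- The matched pair `𝒜 ⊕ T_{0,1}` of a subspace `𝒜 ⊂ 𝕋_{1,0}`. -/
def matchedPair (I : V →L[ℝ] V) (𝒜 : Submodule ℂ (Cx (Gen V))) : Submodule ℂ (Cx (Gen V)) :=
  𝒜 ⊔ T01 I

variable [IsTopologicalAddGroup V] [ContinuousSMul ℝ V]

/-- `𝕋_{1,0} = T_{1,0} ⊕ T_{1,0}^*`: the elements `X + α` with `I X = i X` and `α ∘ I = i α`. -/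
def TT10 (I : V →L[ℝ] V) : Submodule ℂ (Cx (Gen V)) :=
  (Module.End.eigenspace (Cx.map (I : V →ₗ[ℝ] V)) Complex.I).comap tangentC ⊓
    (Module.End.eigenspace
      (Cx.map ((ContinuousLinearMap.precomp ℝ I : (V →L[ℝ] ℝ) →L[ℝ] (V →L[ℝ] ℝ)) :
        (V →L[ℝ] ℝ) →ₗ[ℝ] (V →L[ℝ] ℝ))) Complex.I).comap formC

/-- The nilpotent endomorphism `X + α ↦ ι_X B` of `𝕋V`, for `B` regarded as a map `V → V*`,
`X ↦ B(X, ·)`. -/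
def gaugeNil (B : V →L[ℝ] V →L[ℝ] ℝ) : Gen V →ₗ[ℝ] Gen V :=
  (LinearMap.inr ℝ V (V →L[ℝ] ℝ)).comp
    ((B : V →ₗ[ℝ] V →L[ℝ] ℝ).comp (LinearMap.fst ℝ V (V →L[ℝ] ℝ)))

/-- The gauge transformation `e^B (X + α) = X + α + ι_X B`. -/
def gauge (B : V →L[ℝ] V →L[ℝ] ℝ) : Gen V ≃ₗ[ℝ] Gen V where
  toFun u := (u.1, u.2 + B u.1)
  invFun u := (u.1, u.2 - B u.1)
  map_add' u v := by ext <;> simp; ring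
  map_smul' c u := by ext <;> simp
  left_inv u := by simp
  right_inv u := by simp

/-- The complex gauge transformation `e^{B + iC}` of `𝕋V ⊗ ℂ`. -/
def gaugeC (B C : V →L[ℝ] V →L[ℝ] ℝ) : Cx (Gen V) →ₗ[ℂ] Cx (Gen V) :=
  LinearMap.id + Cx.map (gaugeNil B) + Complex.I • Cx.map (gaugeNil C)

/-! ### The bihermitian data of a pair `(J_A, J_B)`

With `G = -J_A J_B` the generalized metric, its `±1` eigenspaces are the graphs
`C_± = {X + b(X) ± g(X)}`, and `I_±` is `J_A` restricted to `C_± ≅ V`. -/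

section Bihermitian

variable (JA JB : Gen V →L[ℝ] Gen V)

/-- The generalized metric `G = -J_A J_B`, for which `⟨J_A u, J_B v⟩ = ⟨G u, v⟩`. -/
def genMetric : Gen V →L[ℝ] Gen V := -(JA.comp JB)

/-- `g⁻¹ : V* → V`, `α ↦ ρ(G α)`, where `ρ : 𝕋V → V` is the projection. -/
def metricInv : (V →L[ℝ] ℝ) →L[ℝ] V :=
  (ContinuousLinearMap.fst ℝ V (V →L[ℝ] ℝ)).comp
    ((genMetric JA JB).comp (ContinuousLinearMap.inr ℝ V (V →L[ℝ] ℝ)))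

/-- The metric `g : V → V*`. -/
def metric : V →L[ℝ] V →L[ℝ] ℝ := (metricInv JA JB).inverse

/-- The 2-form `b : V → V*`, `b = -g ∘ ρ ∘ G|_V`. It vanishes when `G` is block off-diagonal in
`V ⊕ V*`. -/
def bField : V →L[ℝ] V →L[ℝ] ℝ :=
  -((metric JA JB).comp ((ContinuousLinearMap.fst ℝ V (V →L[ℝ] ℝ)).comp
    ((genMetric JA JB).comp (ContinuousLinearMap.inl ℝ V (V →L[ℝ] ℝ)))))

/-- `I_+ X = ρ(J_A(X + b(X) + g(X)))`. -/
def IPlus : V →L[ℝ] V :=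
  (ContinuousLinearMap.fst ℝ V (V →L[ℝ] ℝ)).comp
    (JA.comp ((ContinuousLinearMap.id ℝ V).prod (bField JA JB + metric JA JB)))

/-- `I_- X = ρ(J_A(X + b(X) - g(X)))`. -/
def IMinus : V →L[ℝ] V :=
  (ContinuousLinearMap.fst ℝ V (V →L[ℝ] ℝ)).comp
    (JA.comp ((ContinuousLinearMap.id ℝ V).prod (bField JA JB - metric JA JB)))

/-- The Hermitian form `ω_+ = g I_+`, as the map `V → V*`, `X ↦ g(I_+ X, ·)`. -/
def omegaPlus : V →L[ℝ] V →L[ℝ] ℝ := (metric JA JB).comp (IPlus JA JB)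

/-- The Hermitian form `ω_- = g I_-`. -/
def omegaMinus : V →L[ℝ] V →L[ℝ] ℝ := (metric JA JB).comp (IMinus JA JB)

/-- The bivector `π_J(α) = ρ(J α)`. -/
def poisson (J : Gen V →L[ℝ] Gen V) : (V →L[ℝ] ℝ) →ₗ[ℝ] V :=
  (LinearMap.fst ℝ V (V →L[ℝ] ℝ)).comp
    ((J : Gen V →ₗ[ℝ] Gen V).comp (LinearMap.inr ℝ V (V →L[ℝ] ℝ)))

end Bihermitian

/-! ### The `(2,1)` part of a 3-form -/

/-- `θ ↦ θ(…, P X_k, …)` where `P = ½(1 - ε i I)` and the complex valued form `θ` is extended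
complex linearly: for `ε = 1` this is the projection of the `k`-th argument to `T_{1,0}`, for
`ε = -1` to `T_{0,1}`. -/
def slotProj (I : V →L[ℝ] V) (ε : ℂ) (k : Fin 3)
    (θ : ContinuousMultilinearMap ℝ (fun _ : Fin 3 => V) ℂ) :
    ContinuousMultilinearMap ℝ (fun _ : Fin 3 => V) ℂ :=
  (1 / 2 : ℂ) • (θ - (ε * Complex.I) • θ.compContinuousLinearMap
    (fun j => if j = k then I else ContinuousLinearMap.id ℝ V))

/-- The `(2,1)` part of a 3-form `θ`: the sum of `θ(QX, PY, PZ)`, `θ(PX, QY, PZ)` and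
`θ(PX, PY, QZ)` with `P`, `Q` the projections to `T_{1,0}`, `T_{0,1}`. -/
def part21 (I : V →L[ℝ] V) (θ : V [⋀^Fin 3]→L[ℝ] ℂ) : V [⋀^Fin 3]→L[ℝ] ℂ where
  toContinuousMultilinearMap :=
    slotProj I (-1) 0 (slotProj I 1 1 (slotProj I 1 2 θ.toContinuousMultilinearMap)) +
    slotProj I 1 0 (slotProj I (-1) 1 (slotProj I 1 2 θ.toContinuousMultilinearMap)) +
    slotProj I 1 0 (slotProj I 1 1 (slotProj I (-1) 2 θ.toContinuousMultilinearMap))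
  map_eq_zero_of_eq' := by
    intro v i j hv hij
    obtain ⟨h, hh⟩ : ∃ h : V → V → V → ℂ, ∀ a b c, h a b c = θ ![a, b, c] := ⟨_, fun _ _ _ => rfl⟩
    have ev : ∀ f : Fin 3 → V, θ f = h (f 0) (f 1) (f 2) := fun f => by
      rw [hh]; congr 1; ext k; fin_cases k <;> rfl
    have s01 : ∀ a b c, h a b c = -h b a c := fun a b c => by
      rw [hh, hh]
      refine Eq.trans ?_ (θ.toAlternatingMap.map_swap ![b, a, c] (i := 0) (j := 1) (by decide))
      change θ _ = θ _
      congr 1; ext k; fin_cases k <;> rfl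
    have s12 : ∀ a b c, h a b c = -h a c b := fun a b c => by
      rw [hh, hh]
      refine Eq.trans ?_ (θ.toAlternatingMap.map_swap ![a, c, b] (i := 1) (j := 2) (by decide))
      change θ _ = θ _
      congr 1; ext k; fin_cases k <;> rfl
    have z01 : ∀ a c, h a a c = 0 := fun a c => by linear_combination (1 / 2 : ℂ) * s01 a a c
    have z12 : ∀ a c, h c a a = 0 := fun a c => by linear_combination (1 / 2 : ℂ) * s12 c a a
    have z02 : ∀ a c, h a c a = 0 := fun a c => by rw [s01, z12, neg_zero]
    have s02 : ∀ a b c, h a b c = -h c b a := fun a b c => by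
      rw [s01, s12, s01]; ring
    simp only [slotProj]
    fin_cases i <;> fin_cases j <;> simp [ev] at hij hv ⊢ <;> rw [hv] <;> simp only [z01, z02, z12]
    · rw [s01 (I (v 1)) (v 1) (v 2), s01 (I (v 1)) (v 1) (I (v 2))]; ring
    · rw [s02 (I (v 2)) (v 1) (v 2), s02 (I (v 2)) (I (v 1)) (v 2)]; ring
    · rw [s01 (I (v 0)) (v 0) (v 2), s01 (I (v 0)) (v 0) (I (v 2))]; ring
    · rw [s12 (v 0) (I (v 2)) (v 2), s12 (I (v 0)) (I (v 2)) (v 2)]; ring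
    · rw [s02 (I (v 0)) (v 1) (v 0), s02 (I (v 0)) (I (v 1)) (v 0)]; ring
    · rw [s12 (v 0) (I (v 1)) (v 1), s12 (I (v 0)) (I (v 1)) (v 1)]; ring

/-- The 2-form `(u, v) ↦ B(u, v)` of a skew-symmetric bilinear form `B : V → V*`. (For an arbitrary
`B` this is the skew-symmetric part of `B`.) -/
def twoForm [T2Space V] [FiniteDimensional ℝ V] (B : V →L[ℝ] V →L[ℝ] ℝ) : V [⋀^Fin 2]→L[ℝ] ℝ where
  toFun v := (1 / 2) * (B (v 0) (v 1) - B (v 1) (v 0))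
  map_update_add' := by
    intro inst v i x y
    obtain rfl : inst = instDecidableEqFin 2 := Subsingleton.elim _ _
    fin_cases i <;> simp <;> ring
  map_update_smul' := by
    intro inst v i c x
    obtain rfl : inst = instDecidableEqFin 2 := Subsingleton.elim _ _
    fin_cases i <;> simp <;> ring
  map_eq_zero_of_eq' := by
    intro v i j hv hij
    fin_cases i <;> fin_cases j <;> simp at hij hv ⊢ <;> simp [hv]
  cont := by
    have key : ∀ i j : Fin 2, Continuous fun v : Fin 2 → V => B (v i) (v j) := by
      intro i j
      let e := Module.finBasis ℝ V
      have h : (fun v : Fin 2 → V => B (v i) (v j)) =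
          fun v => ∑ k, e.coord k (v i) * B (e k) (v j) := by
        funext v
        have hv : B (v i) = ∑ k, e.coord k (v i) • B (e k) := by
          conv_lhs => rw [← e.sum_repr (v i)]
          rw [map_sum]
          simp only [map_smul, Module.Basis.coord_apply]
        rw [hv]
        simp [_root_.sum_apply]
      rw [h]
      refine continuous_finsetSum _ fun k _ => Continuous.mul ?_ ?_
      · exact (e.coord k).continuous_of_finiteDimensional.comp (continuous_apply i)
      · exact (B (e k)).continuous.comp (continuous_apply j)
    exact continuous_const.mul ((key 0 1).sub (key 1 0))

theorem twoForm_apply [T2Space V] [FiniteDimensional ℝ V] (B : V →L[ℝ] V →L[ℝ] ℝ)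
    (hB : ∀ u v, B u v = -B v u) (u v : V) : twoForm B ![u, v] = B u v := by
  change (1 / 2) * (B u v - B v u) = B u v
  rw [hB v u]; ring

end LinearAlgebra

/-! ## Tensor calculus on a manifold -/

section Manifold

variable {E : Type*} [NormedAddCommGroup E] [NormedSpace ℝ E]
  {M : Type*} [TopologicalSpace M] [ChartedSpace E M]

instance (x : M) : T2Space (TangentSpace 𝓘(ℝ, E) x) := inferInstanceAs (T2Space E)

instance [FiniteDimensional ℝ E] (x : M) : FiniteDimensional ℝ (TangentSpace 𝓘(ℝ, E) x) :=
  inferInstanceAs (FiniteDimensional ℝ E)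

variable (E) in
/-- The fibre `T_x M ⊕ T_x^* M` of `𝕋M`. -/
abbrev GT (x : M) : Type _ := Gen (TangentSpace 𝓘(ℝ, E) x)

variable (E M) in
/-- Differential forms of degree `n` with values in `F` (no regularity is imposed). -/
abbrev Form (n : ℕ) (F : Type*) [NormedAddCommGroup F] [NormedSpace ℝ F] : Type _ :=
  ∀ x : M, TangentSpace 𝓘(ℝ, E) x [⋀^Fin n]→L[ℝ] F

variable (E M) in
/-- Sections of `𝕋M` (no regularity is imposed). -/
abbrev GSection : Type _ := ∀ x : M, GT E x

section Forms

variable {F : Type*} [NormedAddCommGroup F] [NormedSpace ℝ F] {n : ℕ}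

/-- The form `η` in the preferred chart `φ` at `x₀`, that is, `(φ⁻¹)^* η`. -/
def chartForm (η : Form E M n F) (x₀ : M) (y : E) : E [⋀^Fin n]→L[ℝ] F :=
  (η ((extChartAt 𝓘(ℝ, E) x₀).symm y)).compContinuousLinearMap
    (mfderiv 𝓘(ℝ, E) 𝓘(ℝ, E) (extChartAt 𝓘(ℝ, E) x₀).symm y)

/-- Smoothness of a differential form: smoothness in charts. -/
def IsSmoothForm (η : Form E M n F) : Prop :=
  ∀ x₀ : M, ContDiffOn ℝ ∞ (chartForm η x₀) (extChartAt 𝓘(ℝ, E) x₀).target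

/-- The exterior derivative, computed at `x` in the preferred chart `φ` at `x`:
`(dη)_x = φ^* (d ((φ⁻¹)^* η))`. -/
def extD (η : Form E M n F) : Form E M (n + 1) F := fun x =>
  (extDeriv (chartForm η x) (extChartAt 𝓘(ℝ, E) x x)).compContinuousLinearMap
    (mfderiv 𝓘(ℝ, E) 𝓘(ℝ, E) (extChartAt 𝓘(ℝ, E) x) x)

/-- A smooth closed form. -/
def IsClosedForm (η : Form E M n F) : Prop := IsSmoothForm η ∧ extD η = 0

end Forms

/-- Smoothness of a vector field. -/
def IsSmoothField (X : ∀ x : M, TangentSpace 𝓘(ℝ, E) x) [IsManifold 𝓘(ℝ, E) ∞ M] : Prop :=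
  ContMDiff 𝓘(ℝ, E) 𝓘(ℝ, E).tangent ∞ (fun x => (⟨x, X x⟩ : TangentBundle 𝓘(ℝ, E) M))

/-- A 1-form, given as a section of `T^*M`, as a differential form. -/
def oneForm (α : ∀ x : M, TangentSpace 𝓘(ℝ, E) x →L[ℝ] ℝ) : Form E M 1 ℝ := fun x =>
  ContinuousAlternatingMap.ofSubsingleton ℝ (TangentSpace 𝓘(ℝ, E) x) ℝ (0 : Fin 1) (α x)

/-- Smoothness of a section `X + α` of `𝕋M`. -/
def IsSmoothSection [IsManifold 𝓘(ℝ, E) ∞ M] (s : GSection E M) : Prop :=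
  IsSmoothField (fun x => (s x).1) ∧ IsSmoothForm (oneForm fun x => (s x).2)

/-- The contraction `ι_X η = η(X, ·)` of a 2-form with a vector. -/
def contract₂ {x : M} (η : TangentSpace 𝓘(ℝ, E) x [⋀^Fin 2]→L[ℝ] ℝ) (X : TangentSpace 𝓘(ℝ, E) x) :
    TangentSpace 𝓘(ℝ, E) x →L[ℝ] ℝ :=
  η.toContinuousLinearMap ![X, 0] 1

/-- The double contraction `ι_X ι_Y η = η(Y, X, ·)` of a 3-form. -/
def contract₃ {x : M} (η : TangentSpace 𝓘(ℝ, E) x [⋀^Fin 3]→L[ℝ] ℝ)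
    (X Y : TangentSpace 𝓘(ℝ, E) x) : TangentSpace 𝓘(ℝ, E) x →L[ℝ] ℝ :=
  η.toContinuousLinearMap ![Y, X, 0] 2

/-- The Lie derivative of a 1-form, `L_X β = d(ι_X β) + ι_X dβ`. -/
def lieDeriv (X : ∀ x : M, TangentSpace 𝓘(ℝ, E) x) (β : ∀ x : M, TangentSpace 𝓘(ℝ, E) x →L[ℝ] ℝ)
    (x : M) : TangentSpace 𝓘(ℝ, E) x →L[ℝ] ℝ :=
  mvfderiv 𝓘(ℝ, E) (fun y => β y (X y)) x + contract₂ (extD (oneForm β) x) (X x)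

/-- The Courant bracket
`[X + α, Y + β]_H = [X, Y] + L_X β - ι_Y dα + ι_X ι_Y H`. -/
def courant (H : Form E M 3 ℝ) (s t : GSection E M) : GSection E M := fun x =>
  (VectorField.mlieBracket 𝓘(ℝ, E) (fun y => (s y).1) (fun y => (t y).1) x,
    lieDeriv (fun y => (s y).1) (fun y => (t y).2) x
      - contract₂ (extD (oneForm fun y => (s y).2) x) (t x).1
      + contract₃ (H x) (s x).1 (t x).1)

/-- The complex bilinear extension of the Courant bracket to sections of `𝕋M ⊗ ℂ`. -/
def courantC (H : Form E M 3 ℝ) (s t : ∀ x : M, Cx (GT E x)) : ∀ x : M, Cx (GT E x) := fun x =>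
  ⟨courant H (fun y => (s y).re) (fun y => (t y).re) x
      - courant H (fun y => (s y).im) (fun y => (t y).im) x,
    courant H (fun y => (s y).re) (fun y => (t y).im) x
      + courant H (fun y => (s y).im) (fun y => (t y).re) x⟩

/-! ## Generalized Kähler structures -/

variable [IsManifold 𝓘(ℝ, E) ∞ M]

/-- `J` is a generalized complex structure on `(M, H)`: a smooth complex structure on `𝕋M` whose
`+i` eigenbundle is maximal isotropic and involutive for the Courant bracket. -/
structure IsGenComplex (H : Form E M 3 ℝ) (J : ∀ x : M, GT E x →L[ℝ] GT E x) : Prop where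
  sq : ∀ x u, J x (J x u) = -u
  smooth : ∀ s : GSection E M, IsSmoothSection s → IsSmoothSection fun x => J x (s x)
  lagrangian : ∀ x, IsLagrangianC (eigenC (J x))
  involutive : ∀ s t : ∀ x : M, Cx (GT E x),
    IsSmoothSection (fun x => (s x).re) → IsSmoothSection (fun x => (s x).im) →
    IsSmoothSection (fun x => (t x).re) → IsSmoothSection (fun x => (t x).im) →
    (∀ x, s x ∈ eigenC (J x)) → (∀ x, t x ∈ eigenC (J x)) →
    ∀ x, courantC H s t x ∈ eigenC (J x)

/-- `(J_A, J_B)` is a generalized Kähler structure on `(M, H)`. -/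
structure IsGenKahler (H : Form E M 3 ℝ) (JA JB : ∀ x : M, GT E x →L[ℝ] GT E x) : Prop where
  genComplexA : IsGenComplex H JA
  genComplexB : IsGenComplex H JB
  comm : ∀ x u, JA x (JB x u) = JB x (JA x u)
  pos : ∀ x u, u ≠ 0 → 0 < pairing (JA x u) (JB x u)

/-! ## Real Manin triples -/

variable (E M) in
/-- The data of a triple `((𝕋M, H), A, B)`: the bundle `𝕋M` with its projection to `TM`, its pairing
and the Courant bracket `[·,·]_H`, and two families of subspaces. -/
structure RealTriple where
  H : Form E M 3 ℝ
  A : ∀ x : M, Submodule ℝ (GT E x)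
  B : ∀ x : M, Submodule ℝ (GT E x)

/-- `L` is a Dirac structure in `(𝕋M, H)`: a smooth subbundle (through every point of which there is
a smooth section) which is maximal isotropic and involutive. -/
structure IsDirac (H : Form E M 3 ℝ) (L : ∀ x : M, Submodule ℝ (GT E x)) : Prop where
  smooth : ∀ x, ∀ u ∈ L x, ∃ s : GSection E M, IsSmoothSection s ∧ (∀ y, s y ∈ L y) ∧ s x = u
  lagrangian : ∀ x, IsLagrangian (L x)
  involutive : ∀ s t : GSection E M, IsSmoothSection s → IsSmoothSection t →
    (∀ x, s x ∈ L x) → (∀ x, t x ∈ L x) → ∀ x, courant H s t x ∈ L x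

/-- `((𝕋M, H), A, B)` is a Manin triple: `H` is closed (so that `(𝕋M, H)` is a Courant algebroid),
and `A`, `B` are Dirac structures with `𝕋M = A ⊕ B`. -/
structure IsManinTriple (T : RealTriple E M) : Prop where
  closed : IsClosedForm T.H
  diracA : IsDirac T.H T.A
  diracB : IsDirac T.H T.B
  compl : ∀ x, IsCompl (T.A x) (T.B x)

/-- `Φ` is an isomorphism from the Manin triple `S` to the Manin triple `T`: an isomorphism of
smooth vector bundles, compatible with the projections to `TM`, the pairings and the Courant
brackets, which takes the Dirac structures of `S` to those of `T`. -/
structure IsManinIso (Φ : ∀ x : M, GT E x ≃ₗ[ℝ] GT E x) (S T : RealTriple E M) : Prop where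
  source : IsManinTriple S
  target : IsManinTriple T
  smooth : ∀ s : GSection E M, IsSmoothSection s ↔ IsSmoothSection fun x => Φ x (s x)
  anchor : ∀ x u, (Φ x u).1 = u.1
  pairing : ∀ x u v, pairing (Φ x u) (Φ x v) = pairing u v
  bracket : ∀ s t : GSection E M, IsSmoothSection s → IsSmoothSection t →
    ∀ x, Φ x (courant S.H s t x) = courant T.H (fun y => Φ y (s y)) (fun y => Φ y (t y)) x
  mapA : ∀ x, (S.A x).map (Φ x : GT E x →ₗ[ℝ] GT E x) = T.A x
  mapB : ∀ x, (S.B x).map (Φ x : GT E x →ₗ[ℝ] GT E x) = T.B x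

/-! ## The holomorphic Manin triples of a generalized Kähler structure -/

variable (E M) in
/-- The data `(ℰ, 𝒜, ℬ)` of a holomorphic Manin triple over `X = (M, I)`: the complex structure `I`;
the closed complex 3-form `𝓗` of type `(2,1) + (3,0)` which determines the holomorphic Courant
algebroid `ℰ = 𝕋_{1,0}X`; and the subbundles `𝒜`, `ℬ` of `𝕋_{1,0}X ⊂ 𝕋M ⊗ ℂ`. -/
structure HolTriple where
  I : ∀ x : M, TangentSpace 𝓘(ℝ, E) x →L[ℝ] TangentSpace 𝓘(ℝ, E) x
  curv : Form E M 3 ℂ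
  A : ∀ x : M, Submodule ℂ (Cx (GT E x))
  B : ∀ x : M, Submodule ℂ (Cx (GT E x))

/-- The real part: the matched pair of `ℰ` is `𝕋M ⊗ ℂ` with the Courant bracket twisted by `𝓗`, so
its real part is `(𝕋M, Re 𝓗)`; the real parts of `𝒜`, `ℬ` are those of their matched pairs. -/
def HolTriple.re (T : HolTriple E M) : RealTriple E M where
  H x := Complex.reCLM.compContinuousAlternatingMap (T.curv x)
  A x := realPart (matchedPair (T.I x) (T.A x))
  B x := realPart (matchedPair (T.I x) (T.B x))

/-- The imaginary part of `(ℰ, 𝒜, ℬ)`. -/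
def HolTriple.im (T : HolTriple E M) : RealTriple E M where
  H x := Complex.imCLM.compContinuousAlternatingMap (T.curv x)
  A x := imagPart (matchedPair (T.I x) (T.A x))
  B x := imagPart (matchedPair (T.I x) (T.B x))

/-- `∂w`, the `(2,1)` part of `dw`, for a real 2-form `w` of type `(1,1)` on `(M, I)`, given as
a map `TM → T^*M`. -/
def del [FiniteDimensional ℝ E] (I : ∀ x : M, TangentSpace 𝓘(ℝ, E) x →L[ℝ] TangentSpace 𝓘(ℝ, E) x)
    (w : ∀ x : M, TangentSpace 𝓘(ℝ, E) x →L[ℝ] TangentSpace 𝓘(ℝ, E) x →L[ℝ] ℝ) : Form E M 3 ℂ :=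
  fun x => part21 (I x)
    (Complex.ofRealCLM.compContinuousAlternatingMap (extD (fun y => twoForm (w y)) x))

variable [FiniteDimensional ℝ E]

/-- The triple `(ℰ_+, 𝒜_+, ℬ_+)` over `(M, I_+)`:
`𝓗_+ = -2i ∂_+ ω_+`, `𝒜_+ = 𝕋_{1,0} ∩ e^{-b - iω_+}(L̄_A)`, `ℬ_+ = 𝕋_{1,0} ∩ e^{-b - iω_+}(L̄_B)`,
where `L_A`, `L_B` are the `+i` eigenbundles of `J_A`, `J_B`. -/
def holPlus (JA JB : ∀ x : M, GT E x →L[ℝ] GT E x) : HolTriple E M where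
  I x := IPlus (JA x) (JB x)
  curv x := (-2 * Complex.I) •
    del (fun y => IPlus (JA y) (JB y)) (fun y => omegaPlus (JA y) (JB y)) x
  A x := TT10 (IPlus (JA x) (JB x)) ⊓ (Cx.conjSubmodule (eigenC (JA x))).map
    (gaugeC (-bField (JA x) (JB x)) (-omegaPlus (JA x) (JB x)))
  B x := TT10 (IPlus (JA x) (JB x)) ⊓ (Cx.conjSubmodule (eigenC (JB x))).map
    (gaugeC (-bField (JA x) (JB x)) (-omegaPlus (JA x) (JB x)))

/-- The triple `(ℰ_-, 𝒜_-, ℬ_-)` over `(M, I_-)`: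
`𝓗_- = 2i ∂_- ω_-`, `𝒜_- = 𝕋_{1,0} ∩ e^{-b + iω_-}(L̄_A)`, `ℬ_- = 𝕋_{1,0} ∩ e^{-b + iω_-}(L_B)`. -/
def holMinus (JA JB : ∀ x : M, GT E x →L[ℝ] GT E x) : HolTriple E M where
  I x := IMinus (JA x) (JB x)
  curv x := (2 * Complex.I) •
    del (fun y => IMinus (JA y) (JB y)) (fun y => omegaMinus (JA y) (JB y)) x
  A x := TT10 (IMinus (JA x) (JB x)) ⊓ (Cx.conjSubmodule (eigenC (JA x))).map
    (gaugeC (-bField (JA x) (JB x)) (omegaMinus (JA x) (JB x)))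
  B x := TT10 (IMinus (JA x) (JB x)) ⊓ (eigenC (JB x)).map
    (gaugeC (-bField (JA x) (JB x)) (omegaMinus (JA x) (JB x)))

end Manifold

end GenKahler

end

noncomputable section

set_option linter.unusedSectionVars false
set_option synthInstance.maxHeartbeats 200000

/-! Both signs are instances of one statement. On the graph `C_±` of `b ± g` one has `J_B = ±J_A`.
Take `(J, K, I, F)` to be `(J_A, J_B, I_+, ω_+)` or `(J_A, -J_B, I_-, -ω_-)`. Then `J` and `K` agree
exactly on the graph of `b - F I`, and either triple is the one with curvature `-2i ∂F` and
subbundles `𝕋_{1,0} ∩ e^{-b-iF}(L̄_J)`, `𝕋_{1,0} ∩ e^{-b-iF}(L̄_K)` (`holTriple`, `holMinus_eq`).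

Fibrewise, `J` acts on that graph through `I`, which says that `e^{b+iF}` maps `T_{0,1}` into
`L̄_J`. Since `L̄_J` is isotropic, the matched pair of the first subbundle is all of
`e^{-b-iF}(L̄_J)` (`matchedPair_eq`). Its real part, moved by `e^b`, consists of the real `v` with
`J v ∈ T^*`, which is `J(T^*)`. Its imaginary part, moved by `e^F`, consists of the `X + ξ` for
which `J ξ` has tangent component `-X`, which is `Gr(-π_J)` (`map_gauge_realPart`,
`map_gauge_imagPart`). The same holds for `K`.

For the brackets, `e^F` carries the bracket twisted by `H - dF` to the one twisted by `H`
(`gauge_courant`). It remains to see that `-2i ∂F = (H - db) - i dF`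
(`IsBihermitianField.curv_apply`). The Nijenhuis identities of `J` and `K`, applied to sections of
their common graph, involve the same brackets; hence `[s', t'] - [s, t]` is again a section of the
graph, and the identity can be written through `I` and `F` (`courant_graph`). Its tangent component
is the integrability of `I`, so `dF` has type `(2,1) + (1,2)` and `dF = 2 Re ∂F`. Its cotangent
component relates `H - db` to `dF` and yields `H - db = -dF(I·, I·, I·) = 2 Im ∂F`.

The target triples are Manin triples because the Nijenhuis identity on 1-forms makes `J(T^*)`
involutive and `π_J` Poisson, and definiteness of `⟨J·, K·⟩` makes the two Dirac structures
transverse. The source triples inherit everything through the gauge transformation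
(`isManinIso_gauge`). -/

namespace GenKahler

/-! ### Linear algebra of eigenspaces, matched pairs, and real and imaginary parts. -/

section FibrewiseAlgebra

variable {V : Type*} [AddCommGroup V] [Module ℝ V] [TopologicalSpace V]

theorem pairing_comm (u v : Gen V) : pairing u v = pairing v u := by
  simp only [pairing, add_comm]

theorem pairing_neg_left (u v : Gen V) : pairing (-u) v = -pairing u v := by
  simp only [pairing, Prod.fst_neg, Prod.snd_neg, map_neg, neg_apply]; ring

theorem pairing_neg_right (u v : Gen V) : pairing u (-v) = -pairing u v := by
  rw [pairing_comm, pairing_neg_left, pairing_comm]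

theorem clm_map_neg (J : Gen V →L[ℝ] Gen V) (u : Gen V) : J (-u) = -J u :=
  LinearMap.map_neg (J : Gen V →ₗ[ℝ] Gen V) u

theorem clm_map_sub (J : Gen V →L[ℝ] Gen V) (u v : Gen V) : J (u - v) = J u - J v :=
  LinearMap.map_sub (J : Gen V →ₗ[ℝ] Gen V) u v

theorem clm_map_add (J : Gen V →L[ℝ] Gen V) (u v : Gen V) : J (u + v) = J u + J v :=
  LinearMap.map_add (J : Gen V →ₗ[ℝ] Gen V) u v

theorem clm_neg_apply [IsTopologicalAddGroup V] [ContinuousSMul ℝ V] (J : Gen V →L[ℝ] Gen V)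
    (u : Gen V) : (-J) u = -J u := rfl

/-- A complex structure `J` on `V ⊕ V*` which preserves the pairing. -/
structure IsOrthComplex (J : Gen V →L[ℝ] Gen V) : Prop where
  sq : ∀ u, J (J u) = -u
  orth : ∀ u v, pairing (J u) (J v) = pairing u v

namespace IsOrthComplex

variable {J : Gen V →L[ℝ] Gen V}

theorem skew (h : IsOrthComplex J) (u v : Gen V) : pairing (J u) v = -pairing u (J v) := by
  rw [← h.orth u (J v), h.sq, pairing_neg_right, neg_neg]

theorem neg [IsTopologicalAddGroup V] [ContinuousSMul ℝ V] (h : IsOrthComplex J) : IsOrthComplex (-J) where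
  sq u := by
    change -(J (-(J u))) = -u
    rw [clm_map_neg, h.sq, neg_neg]
  orth u v := by
    change pairing (-(J u)) (-(J v)) = _
    rw [pairing_neg_left, pairing_neg_right, neg_neg, h.orth]

end IsOrthComplex

theorem mem_eigenC {J : Gen V →L[ℝ] Gen V} {w : Cx (Gen V)} :
    w ∈ eigenC J ↔ J w.re = -w.im ∧ J w.im = w.re := by
  rw [eigenC, Module.End.mem_eigenspace_iff, Cx.ext_iff]
  simp [Cx.map]

theorem mem_conj_eigenC {J : Gen V →L[ℝ] Gen V} {w : Cx (Gen V)} :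
    w ∈ Cx.conjSubmodule (eigenC J) ↔ J w.re = w.im ∧ J w.im = -w.re := by
  change Cx.conj w ∈ eigenC J ↔ _
  rw [mem_eigenC]
  simp only [Cx.conj, clm_map_neg, neg_neg]
  rw [neg_eq_iff_eq_neg]

/-- This absorbs the asymmetry of the minus triple, where `L_B` appears instead of its conjugate:
passing from `J_B` to `-J_B` restores the form of the plus triple. -/
theorem conj_eigenC_neg [IsTopologicalAddGroup V] [ContinuousSMul ℝ V] (J : Gen V →L[ℝ] Gen V) :
    Cx.conjSubmodule (eigenC (-J)) = eigenC J := by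
  ext w
  rw [mem_conj_eigenC, mem_eigenC]
  simp only [neg_apply, neg_inj]
  rw [neg_eq_iff_eq_neg]

theorem isOrthComplex_of_lagrangian {J : Gen V →L[ℝ] Gen V} (sq : ∀ u, J (J u) = -u)
    (hL : IsLagrangianC (eigenC J)) : IsOrthComplex J where
  sq := sq
  orth u v := by
    -- Every vector of the `+i` eigenspace has the form `J u + i u`; isotropy of two such vectors
    -- has real part `⟨J u, J v⟩ - ⟨u, v⟩ = 0`.
    have hm : ∀ u, (⟨J u, u⟩ : Cx (Gen V)) ∈ eigenC J := fun u => mem_eigenC.2 ⟨sq u, rfl⟩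
    have := congrArg Complex.re ((hL _).1 (hm u) _ (hm v))
    simpa [pairingC, sub_eq_zero] using this

theorem mem_imageCotangent {J : Gen V →L[ℝ] Gen V} {u : Gen V} :
    u ∈ imageCotangent J ↔ ∃ α : V →L[ℝ] ℝ, J (0, α) = u := by
  simp [imageCotangent]

theorem mem_graph {P : (V →L[ℝ] ℝ) →ₗ[ℝ] V} {u : Gen V} : u ∈ graph P ↔ P u.2 = u.1 := by
  constructor
  · rintro ⟨α, rfl⟩; rfl
  · intro h; exact ⟨u.2, Prod.ext h rfl⟩

theorem mem_realPart_iff {L : Submodule ℂ (Cx (Gen V))} {u : Gen V} :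
    u ∈ realPart L ↔ ∃ w ∈ L, ∃ w', Cx.conj w' ∈ L ∧ w.re.1 = u.1 ∧ w.im.1 = 0 ∧
      w'.re.1 = u.1 ∧ w'.im.1 = 0 ∧ w.re.2 + w'.re.2 = (2 : ℝ) • u.2 ∧ w.im.2 + w'.im.2 = 0 := by
  constructor
  · rintro ⟨w, hw, w', hw', h1, h2, h3⟩
    rw [Cx.ext_iff] at h1 h2 h3
    refine ⟨w, hw, w', hw', h1.1, h1.2, h2.1, h2.2, ?_, ?_⟩
    · have := h3.1
      simp [formC, Cx.map, Cx.ofReal] at this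
      rw [← this]; module
    · have := h3.2
      simp [formC, Cx.map, Cx.ofReal] at this
      calc w.im.2 + w'.im.2 = (2 : ℝ) • ((2⁻¹ : ℝ) • w.im.2 + (2⁻¹ : ℝ) • w'.im.2) := by module
        _ = 0 := by rw [this, smul_zero]
  · rintro ⟨w, hw, w', hw', h1, h2, h3, h4, h5, h6⟩
    refine ⟨w, hw, w', hw', Cx.ext h1 h2, Cx.ext h3 h4, Cx.ext ?_ ?_⟩
    · simp [formC, Cx.map, Cx.ofReal]
      rw [← smul_add, h5, smul_smul]; norm_num
    · simp [formC, Cx.map, Cx.ofReal]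
      rw [← smul_add, h6, smul_zero]

theorem mem_imagPart_iff {L : Submodule ℂ (Cx (Gen V))} {u : Gen V} :
    u ∈ imagPart L ↔ ∃ w ∈ L, ∃ w', Cx.conj w' ∈ L ∧ w.re.1 = u.1 ∧ w.im.1 = 0 ∧
      w'.re.1 = u.1 ∧ w'.im.1 = 0 ∧ w.re.2 = w'.re.2 ∧ w.im.2 - w'.im.2 = (2 : ℝ) • u.2 := by
  have hI : (1 / (2 * Complex.I) : ℂ) = ⟨0, -1 / 2⟩ := by
    apply Complex.ext <;> simp [Complex.inv_re, Complex.inv_im]; norm_num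
  constructor
  · rintro ⟨w, hw, w', hw', h1, h2, h3⟩
    rw [Cx.ext_iff, hI] at h3
    rw [Cx.ext_iff] at h1 h2
    refine ⟨w, hw, w', hw', h1.1, h1.2, h2.1, h2.2, ?_, ?_⟩
    · have := h3.2
      simp [formC, Cx.map, Cx.ofReal] at this
      simpa [sub_eq_zero] using this
    · have := h3.1
      simp [formC, Cx.map, Cx.ofReal] at this
      rw [← this]; module
  · rintro ⟨w, hw, w', hw', h1, h2, h3, h4, h5, h6⟩
    refine ⟨w, hw, w', hw', Cx.ext h1 h2, Cx.ext h3 h4, Cx.ext ?_ ?_⟩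
    · rw [hI]
      simp [formC, Cx.map, Cx.ofReal, h5]
      rw [h6, smul_smul]; module
    · rw [hI]
      simp [formC, Cx.map, Cx.ofReal, h5, h6]

theorem gaugeC_apply [IsTopologicalAddGroup V] [ContinuousSMul ℝ V] (B C : V →L[ℝ] V →L[ℝ] ℝ)
    (w : Cx (Gen V)) :
    gaugeC B C w = ⟨(w.re.1, w.re.2 + B w.re.1 - C w.im.1),
      (w.im.1, w.im.2 + B w.im.1 + C w.re.1)⟩ := by
  refine Cx.ext (Prod.ext ?_ ?_) (Prod.ext ?_ ?_)
  · simp [gaugeC, gaugeNil, Cx.map]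
  · simp [gaugeC, gaugeNil, Cx.map]; abel
  · simp [gaugeC, gaugeNil, Cx.map]
  · simp [gaugeC, gaugeNil, Cx.map]

theorem mem_T01 {I : V →L[ℝ] V} {w : Cx (Gen V)} :
    w ∈ T01 I ↔ (I w.re.1 = w.im.1 ∧ I w.im.1 = -w.re.1) ∧ w.re.2 = 0 ∧ w.im.2 = 0 := by
  simp only [T01, Submodule.mem_inf, Submodule.mem_comap, Module.End.mem_eigenspace_iff,
    LinearMap.mem_ker, Cx.ext_iff]
  simp [tangentC, formC, Cx.map]

theorem mem_TT10 [IsTopologicalAddGroup V] [ContinuousSMul ℝ V] {I : V →L[ℝ] V}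
    {w : Cx (Gen V)} :
    w ∈ TT10 I ↔ (I w.re.1 = -w.im.1 ∧ I w.im.1 = w.re.1) ∧
      (∀ X, w.re.2 (I X) = -w.im.2 X) ∧ ∀ X, w.im.2 (I X) = w.re.2 X := by
  simp only [TT10, Submodule.mem_inf, Submodule.mem_comap, Module.End.mem_eigenspace_iff,
    Cx.ext_iff, ContinuousLinearMap.ext_iff]
  simp [tangentC, formC, Cx.map]

/-- For `w ∈ L`, orthogonality to `T_{0,1}` says that the cotangent part of `w` kills `T_{0,1}`, so
it already has type `(1,0)`. Only the tangent part needs correcting, by an element of `T_{0,1} ≤ L`.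
-/
theorem matchedPair_TT10_inf [IsTopologicalAddGroup V] [ContinuousSMul ℝ V] {I : V →L[ℝ] V}
    (hI : ∀ X, I (I X) = -X) {L : Submodule ℂ (Cx (Gen V))} (hT : T01 I ≤ L)
    (hL : ∀ w ∈ L, ∀ t ∈ T01 I, pairingC w t = 0) : matchedPair I (TT10 I ⊓ L) = L := by
  refine le_antisymm (sup_le inf_le_right hT) fun w hw => ?_
  -- The projection `½(1 + iI)` of the tangent part of `w` to `T_{0,1}`.
  let z : Cx (Gen V) := ⟨((1 / 2 : ℝ) • (w.re.1 - I w.im.1), 0),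
    ((1 / 2 : ℝ) • (w.im.1 + I w.re.1), 0)⟩
  have hz : z ∈ T01 I := by
    refine mem_T01.2 ⟨⟨?_, ?_⟩, rfl, rfl⟩
    · simp only [z, map_smul, map_sub, hI]; module
    · simp only [z, map_smul, map_add, hI]; module
  -- Test vectors `X + i I X`, which exhaust `T_{0,1}`; the two equations are the real and imaginary
  -- parts of the pairing.
  have key : ∀ X, w.re.2 X - w.im.2 (I X) = 0 ∧ w.re.2 (I X) + w.im.2 X = 0 := fun X => by
    have := hL w hw ⟨(X, 0), (I X, 0)⟩ (mem_T01.2 ⟨⟨rfl, hI X⟩, rfl, rfl⟩)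
    rw [Complex.ext_iff] at this
    simpa [pairingC, pairing] using this
  have hwz : w = (w - z) + z := (sub_add_cancel w z).symm
  rw [hwz]
  refine Submodule.add_mem_sup ⟨mem_TT10.2 ⟨⟨?_, ?_⟩, fun X => ?_, fun X => ?_⟩,
    L.sub_mem hw (hT hz)⟩ hz
  · simp only [z, Cx.sub_re, Cx.sub_im, Prod.fst_sub, map_smul, map_sub, hI]; module
  · simp only [z, Cx.sub_re, Cx.sub_im, Prod.fst_sub, map_smul, map_sub, map_add, hI]; module
  · have := (key X).2
    simp only [z, Cx.sub_re, Cx.sub_im, Prod.snd_sub, sub_zero]; linarith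
  · have := (key X).1
    simp only [z, Cx.sub_re, Cx.sub_im, Prod.snd_sub, sub_zero]; linarith

theorem pairingC_gaugeC [IsTopologicalAddGroup V] [ContinuousSMul ℝ V]
    {B C : V →L[ℝ] V →L[ℝ] ℝ} (hB : ∀ X Y, B X Y = -B Y X) (hC : ∀ X Y, C X Y = -C Y X)
    (u v : Cx (Gen V)) : pairingC (gaugeC B C u) (gaugeC B C v) = pairingC u v := by
  rw [gaugeC_apply, gaugeC_apply]
  apply Complex.ext
  · simp only [pairingC, pairing, add_apply, sub_apply]
    rw [hB v.re.1, hB v.im.1, hC v.re.1, hC v.im.1]; ring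
  · simp only [pairingC, pairing, add_apply, sub_apply]
    rw [hB v.re.1, hB v.im.1, hC v.re.1, hC v.im.1]; ring

theorem mem_map_gaugeC_neg [IsTopologicalAddGroup V] [ContinuousSMul ℝ V]
    (B C : V →L[ℝ] V →L[ℝ] ℝ) (L : Submodule ℂ (Cx (Gen V))) (w : Cx (Gen V)) :
    w ∈ L.map (gaugeC (-B) (-C)) ↔ gaugeC B C w ∈ L := by
  constructor
  · rintro ⟨w, hw, rfl⟩
    have : gaugeC B C (gaugeC (-B) (-C) w) = w := by
      rw [gaugeC_apply, gaugeC_apply]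
      refine Cx.ext (Prod.ext rfl ?_) (Prod.ext rfl ?_) <;> simp only [neg_apply] <;> abel
    rwa [this]
  · intro h
    refine ⟨_, h, ?_⟩
    rw [gaugeC_apply, gaugeC_apply]
    refine Cx.ext (Prod.ext rfl ?_) (Prod.ext rfl ?_) <;> simp only [neg_apply] <;> abel

theorem pairingC_conj_eigenC {J : Gen V →L[ℝ] Gen V} (hJ : IsOrthComplex J) {u v : Cx (Gen V)}
    (hu : u ∈ Cx.conjSubmodule (eigenC J)) (hv : v ∈ Cx.conjSubmodule (eigenC J)) :
    pairingC u v = 0 := by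
  rw [mem_conj_eigenC] at hu hv
  apply Complex.ext
  · simp only [pairingC, ← hu.1, ← hv.1, hJ.orth, sub_self, Complex.zero_re]
  · simp only [pairingC, ← hu.1, ← hv.1, hJ.skew, add_neg_cancel, Complex.zero_im]

/-! ### Real and imaginary parts of `e^{-B-iF}(L̄_J)`. -/

section Gauge

variable [IsTopologicalAddGroup V] [ContinuousSMul ℝ V] {J : Gen V →L[ℝ] Gen V}
  {B F : V →L[ℝ] V →L[ℝ] ℝ}

/-- Membership of `X + α` in `e^{-B-iF}(L̄_J)` means that `J` sends `X + B X + Re α` to `Im α + F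
X`. So the real vector, after `e^B`, is exactly one that `J` sends into the cotangent space. -/
theorem map_gauge_realPart (hJ : IsOrthComplex J) :
    (realPart ((Cx.conjSubmodule (eigenC J)).map (gaugeC (-B) (-F)))).map
      (gauge B : Gen V →ₗ[ℝ] Gen V) = imageCotangent J := by
  ext u
  rw [mem_imageCotangent]
  constructor
  · rintro ⟨u, hu, rfl⟩
    obtain ⟨w, hw, w', hw', h1, h2, h3, h4, h5, h6⟩ := mem_realPart_iff.1 hu
    rw [mem_map_gaugeC_neg, gaugeC_apply, mem_conj_eigenC] at hw hw'
    simp only [Cx.conj, h1, h2, h3, h4, Prod.fst_neg, neg_zero, map_zero, add_zero, sub_zero,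
      Prod.snd_neg] at hw hw'
    rw [← neg_eq_of_add_eq_zero_left h6] at hw
    -- Since `α + β` is real, `Im β = -Im α`. Thus `w` and the conjugate of `w'` have the same
    -- imaginary part after the gauge transformation, and `J` recovers the real part from it.
    have e := neg_injective (hw.2.symm.trans hw'.2)
    have e2 : w.re.2 = w'.re.2 := add_right_cancel (congrArg Prod.snd e)
    have e3 : w'.re.2 = u.2 := by
      rw [e2] at h5
      calc w'.re.2 = (1 / 2 : ℝ) • (w'.re.2 + w'.re.2) := by module
        _ = u.2 := by rw [h5, smul_smul]; norm_num
    refine ⟨-(-w'.im.2 + F u.1), ?_⟩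
    have := congrArg Neg.neg hw'.2
    rw [neg_neg, e3, ← clm_map_neg] at this
    rw [← neg_zero (G := V)]
    exact this
  · rintro ⟨α, rfl⟩
    set v := J (0, α) with hv
    -- With `v = J α` one has `J v = -α`, so after `e^{B+iF}` the imaginary part must be `-α`; the
    -- terms `B v.1` and `F v.1` are removed in advance.
    refine ⟨(gauge B).symm v, mem_realPart_iff.2 ⟨⟨(v.1, v.2 - B v.1), (0, -α - F v.1)⟩, ?_,
      ⟨(v.1, v.2 - B v.1), -(0, -α - F v.1)⟩, ?_, rfl, rfl, rfl, neg_zero, ?_, ?_⟩,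
      (gauge B).apply_symm_apply v⟩
    rotate_left
    · simp only [Cx.conj, neg_neg]
      rw [mem_map_gaugeC_neg, gaugeC_apply, mem_conj_eigenC]
      simp only [map_zero, sub_add_cancel, sub_zero, add_zero]
      have e : ((0, -α) : Gen V) = -(0, α) := by rw [Prod.neg_mk, neg_zero]
      rw [e, clm_map_neg, hv, hJ.sq]
      exact ⟨rfl, rfl⟩
    · exact (two_smul ℝ _).symm
    · exact add_neg_cancel _
    · rw [mem_map_gaugeC_neg, gaugeC_apply, mem_conj_eigenC]
      simp only [map_zero, sub_add_cancel, sub_zero, add_zero]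
      have e : ((0, -α) : Gen V) = -(0, α) := by rw [Prod.neg_mk, neg_zero]
      rw [e, clm_map_neg, hv, hJ.sq]
      exact ⟨rfl, rfl⟩

/-- Now reality of `(α - β)/2i` forces `Re α = Re β`, and the surviving covector, after `e^F`, is
`Im α + F X`. The eigenvalue equation gives `J (Im α + F X) = -(X + B X + Re α)`, whose tangent
component is the graph condition. -/
theorem map_gauge_imagPart (hJ : IsOrthComplex J) :
    (imagPart ((Cx.conjSubmodule (eigenC J)).map (gaugeC (-B) (-F)))).map
      (gauge F : Gen V →ₗ[ℝ] Gen V) = graph (-poisson J) := by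
  ext u
  rw [mem_graph]
  constructor
  · rintro ⟨u, hu, rfl⟩
    obtain ⟨w, hw, w', hw', h1, h2, h3, h4, h5, h6⟩ := mem_imagPart_iff.1 hu
    rw [mem_map_gaugeC_neg, gaugeC_apply, mem_conj_eigenC] at hw hw'
    simp only [Cx.conj, h1, h2, h3, h4, Prod.fst_neg, neg_zero, map_zero, add_zero, sub_zero,
      Prod.snd_neg, h5] at hw hw'
    have e : w.im.2 = -w'.im.2 :=
      add_right_cancel (congrArg Prod.snd (hw.1.symm.trans hw'.1))
    have e3 : w.im.2 = u.2 := by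
      rw [← neg_eq_iff_eq_neg.2 e, sub_neg_eq_add] at h6
      calc w.im.2 = (1 / 2 : ℝ) • (w.im.2 + w.im.2) := by module
        _ = u.2 := by rw [h6, smul_smul]; norm_num
    have := congrArg Prod.fst hw.2
    rw [e3] at this
    exact neg_eq_iff_eq_neg.2 this
  · intro hu
    set v := J (0, u.2) with hv
    have hv1 : -v.1 = u.1 := hu
    have hm : (⟨(u.1, -v.2 - B u.1), (0, u.2 - F u.1)⟩ : Cx (Gen V)) ∈
        (Cx.conjSubmodule (eigenC J)).map (gaugeC (-B) (-F)) := by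
      rw [mem_map_gaugeC_neg, gaugeC_apply, mem_conj_eigenC]
      simp only [map_zero, sub_add_cancel, sub_zero, add_zero]
      have e : ((u.1, -v.2) : Gen V) = -v := by rw [← hv1]; rfl
      rw [e, clm_map_neg, hv, hJ.sq, neg_neg, neg_neg]
      exact ⟨rfl, rfl⟩
    refine ⟨(gauge F).symm u, mem_imagPart_iff.2 ⟨_, hm,
      ⟨(u.1, -v.2 - B u.1), -(0, u.2 - F u.1)⟩, ?_, rfl, rfl, rfl, neg_zero, rfl, ?_⟩,
      (gauge F).apply_symm_apply u⟩
    · simpa only [Cx.conj, neg_neg] using hm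
    · rw [Prod.snd_neg, sub_neg_eq_add]
      exact (two_smul ℝ _).symm

end Gauge

end FibrewiseAlgebra

/-! ### Lagrangian complements and the matched pair in the bihermitian situation. -/

section BihermitianAlgebra

variable {V : Type*} [AddCommGroup V] [Module ℝ V] [TopologicalSpace V]
  [IsTopologicalAddGroup V] [ContinuousSMul ℝ V]

theorem imageCotangent_neg (J : Gen V →L[ℝ] Gen V) : imageCotangent (-J) = imageCotangent J := by
  ext u
  rw [mem_imageCotangent, mem_imageCotangent]
  constructor
  · rintro ⟨α, rfl⟩
    refine ⟨-α, ?_⟩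
    have : ((0, -α) : Gen V) = -(0, α) := by rw [Prod.neg_mk, neg_zero]
    rw [this, clm_map_neg]; rfl
  · rintro ⟨α, rfl⟩
    refine ⟨-α, ?_⟩
    have : ((0, -α) : Gen V) = -(0, α) := by rw [Prod.neg_mk, neg_zero]
    rw [this, clm_map_neg, neg_apply, neg_neg]

theorem poisson_neg (J : Gen V →L[ℝ] Gen V) : poisson (-J) = -poisson J := rfl

/-- Two commuting orthogonal complex structures `J`, `K` on `V ⊕ V*` which coincide precisely on
the graph of `b - F I`, where `I` is the complex structure on `V` induced from the graph. -/
structure IsBihermitian (J K : Gen V →L[ℝ] Gen V) (I : V →L[ℝ] V) (b F : V →L[ℝ] V →L[ℝ] ℝ) :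
    Prop where
  fst : IsOrthComplex J
  snd : IsOrthComplex K
  comm : ∀ u, J (K u) = K (J u)
  definite : ∀ u, GenKahler.pairing (J u) (K u) = 0 → u = 0
  sq : ∀ X, I (I X) = -X
  skew_b : ∀ X Y, b X Y = -b Y X
  skew_F : ∀ X Y, F X Y = -F Y X
  inv_F : ∀ X Y, F (I X) (I Y) = F X Y
  map_fst : ∀ X, J (X, b X - F (I X)) = (I X, b (I X) + F X)
  map_snd : ∀ X, K (X, b X - F (I X)) = (I X, b (I X) + F X)
  mem : ∀ u, J u = K u → u.2 = b u.1 - F (I u.1)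

theorem eq_zero_of_forall_clm [T2Space V] [FiniteDimensional ℝ V] {X : V}
    (h : ∀ α : V →L[ℝ] ℝ, α X = 0) : X = 0 :=
  (Module.forall_dual_apply_eq_zero_iff ℝ X).1 fun f => h (LinearMap.toContinuousLinearMap f)

theorem finrank_cotangent [T2Space V] [FiniteDimensional ℝ V] :
    Module.finrank ℝ (V →L[ℝ] ℝ) = Module.finrank ℝ V := by
  rw [← Subspace.dual_finrank_eq (K := ℝ) (V := V)]
  exact (LinearMap.toContinuousLinearMap (𝕜 := ℝ) (E := V) (F' := ℝ)).finrank_eq.symm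

theorem isCompl_of_finrank_eq [T2Space V] [FiniteDimensional ℝ V] {A B : Submodule ℝ (Gen V)}
    (hA : Module.finrank ℝ A = Module.finrank ℝ V) (hB : Module.finrank ℝ B = Module.finrank ℝ V)
    (h : ∀ u ∈ A, u ∈ B → u = 0) : IsCompl A B := by
  have hd : Disjoint A B := Submodule.disjoint_def.2 h
  refine ⟨hd, codisjoint_iff.2 (Submodule.eq_top_of_finrank_eq ?_)⟩
  have := Submodule.finrank_sup_add_finrank_inf_eq A B
  rw [hd.eq_bot, finrank_bot] at this
  rw [Module.finrank_prod, finrank_cotangent, ← hA]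
  omega

namespace IsOrthComplex

variable {J : Gen V →L[ℝ] Gen V}

theorem injective (h : IsOrthComplex J) : Function.Injective J := fun u v e => by
  have := congrArg J e
  rwa [h.sq, h.sq, neg_inj] at this

theorem isLagrangian_imageCotangent [T2Space V] [FiniteDimensional ℝ V] (h : IsOrthComplex J) :
    IsLagrangian (imageCotangent J) := by
  intro u
  constructor
  · intro hu v hv
    obtain ⟨α, rfl⟩ := mem_imageCotangent.1 hu
    obtain ⟨β, rfl⟩ := mem_imageCotangent.1 hv
    rw [h.orth]
    simp [pairing]
  · intro hu
    -- Orthogonality of `u` to `J α` is, by skewness of `J`, the vanishing of `α` on the tangent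
    -- part of `J u`.
    have : (J u).1 = 0 := eq_zero_of_forall_clm fun α => by
      have := hu (J (0, α)) (mem_imageCotangent.2 ⟨α, rfl⟩)
      rw [← neg_eq_zero, ← h.skew] at this
      simpa [pairing] using this
    refine mem_imageCotangent.2 ⟨-(J u).2, ?_⟩
    have e : ((0, -(J u).2) : Gen V) = -(J u) := by rw [← neg_zero (G := V), ← this]; rfl
    rw [e, clm_map_neg, h.sq, neg_neg]

theorem finrank_imageCotangent [T2Space V] [FiniteDimensional ℝ V] (h : IsOrthComplex J) :
    Module.finrank ℝ (imageCotangent J) = Module.finrank ℝ V := by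
  rw [imageCotangent, ← (Submodule.equivMapOfInjective (J : Gen V →ₗ[ℝ] Gen V) h.injective
    (LinearMap.range (LinearMap.inr ℝ V (V →L[ℝ] ℝ)))).finrank_eq,
    LinearMap.finrank_range_of_inj LinearMap.inr_injective, finrank_cotangent]

theorem poisson_skew (h : IsOrthComplex J) (α β : V →L[ℝ] ℝ) :
    β (poisson J α) = -α (poisson J β) := by
  have := h.skew (0, α) (0, β)
  simpa [pairing, poisson] using this

theorem isLagrangian_graph [T2Space V] [FiniteDimensional ℝ V] (h : IsOrthComplex J) :
    IsLagrangian (graph (-poisson J)) := by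
  intro u
  constructor
  · intro hu v hv
    rw [mem_graph] at hu hv
    rw [pairing, ← hu, ← hv]
    simp only [LinearMap.neg_apply, map_neg]
    rw [h.poisson_skew]; ring
  · intro hu
    refine mem_graph.2 (sub_eq_zero.1 (eq_zero_of_forall_clm fun α => ?_))
    have := hu ((-poisson J) α, α) (mem_graph.2 rfl)
    simp only [pairing, LinearMap.neg_apply, map_neg] at this
    rw [map_sub, LinearMap.neg_apply, map_neg, h.poisson_skew]
    linarith

end IsOrthComplex

theorem finrank_graph [T2Space V] [FiniteDimensional ℝ V] (P : (V →L[ℝ] ℝ) →ₗ[ℝ] V) :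
    Module.finrank ℝ (graph P) = Module.finrank ℝ V := by
  rw [graph, LinearMap.finrank_range_of_inj, finrank_cotangent]
  intro α β h
  exact congrArg Prod.snd h

namespace IsBihermitian

variable {J K : Gen V →L[ℝ] Gen V} {I : V →L[ℝ] V} {b F : V →L[ℝ] V →L[ℝ] ℝ}

/-- On the intersection both `J u` and `K u` are covectors, so `⟨J u, K u⟩ = 0` and definiteness
applies; the dimensions then add up. -/
theorem isCompl_imageCotangent [T2Space V] [FiniteDimensional ℝ V]
    (h : IsBihermitian J K I b F) : IsCompl (imageCotangent J) (imageCotangent K) := by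
  refine isCompl_of_finrank_eq h.fst.finrank_imageCotangent h.snd.finrank_imageCotangent
    fun u hJ hK => h.definite u ?_
  obtain ⟨α, rfl⟩ := mem_imageCotangent.1 hJ
  obtain ⟨β, hβ⟩ := mem_imageCotangent.1 hK
  rw [← hβ, h.snd.sq, hβ, h.fst.sq]
  simp [GenKahler.pairing]

/-- If `π_J ξ = π_K ξ`, then `w = J ξ - K ξ` is a covector with `J w = -K w`. Hence `⟨J w, K w⟩ =
-⟨w, w⟩ = 0` and `w = 0`. Then `⟨J ξ, K ξ⟩ = ⟨ξ, ξ⟩ = 0`, which gives `ξ = 0`. -/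
theorem isCompl_graph [T2Space V] [FiniteDimensional ℝ V]
    (h : IsBihermitian J K I b F) : IsCompl (graph (-poisson J)) (graph (-poisson K)) := by
  refine isCompl_of_finrank_eq (finrank_graph _) (finrank_graph _) fun u hJ hK => ?_
  rw [mem_graph] at hJ hK
  set w : Gen V := J (0, u.2) - K (0, u.2) with hw
  have hw1 : w.1 = 0 := by
    have := neg_injective (hJ.trans hK.symm)
    exact sub_eq_zero.2 this
  have hJK : J w = -K w := by
    rw [hw, clm_map_sub, clm_map_sub, h.fst.sq, h.snd.sq, h.comm]; abel
  have hw0 : w = 0 := h.definite w <| by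
    rw [hJK, pairing_neg_left, h.snd.orth]
    simp [GenKahler.pairing, hw1]
  have h2 : ((0, u.2) : Gen V) = 0 := h.definite _ <| by
    rw [sub_eq_zero.1 (hw.symm.trans hw0), h.snd.orth]
    simp [GenKahler.pairing]
  have h3 : u.2 = 0 := congrArg Prod.snd h2
  rw [h3, map_zero] at hJ
  exact Prod.ext hJ.symm h3

/-- The matched pair of `𝕋_{1,0} ∩ e^{-b-iF}(L̄)`, for `L` the `+i` eigenspace of `J`. -/
theorem matchedPair_eq (h : IsBihermitian J K I b F) {J' : Gen V →L[ℝ] Gen V}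
    (hJ : IsOrthComplex J') (hmap : ∀ X, J' (X, b X - F (I X)) = (I X, b (I X) + F X)) :
    matchedPair I (TT10 I ⊓ (Cx.conjSubmodule (eigenC J')).map (gaugeC (-b) (-F))) =
      (Cx.conjSubmodule (eigenC J')).map (gaugeC (-b) (-F)) := by
  have hT : T01 I ≤ (Cx.conjSubmodule (eigenC J')).map (gaugeC (-b) (-F)) := by
    intro t ht
    obtain ⟨⟨h1, -⟩, h3, h4⟩ := mem_T01.1 ht
    -- A vector of `T_{0,1}` is `X + i I X`, and `e^{b+iF}` takes it to `(X + bX - F I X) + i (I X +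
    -- b I X + F X)`; `hmap` says that `J'` maps the real part to the imaginary part.
    rw [mem_map_gaugeC_neg, gaugeC_apply, mem_conj_eigenC]
    simp only [← h1, h3, h4, zero_add]
    have := congrArg J' (hmap t.re.1)
    rw [hJ.sq] at this
    exact ⟨hmap _, this.symm⟩
  refine matchedPair_TT10_inf h.sq hT fun w hw t ht => ?_
  have ht' := hT ht
  rw [mem_map_gaugeC_neg] at hw ht'
  rw [← pairingC_gaugeC h.skew_b h.skew_F]
  exact pairingC_conj_eigenC hJ hw ht'

end IsBihermitian

end BihermitianAlgebra

/-! ### The bihermitian data of a linear generalized Kähler structure. -/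

section GeneralizedMetric

variable {V : Type*} [AddCommGroup V] [Module ℝ V] [TopologicalSpace V]
  [IsTopologicalAddGroup V] [ContinuousSMul ℝ V]
  {JA JB : Gen V →L[ℝ] Gen V}

/-- A generalized Kähler structure on the vector space `V`. -/
structure IsLinearGenKahler (JA JB : Gen V →L[ℝ] Gen V) : Prop where
  fst : IsOrthComplex JA
  snd : IsOrthComplex JB
  comm : ∀ u, JA (JB u) = JB (JA u)
  pos : ∀ u, u ≠ 0 → 0 < GenKahler.pairing (JA u) (JB u)

namespace IsLinearGenKahler

theorem genMetric_genMetric (h : IsLinearGenKahler JA JB) (u : Gen V) :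
    genMetric JA JB (genMetric JA JB u) = u := by
  change -(JA (JB (-(JA (JB u))))) = u
  rw [clm_map_neg, clm_map_neg, ← h.comm (JB u), h.fst.sq, h.snd.sq]
  abel

theorem pairing_genMetric (h : IsLinearGenKahler JA JB) (u v : Gen V) :
    pairing (genMetric JA JB u) v = pairing (JA u) (JB v) := by
  change pairing (-(JA (JB u))) v = _
  rw [h.comm, pairing_neg_left, h.snd.skew, neg_neg]

theorem pairing_genMetric_comm (h : IsLinearGenKahler JA JB) (u v : Gen V) :
    pairing (genMetric JA JB u) v = pairing u (genMetric JA JB v) := by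
  rw [h.pairing_genMetric]
  change _ = pairing u (-(JA (JB v)))
  rw [pairing_neg_right, ← h.fst.skew]

/-- For `α ≠ 0` positivity reads `0 < ⟨G α, α⟩ = α(g⁻¹ α)`. -/
theorem metricInv_injective (h : IsLinearGenKahler JA JB) :
    Function.Injective (metricInv JA JB) := by
  rw [injective_iff_map_eq_zero]
  intro α hα
  by_contra hne
  have := h.pos (0, α) fun h0 => hne (congrArg Prod.snd h0)
  rw [← h.pairing_genMetric] at this
  have e : (genMetric JA JB (0, α)).1 = 0 := hα
  simp [pairing, e] at this

variable [T2Space V] [FiniteDimensional ℝ V]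

theorem exists_equiv (h : IsLinearGenKahler JA JB) :
    ∃ e : (V →L[ℝ] ℝ) ≃L[ℝ] V, (e : (V →L[ℝ] ℝ) →L[ℝ] V) = metricInv JA JB :=
  ⟨(LinearEquiv.ofInjectiveOfFinrankEq (metricInv JA JB : (V →L[ℝ] ℝ) →ₗ[ℝ] V)
    h.metricInv_injective finrank_cotangent).toContinuousLinearEquiv, rfl⟩

theorem metric_metricInv (h : IsLinearGenKahler JA JB) (α : V →L[ℝ] ℝ) :
    metric JA JB (metricInv JA JB α) = α := by
  obtain ⟨e, he⟩ := h.exists_equiv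
  rw [metric, ← he, ContinuousLinearMap.inverse_equiv]
  exact e.symm_apply_apply α

theorem metricInv_metric (h : IsLinearGenKahler JA JB) (X : V) :
    metricInv JA JB (metric JA JB X) = X := by
  obtain ⟨e, he⟩ := h.exists_equiv
  rw [metric, ← he, ContinuousLinearMap.inverse_equiv]
  exact e.apply_symm_apply X

theorem eq_zero_of_genMetric (h : IsLinearGenKahler JA JB) {ξ : V →L[ℝ] ℝ}
    (hξ : (genMetric JA JB (0, ξ)).1 = 0) : ξ = 0 :=
  h.metricInv_injective (by rw [map_zero]; exact hξ)

/-- The form `b` is defined so that `G(X + b X)` has no tangent component; what is left is `g⁻¹ α`.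
-/
theorem genMetric_fst_add (h : IsLinearGenKahler JA JB) (X : V) (α : V →L[ℝ] ℝ) :
    (genMetric JA JB (X, bField JA JB X + α)).1 = metricInv JA JB α := by
  have e : ((X, bField JA JB X + α) : Gen V) = (X, 0) + (0, bField JA JB X + α) := by simp
  rw [e, clm_map_add, Prod.fst_add]
  change _ + metricInv JA JB (bField JA JB X + α) = _
  rw [map_add]
  change _ + (metricInv JA JB (-(metric JA JB (genMetric JA JB (X, 0)).1)) + _) = _
  rw [map_neg, h.metricInv_metric]
  abel

/-- The difference `G u - u` is a covector because the tangent parts agree. As `G² = 1`, `G` negates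
it, so its image under `g⁻¹` vanishes, and `g⁻¹` is injective. -/
theorem genMetric_plus (h : IsLinearGenKahler JA JB) (X : V) :
    genMetric JA JB (X, bField JA JB X + metric JA JB X) =
      (X, bField JA JB X + metric JA JB X) := by
  set u : Gen V := (X, bField JA JB X + metric JA JB X) with hu
  have h1 : (genMetric JA JB u - u).1 = 0 := by
    rw [Prod.fst_sub, hu, h.genMetric_fst_add, h.metricInv_metric]; exact sub_self X
  have h2 : genMetric JA JB u - u = (0, (genMetric JA JB u - u).2) := Prod.ext h1 rfl
  have h3 : (genMetric JA JB u - u).2 = 0 := h.eq_zero_of_genMetric <| by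
    rw [← h2, clm_map_sub, h.genMetric_genMetric, Prod.fst_sub, ← neg_sub, ← Prod.fst_sub, h1,
      neg_zero]
  exact sub_eq_zero.1 (Prod.ext h1 h3)

theorem genMetric_minus (h : IsLinearGenKahler JA JB) (X : V) :
    genMetric JA JB (X, bField JA JB X - metric JA JB X) =
      -(X, bField JA JB X - metric JA JB X) := by
  set u : Gen V := (X, bField JA JB X - metric JA JB X) with hu
  have h1 : (genMetric JA JB u + u).1 = 0 := by
    rw [Prod.fst_add, hu, sub_eq_add_neg, h.genMetric_fst_add, map_neg, h.metricInv_metric]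
    exact neg_add_cancel X
  have h2 : genMetric JA JB u + u = (0, (genMetric JA JB u + u).2) := Prod.ext h1 rfl
  have h3 : (genMetric JA JB u + u).2 = 0 := h.eq_zero_of_genMetric <| by
    rw [← h2, clm_map_add, h.genMetric_genMetric, add_comm, h1]
  exact eq_neg_of_add_eq_zero_left (Prod.ext h1 h3)

/-- Two `+1` eigenvectors with the same tangent part differ by a covector fixed by `G`, which must
vanish: the graph is the whole eigenspace. -/
theorem snd_of_genMetric_eq (h : IsLinearGenKahler JA JB) {u : Gen V}
    (hu : genMetric JA JB u = u) : u.2 = bField JA JB u.1 + metric JA JB u.1 := by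
  refine sub_eq_zero.1 (h.eq_zero_of_genMetric ?_)
  have e : ((0, u.2 - (bField JA JB u.1 + metric JA JB u.1)) : Gen V) =
      u - (u.1, bField JA JB u.1 + metric JA JB u.1) := Prod.ext (sub_self u.1).symm rfl
  rw [e, clm_map_sub, hu, h.genMetric_plus]
  exact sub_self u.1

theorem snd_of_genMetric_eq_neg (h : IsLinearGenKahler JA JB) {u : Gen V}
    (hu : genMetric JA JB u = -u) : u.2 = bField JA JB u.1 - metric JA JB u.1 := by
  refine sub_eq_zero.1 (h.eq_zero_of_genMetric ?_)
  have e : ((0, u.2 - (bField JA JB u.1 - metric JA JB u.1)) : Gen V) =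
      u - (u.1, bField JA JB u.1 - metric JA JB u.1) := Prod.ext (sub_self u.1).symm rfl
  rw [e, clm_map_sub, hu, h.genMetric_minus, ← neg_sub']
  exact neg_eq_zero.2 (sub_self u.1)

theorem metric_symm (h : IsLinearGenKahler JA JB) (X Y : V) :
    metric JA JB X Y = metric JA JB Y X := by
  have := h.pairing_genMetric_comm (0, metric JA JB X) (0, metric JA JB Y)
  have e : ∀ Z, (genMetric JA JB (0, metric JA JB Z)).1 = Z := h.metricInv_metric
  simp only [pairing, e, map_zero, add_zero] at this
  simpa using this.symm

theorem genMetric_JA (h : IsLinearGenKahler JA JB) (u : Gen V) :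
    genMetric JA JB (JA u) = JA (genMetric JA JB u) := by
  change -(JA (JB (JA u))) = JA (-(JA (JB u)))
  rw [← h.comm, clm_map_neg]

/-- `G` is self-adjoint, so its eigenspaces `C_+` and `C_-` are orthogonal; after the symmetric `g`
terms cancel, this orthogonality is skewness of `b`. -/
theorem bField_skew (h : IsLinearGenKahler JA JB) (X Y : V) :
    bField JA JB X Y = -bField JA JB Y X := by
  have := h.pairing_genMetric_comm (X, bField JA JB X + metric JA JB X)
    (Y, bField JA JB Y - metric JA JB Y)
  rw [h.genMetric_plus, h.genMetric_minus, pairing_neg_right] at this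
  simp only [pairing, add_apply, sub_apply] at this
  rw [h.metric_symm X Y] at this
  linarith

theorem JA_plus (h : IsLinearGenKahler JA JB) (X : V) :
    JA (X, bField JA JB X + metric JA JB X) =
      (IPlus JA JB X, bField JA JB (IPlus JA JB X) + metric JA JB (IPlus JA JB X)) :=
  Prod.ext rfl (h.snd_of_genMetric_eq (by rw [h.genMetric_JA, h.genMetric_plus]))

theorem JA_minus (h : IsLinearGenKahler JA JB) (X : V) :
    JA (X, bField JA JB X - metric JA JB X) =
      (IMinus JA JB X, bField JA JB (IMinus JA JB X) - metric JA JB (IMinus JA JB X)) :=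
  Prod.ext rfl (h.snd_of_genMetric_eq_neg
    (by rw [h.genMetric_JA, h.genMetric_minus, clm_map_neg]))

/-- Hence `J_B = J_A` on `C_+` and `J_B = -J_A` on `C_-`, the source of the sign in the minus case.
-/
theorem genMetric_eq_iff (h : IsLinearGenKahler JA JB) (u v : Gen V) :
    genMetric JA JB u = v ↔ JB u = JA v := by
  change -(JA (JB u)) = v ↔ _
  constructor
  · rintro rfl
    rw [clm_map_neg, h.fst.sq, neg_neg]
  · intro e
    rw [e, h.fst.sq, neg_neg]

theorem IPlus_IPlus (h : IsLinearGenKahler JA JB) (X : V) :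
    IPlus JA JB (IPlus JA JB X) = -X := by
  have := h.fst.sq (X, bField JA JB X + metric JA JB X)
  rw [h.JA_plus, h.JA_plus] at this
  exact congrArg Prod.fst this

theorem IMinus_IMinus (h : IsLinearGenKahler JA JB) (X : V) :
    IMinus JA JB (IMinus JA JB X) = -X := by
  have := h.fst.sq (X, bField JA JB X - metric JA JB X)
  rw [h.JA_minus, h.JA_minus] at this
  exact congrArg Prod.fst this

/-- The pairing restricted to `C_+` is `2g`, and `J_A` preserves both the pairing and `C_+`. -/
theorem metric_IPlus (h : IsLinearGenKahler JA JB) (X Y : V) :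
    metric JA JB (IPlus JA JB X) (IPlus JA JB Y) = metric JA JB X Y := by
  have := h.fst.orth (X, bField JA JB X + metric JA JB X) (Y, bField JA JB Y + metric JA JB Y)
  rw [h.JA_plus, h.JA_plus] at this
  simp only [pairing, add_apply] at this
  rw [h.bField_skew X, h.bField_skew (IPlus JA JB X), h.metric_symm Y,
    h.metric_symm (IPlus JA JB Y)] at this
  linarith

theorem metric_IMinus (h : IsLinearGenKahler JA JB) (X Y : V) :
    metric JA JB (IMinus JA JB X) (IMinus JA JB Y) = metric JA JB X Y := by
  have := h.fst.orth (X, bField JA JB X - metric JA JB X) (Y, bField JA JB Y - metric JA JB Y)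
  rw [h.JA_minus, h.JA_minus] at this
  simp only [pairing, sub_apply] at this
  rw [h.bField_skew X, h.bField_skew (IMinus JA JB X), h.metric_symm Y,
    h.metric_symm (IMinus JA JB Y)] at this
  linarith

theorem definite (h : IsLinearGenKahler JA JB) (u : Gen V) (hu : pairing (JA u) (JB u) = 0) :
    u = 0 := by
  by_contra hne
  exact (h.pos u hne).ne' hu

theorem isBihermitian_plus (h : IsLinearGenKahler JA JB) :
    IsBihermitian JA JB (IPlus JA JB) (bField JA JB) (omegaPlus JA JB) := by
  -- Since `ω_+ I_+ = g I_+² = -g`, the graph of `b - F I` is `C_+`.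
  have e : ∀ X, bField JA JB X - omegaPlus JA JB (IPlus JA JB X) =
      bField JA JB X + metric JA JB X := fun X => by
    change _ - metric JA JB (IPlus JA JB (IPlus JA JB X)) = _
    rw [h.IPlus_IPlus, map_neg, sub_neg_eq_add]
  refine ⟨h.fst, h.snd, h.comm, h.definite, h.IPlus_IPlus, h.bField_skew, fun X Y => ?_,
    fun X Y => ?_, fun X => ?_, fun X => ?_, fun u hu => ?_⟩
  · change metric JA JB (IPlus JA JB X) Y = -metric JA JB (IPlus JA JB Y) X
    rw [← h.metric_IPlus, h.IPlus_IPlus, map_neg, neg_apply, h.metric_symm]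
  · exact h.metric_IPlus _ _
  · rw [e]; exact h.JA_plus X
  · rw [e, (h.genMetric_eq_iff _ _).1 (h.genMetric_plus X)]
    exact h.JA_plus X
  · rw [e]
    exact h.snd_of_genMetric_eq ((h.genMetric_eq_iff _ _).2 hu.symm)

/-- With `F = -ω_-` one gets `F I_- = g`, so the graph of `b - F I` is `C_-`, where `J_A` and `-J_B`
agree. The pairing `⟨J_A·, -J_B·⟩` is negative definite, which is why only definiteness is demanded.
-/
theorem isBihermitian_minus (h : IsLinearGenKahler JA JB) :
    IsBihermitian JA (-JB) (IMinus JA JB) (bField JA JB) (-omegaMinus JA JB) := by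
  have e : ∀ X, bField JA JB X - (-omegaMinus JA JB) (IMinus JA JB X) =
      bField JA JB X - metric JA JB X := fun X => by
    rw [neg_apply]
    change _ - -metric JA JB (IMinus JA JB (IMinus JA JB X)) = _
    rw [h.IMinus_IMinus, map_neg, neg_neg]
  have e' : ∀ X, ((IMinus JA JB X, bField JA JB (IMinus JA JB X) + (-omegaMinus JA JB) X) : Gen V) =
      JA (X, bField JA JB X - metric JA JB X) := fun X => by
    rw [h.JA_minus, neg_apply, ← sub_eq_add_neg]; rfl
  refine ⟨h.fst, h.snd.neg, fun u => ?_, fun u hu => h.definite u ?_, h.IMinus_IMinus,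
    h.bField_skew, fun X Y => ?_, fun X Y => ?_, fun X => ?_, fun X => ?_, fun u hu => ?_⟩
  · rw [clm_neg_apply, clm_neg_apply, clm_map_neg, h.comm]
  · rwa [clm_neg_apply, pairing_neg_right, neg_eq_zero] at hu
  · change -metric JA JB (IMinus JA JB X) Y = -(-metric JA JB (IMinus JA JB Y) X)
    rw [← h.metric_IMinus, h.IMinus_IMinus, map_neg, neg_apply, h.metric_symm]
  · exact congrArg Neg.neg (h.metric_IMinus _ _)
  · rw [e, e']
  · rw [e, e', clm_neg_apply, (h.genMetric_eq_iff _ _).1 (h.genMetric_minus X), clm_map_neg, neg_neg]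
  · rw [e]
    refine h.snd_of_genMetric_eq_neg ((h.genMetric_eq_iff _ _).2 ?_)
    rw [clm_map_neg, hu, clm_neg_apply, neg_neg]

end IsLinearGenKahler

end GeneralizedMetric

/-! ### Types of 3-forms and the identity `-2i ∂F = (H - db) - i dF`, pointwise. -/

section TypeDecomposition

variable {V : Type*} [AddCommGroup V] [Module ℝ V] [TopologicalSpace V]
  [IsTopologicalAddGroup V] [ContinuousSMul ℝ V]

theorem alternating_swap₀₁ {W : Type*} [AddCommGroup W] [Module ℝ W] [TopologicalSpace W]
    (θ : V [⋀^Fin 3]→L[ℝ] W) (a b c : V) : θ ![a, b, c] = -θ ![b, a, c] := by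
  refine Eq.trans ?_ (θ.toAlternatingMap.map_swap ![b, a, c] (i := 0) (j := 1) (by decide))
  change θ _ = θ _
  congr 1; ext k; fin_cases k <;> rfl

theorem alternating_swap₁₂ {W : Type*} [AddCommGroup W] [Module ℝ W] [TopologicalSpace W]
    (θ : V [⋀^Fin 3]→L[ℝ] W) (a b c : V) : θ ![a, b, c] = -θ ![a, c, b] := by
  refine Eq.trans ?_ (θ.toAlternatingMap.map_swap ![a, c, b] (i := 1) (j := 2) (by decide))
  change θ _ = θ _
  congr 1; ext k; fin_cases k <;> rfl

theorem alternating_cycle {W : Type*} [AddCommGroup W] [Module ℝ W] [TopologicalSpace W]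
    (θ : V [⋀^Fin 3]→L[ℝ] W) (a b c : V) : θ ![a, b, c] = θ ![b, c, a] := by
  rw [alternating_swap₀₁, alternating_swap₁₂, neg_neg]

theorem alternating_neg₀ (θ : V [⋀^Fin 3]→L[ℝ] ℝ) (a b c : V) :
    θ ![-a, b, c] = -θ ![a, b, c] := by
  have := θ.toAlternatingMap.map_update_neg ![a, b, c] 0 a
  rwa [Matrix.vecCons, Matrix.vecCons, Fin.update_cons_zero, Fin.update_cons_zero] at this

theorem alternating_neg₁ (θ : V [⋀^Fin 3]→L[ℝ] ℝ) (a b c : V) :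
    θ ![a, -b, c] = -θ ![a, b, c] := by
  rw [alternating_swap₀₁, alternating_neg₀, alternating_swap₀₁]; ring

/-- Expand the three products of two factors `½(1 - iI)` and one factor `½(1 + iI)`. Each term
carries `1/8`; `d` and `d(I, I, I)` receive equal contributions from all three products, whereas in
the mixed terms one contribution cancels another. -/
theorem part21_apply (I : V →L[ℝ] V) (d : V [⋀^Fin 3]→L[ℝ] ℝ) (x y z : V) :
    part21 I (Complex.ofRealCLM.compContinuousAlternatingMap d) ![x, y, z] =
      ⟨(3 * d ![x, y, z] + d ![I x, I y, z] + d ![I x, y, I z] + d ![x, I y, I z]) / 8,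
        -(d ![I x, y, z] + d ![x, I y, z] + d ![x, y, I z] + 3 * d ![I x, I y, I z]) / 8⟩ := by
  obtain ⟨f, hf⟩ : ∃ f : V → V → V → ℝ, ∀ a b c, f a b c = d ![a, b, c] := ⟨_, fun _ _ _ => rfl⟩
  have ev : ∀ v : Fin 3 → V, Complex.ofRealCLM.compContinuousAlternatingMap d v =
      (f (v 0) (v 1) (v 2) : ℂ) := fun v => by
    rw [hf]
    change ((d v : ℝ) : ℂ) = _
    congr 2; ext k; fin_cases k <;> rfl
  simp only [← hf]
  change (slotProj I (-1) 0 (slotProj I 1 1 (slotProj I 1 2 _)) +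
    slotProj I 1 0 (slotProj I (-1) 1 (slotProj I 1 2 _)) +
    slotProj I 1 0 (slotProj I 1 1 (slotProj I (-1) 2 _))) ![x, y, z] = _
  simp only [slotProj]
  simp [ev]
  apply Complex.ext
  · simp; ring
  · simp; ring

variable {I : V →L[ℝ] V} {h d : V [⋀^Fin 3]→L[ℝ] ℝ}

/-- On two arguments of type `(1,0)`, `hR` becomes `h = -i d`; by `hd` there is no `(3,0)` part.
Therefore `h` is `-i` times the `(2,1)` part of `d` plus the complex conjugate, and `h - i d` is
`-2i` times that part. The code verifies this in real terms, through `h = -d(I·, I·, I·)`. -/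
theorem curv_apply (hI : ∀ x, I (I x) = -x)
    (hR : ∀ x y z, h ![x, y, z] - h ![I x, I y, z] + d ![I x, y, z] + d ![x, I y, z] = 0)
    (hd : ∀ x y z, d ![x, y, z] = d ![I x, I y, z] + d ![I x, y, I z] + d ![x, I y, I z])
    (x y z : V) :
    ((-2 * Complex.I) • part21 I (Complex.ofRealCLM.compContinuousAlternatingMap d)) ![x, y, z] =
      ⟨h ![x, y, z], -d ![x, y, z]⟩ := by
  -- Cyclic permutations of `hR`, moving the distinguished pair of arguments.
  have hR2 : ∀ x y z,
      h ![x, y, z] - h ![x, I y, I z] + d ![x, I y, z] + d ![x, y, I z] = 0 := fun x y z => by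
    have := hR y z x
    rwa [← alternating_cycle h x, ← alternating_cycle h x, ← alternating_cycle d x,
      ← alternating_cycle d x] at this
  have hR3 : ∀ x y z,
      h ![x, y, z] - h ![I x, y, I z] + d ![I x, y, z] + d ![x, y, I z] = 0 := fun x y z => by
    have := hR z x y
    rw [alternating_cycle h z, alternating_cycle h (I z), alternating_cycle d (I z),
      alternating_cycle d z] at this
    linarith
  have e1 := hR x y z
  have e2 := hR2 x y z
  have e3 := hR3 x y z
  have f1 := hR (I x) y (I z)
  have f2 := hR2 (I x) (I y) z
  have f3 := hR3 (I x) (I y) z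
  have g := hd x y z
  have g1 := hd (I x) y z
  simp only [hI, alternating_neg₀, alternating_neg₁] at *
  change (-2 * Complex.I) • part21 I _ ![x, y, z] = _
  rw [part21_apply]
  apply Complex.ext
  · simp
    linarith
  · simp
    linarith

end TypeDecomposition

/-! ### Vector fields and forms in the preferred charts. -/

section Charts

variable {E : Type*} [NormedAddCommGroup E] [NormedSpace ℝ E]
  {M : Type*} [TopologicalSpace M] [ChartedSpace E M] [IsManifold 𝓘(ℝ, E) ∞ M]

/-- The differential at `x` of the preferred chart at `p`. -/
def chartD (p x : M) : TangentSpace 𝓘(ℝ, E) x →L[ℝ] E :=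
  mfderiv 𝓘(ℝ, E) 𝓘(ℝ, E) (extChartAt 𝓘(ℝ, E) p) x

/-- The differential at `y` of the inverse of the preferred chart at `p`. -/
def chartSymmD (p : M) (y : E) :
    E →L[ℝ] TangentSpace 𝓘(ℝ, E) ((extChartAt 𝓘(ℝ, E) p).symm y) :=
  mfderiv 𝓘(ℝ, E) 𝓘(ℝ, E) (extChartAt 𝓘(ℝ, E) p).symm y

instance isManifold_one : IsManifold 𝓘(ℝ, E) 1 M := IsManifold.of_le (n := ∞) (by simp)

theorem isOpen_target (p : M) : IsOpen (extChartAt 𝓘(ℝ, E) p).target :=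
  isOpen_extChartAt_target p

theorem chartD_chartSymmD {p : M} {y : E} (hy : y ∈ (extChartAt 𝓘(ℝ, E) p).target) (v : E) :
    chartD p ((extChartAt 𝓘(ℝ, E) p).symm y) (chartSymmD p y v) = v := by
  have := mfderiv_extChartAt_comp_mfderivWithin_extChartAt_symm (I := 𝓘(ℝ, E)) hy
  rw [modelWithCornersSelf_coe, Set.range_id, mfderivWithin_univ] at this
  exact DFunLike.congr_fun this v

theorem chartSymmD_chartD {p : M} {y : E} (hy : y ∈ (extChartAt 𝓘(ℝ, E) p).target)
    (w : TangentSpace 𝓘(ℝ, E) ((extChartAt 𝓘(ℝ, E) p).symm y)) :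
    chartSymmD p y (chartD p _ w) = w := by
  have := mfderivWithin_extChartAt_symm_comp_mfderiv_extChartAt (I := 𝓘(ℝ, E)) hy
  rw [modelWithCornersSelf_coe, Set.range_id, mfderivWithin_univ] at this
  exact DFunLike.congr_fun this w

theorem chartD_self (p : M) : chartD p p = ContinuousLinearMap.id ℝ E :=
  mfderiv_extChartAt_self

/-- A vector field in the preferred chart at `p`. -/
def chartField (X : ∀ x : M, TangentSpace 𝓘(ℝ, E) x) (p : M) (y : E) : E :=
  chartD p _ (X ((extChartAt 𝓘(ℝ, E) p).symm y))

/-- A 1-form in the preferred chart at `p`. -/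
def chartCovector (α : ∀ x : M, TangentSpace 𝓘(ℝ, E) x →L[ℝ] ℝ) (p : M) (y : E) : E →L[ℝ] ℝ :=
  (α ((extChartAt 𝓘(ℝ, E) p).symm y)).comp (chartSymmD p y)

/-- A bilinear form in the preferred chart at `p`. -/
def chartBilin (B : ∀ x : M, TangentSpace 𝓘(ℝ, E) x →L[ℝ] TangentSpace 𝓘(ℝ, E) x →L[ℝ] ℝ)
    (p : M) (y : E) : E →L[ℝ] E →L[ℝ] ℝ :=
  (ContinuousLinearMap.precomp ℝ (chartSymmD p y)).comp
    ((B ((extChartAt 𝓘(ℝ, E) p).symm y)).comp (chartSymmD p y))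

theorem chartField_self (X : ∀ x : M, TangentSpace 𝓘(ℝ, E) x) (p : M) :
    chartField X p (extChartAt 𝓘(ℝ, E) p p) = X p := by
  rw [chartField, extChartAt_to_inv p, chartD_self]; rfl

theorem chartSymmD_self_aux (p : M) {y : E} (hy : y ∈ (extChartAt 𝓘(ℝ, E) p).target)
    (h : (extChartAt 𝓘(ℝ, E) p).symm y = p) (v : E) : chartSymmD p y v = (v : E) := by
  have := chartD_chartSymmD hy v
  have h2 : ∀ q, q = p → ∀ w : TangentSpace 𝓘(ℝ, E) q, chartD p q w = (w : E) := by
    rintro q rfl w; rw [chartD_self]; rfl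
  rwa [h2 _ h] at this

theorem chartSymmD_self (p : M) (v : E) :
    chartSymmD p (extChartAt 𝓘(ℝ, E) p p) v = (v : E) :=
  chartSymmD_self_aux p (mem_extChartAt_target p) (extChartAt_to_inv p) v

theorem chartCovector_self (α : ∀ x : M, TangentSpace 𝓘(ℝ, E) x →L[ℝ] ℝ) (p : M) :
    chartCovector α p (extChartAt 𝓘(ℝ, E) p p) = α p := by
  refine ContinuousLinearMap.ext fun v => ?_
  have h2 : ∀ q, q = p → ∀ w : E, α q w = α p w := by rintro q rfl w; rfl
  refine Eq.trans ?_ (h2 _ (extChartAt_to_inv (I := 𝓘(ℝ, E)) p) v)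
  exact congrArg (α _) (chartSymmD_self p v)

theorem chartBilin_self
    (B : ∀ x : M, TangentSpace 𝓘(ℝ, E) x →L[ℝ] TangentSpace 𝓘(ℝ, E) x →L[ℝ] ℝ) (p : M) :
    chartBilin B p (extChartAt 𝓘(ℝ, E) p p) = B p := by
  refine ContinuousLinearMap.ext fun v => ContinuousLinearMap.ext fun w => ?_
  have h2 : ∀ q, q = p → ∀ v w : E, B q v w = B p v w := by rintro q rfl v w; rfl
  refine Eq.trans ?_ (h2 _ (extChartAt_to_inv (I := 𝓘(ℝ, E)) p) v w)
  exact congrArg₂ (fun a b => B _ a b) (chartSymmD_self p v) (chartSymmD_self p w)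

/-- The preferred chart at `p` has identity differential at `p`, so identities at `p` can be
computed in coordinates without Jacobian factors. -/
theorem extD_apply {F : Type*} [NormedAddCommGroup F] [NormedSpace ℝ F] {n : ℕ}
    (η : Form E M n F) (p : M) (v : Fin (n + 1) → E) :
    extD η p v = extDeriv (chartForm η p) (extChartAt 𝓘(ℝ, E) p p) v := by
  change extDeriv (chartForm η p) (extChartAt 𝓘(ℝ, E) p p) (fun i => chartD p p (v i)) = _
  rw [chartD_self]; rfl

theorem chartCovector_apply (α : ∀ x : M, TangentSpace 𝓘(ℝ, E) x →L[ℝ] ℝ)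
    (X : ∀ x : M, TangentSpace 𝓘(ℝ, E) x) {p : M} {y : E}
    (hy : y ∈ (extChartAt 𝓘(ℝ, E) p).target) :
    chartCovector α p y (chartField X p y) =
      α ((extChartAt 𝓘(ℝ, E) p).symm y) (X ((extChartAt 𝓘(ℝ, E) p).symm y)) :=
  congrArg (α _) (chartSymmD_chartD hy _)

theorem chartBilin_apply
    (B : ∀ x : M, TangentSpace 𝓘(ℝ, E) x →L[ℝ] TangentSpace 𝓘(ℝ, E) x →L[ℝ] ℝ)
    (X : ∀ x : M, TangentSpace 𝓘(ℝ, E) x) {p : M} {y : E}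
    (hy : y ∈ (extChartAt 𝓘(ℝ, E) p).target) :
    chartBilin B p y (chartField X p y) = chartCovector (fun x => B x (X x)) p y :=
  ContinuousLinearMap.ext fun v => congrArg (fun w => B _ w (chartSymmD p y v))
    (chartSymmD_chartD hy _)

theorem chartForm_oneForm (α : ∀ x : M, TangentSpace 𝓘(ℝ, E) x →L[ℝ] ℝ) (p : M) (y : E) :
    chartForm (oneForm α) p y =
      ContinuousAlternatingMap.ofSubsingleton ℝ E ℝ (0 : Fin 1) (chartCovector α p y) :=
  ContinuousAlternatingMap.ext fun _ => rfl

theorem chartForm_twoForm [FiniteDimensional ℝ E]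
    (B : ∀ x : M, TangentSpace 𝓘(ℝ, E) x →L[ℝ] TangentSpace 𝓘(ℝ, E) x →L[ℝ] ℝ)
    (p : M) (y : E) :
    chartForm (fun x => twoForm (B x)) p y = twoForm (chartBilin B p y) :=
  ContinuousAlternatingMap.ext fun _ => rfl

theorem isSmoothField_iff {X : ∀ x : M, TangentSpace 𝓘(ℝ, E) x} :
    IsSmoothField X ↔
      ∀ p, ContDiffOn ℝ ∞ (chartField X p) (extChartAt 𝓘(ℝ, E) p).target := by
  have key : ∀ p : M, ∀ x ∈ (chartAt E p).source,
      (trivializationAt E (TangentSpace 𝓘(ℝ, E)) p ⟨x, X x⟩).2 = chartD p x (X x) := by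
    intro p x hx
    rw [chartD, ← TangentBundle.continuousLinearMapAt_trivializationAt hx]
    exact (Trivialization.continuousLinearMapAt_apply_of_mem (R := ℝ)
      (trivializationAt E (TangentSpace 𝓘(ℝ, E)) p) (by simpa using hx) (X x)).symm
  constructor
  · intro h p
    rw [← contMDiffOn_iff_contDiffOn]
    have h1 : ContMDiffOn 𝓘(ℝ, E) 𝓘(ℝ, E) ∞ (fun x => chartD p x (X x)) (chartAt E p).source := by
      have := ((trivializationAt E (TangentSpace 𝓘(ℝ, E)) p).contMDiffOn_section_iff (n := ∞)
        (s := X) (chartAt E p).open_source (by simp)).1 h.contMDiffOn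
      exact this.congr fun x hx => (key p x hx).symm
    exact h1.comp (contMDiffOn_extChartAt_symm p) fun y hy => by
      simpa using (extChartAt 𝓘(ℝ, E) p).map_target hy
  · intro h p
    refine ((trivializationAt E (TangentSpace 𝓘(ℝ, E)) p).contMDiffAt_section_iff (n := ∞)
      (s := X) (by simp)).2 ?_
    have h1 : ContMDiffAt 𝓘(ℝ, E) 𝓘(ℝ, E) ∞
        (chartField X p ∘ extChartAt 𝓘(ℝ, E) p) p :=
      (((h p).contDiffAt ((isOpen_target p).mem_nhds (mem_extChartAt_target p))).contMDiffAt).comp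
        p contMDiffAt_extChartAt
    refine h1.congr_of_eventuallyEq ?_
    filter_upwards [(chartAt E p).open_source.mem_nhds (mem_chart_source E p)] with x hx
    rw [key p x hx]
    have : (extChartAt 𝓘(ℝ, E) p).symm (extChartAt 𝓘(ℝ, E) p x) = x :=
      (extChartAt 𝓘(ℝ, E) p).left_inv (by simpa using hx)
    exact (congrArg (fun x => chartD p x (X x)) this).symm

end Charts

/-! ### Change of chart and the exterior derivative. -/

section Transition

variable {E : Type*} [NormedAddCommGroup E] [NormedSpace ℝ E]
  {M : Type*} [TopologicalSpace M] [ChartedSpace E M] [IsManifold 𝓘(ℝ, E) ∞ M]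

/-- The transition map from the preferred chart at `p` to the one at `q`. -/
def transition (q p : M) : E → E := extChartAt 𝓘(ℝ, E) q ∘ (extChartAt 𝓘(ℝ, E) p).symm

/-- The domain of the transition map. -/
def overlap (q p : M) : Set E :=
  (extChartAt 𝓘(ℝ, E) p).target ∩ (extChartAt 𝓘(ℝ, E) p).symm ⁻¹' (chartAt E q).source

theorem isOpen_overlap (q p : M) : IsOpen (overlap (E := E) q p) :=
  (continuousOn_extChartAt_symm p).isOpen_inter_preimage (isOpen_target p)
    (chartAt E q).open_source

theorem contDiffOn_transition (q p : M) :
    ContDiffOn ℝ ∞ (transition (E := E) q p) (overlap q p) := by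
  rw [← contMDiffOn_iff_contDiffOn]
  exact (contMDiffOn_extChartAt (n := ∞)).comp
    ((contMDiffOn_extChartAt_symm p).mono Set.inter_subset_left) fun y hy => hy.2

theorem contDiffAt_transition {q p : M} {y : E} (hy : y ∈ overlap q p) :
    ContDiffAt ℝ ∞ (transition (E := E) q p) y :=
  (contDiffOn_transition q p).contDiffAt ((isOpen_overlap q p).mem_nhds hy)

theorem fderiv_transition {q p : M} {y : E} (hy : y ∈ overlap q p) (v : E) :
    fderiv ℝ (transition q p) y v = chartD q _ (chartSymmD p y v) := by
  rw [← mfderiv_eq_fderiv, transition, mfderiv_comp (I' := 𝓘(ℝ, E))]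
  · rfl
  · exact mdifferentiableAt_extChartAt hy.2
  · exact ((contMDiffOn_extChartAt_symm (n := ∞) p).contMDiffAt
      ((isOpen_target p).mem_nhds hy.1)).mdifferentiableAt (by simp)

section Forms

variable {F : Type*} [NormedAddCommGroup F] [NormedSpace ℝ F] {n : ℕ}

theorem chartForm_chartD (η : Form E M n F) {q x : M} (hx : x ∈ (chartAt E q).source)
    (w : Fin n → TangentSpace 𝓘(ℝ, E) x) :
    chartForm η q (extChartAt 𝓘(ℝ, E) q x) (fun i => chartD q x (w i)) = η x w := by
  obtain ⟨y, hy, rfl⟩ : ∃ y ∈ (extChartAt 𝓘(ℝ, E) q).target, (extChartAt 𝓘(ℝ, E) q).symm y = x :=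
    ⟨_, (extChartAt 𝓘(ℝ, E) q).map_source (by simpa using hx),
      (extChartAt 𝓘(ℝ, E) q).left_inv (by simpa using hx)⟩
  rw [(extChartAt 𝓘(ℝ, E) q).right_inv hy]
  exact congrArg (η _) (funext fun i => chartSymmD_chartD hy (w i))

theorem chartForm_eq_pullback (η : Form E M n F) {q p : M} {y : E} (hy : y ∈ overlap q p) :
    chartForm η p y =
      (chartForm η q (transition q p y)).compContinuousLinearMap (fderiv ℝ (transition q p) y) := by
  ext v
  refine (chartForm_chartD η hy.2 fun i => chartSymmD p y (v i)).symm.trans ?_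
  exact congrArg (chartForm η q _) (funext fun i => (fderiv_transition hy (v i)).symm)

theorem two_le_infty : minSmoothness ℝ 2 ≤ ∞ := by
  rw [minSmoothness_of_isRCLikeNormedField]
  exact WithTop.coe_le_coe.2 (le_top : (2 : ℕ∞) ≤ ⊤)

theorem IsSmoothForm.contDiffAt {η : Form E M n F} (h : IsSmoothForm η) {p : M} {y : E}
    (hy : y ∈ (extChartAt 𝓘(ℝ, E) p).target) : ContDiffAt ℝ ∞ (chartForm η p) y :=
  (h p).contDiffAt ((isOpen_target p).mem_nhds hy)

/-- The exterior derivative is defined with a different chart at each point; naturality of `d` under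
transition maps lets a single chart compute it everywhere on its target. Smoothness of `dη` and `d²
= 0` depend on this. -/
theorem IsSmoothForm.chartForm_extD {η : Form E M n F} (h : IsSmoothForm η) {p : M} {y : E}
    (hy : y ∈ (extChartAt 𝓘(ℝ, E) p).target) :
    chartForm (extD η) p y = extDeriv (chartForm η p) y := by
  set x := (extChartAt 𝓘(ℝ, E) p).symm y with hx
  have hy' : y ∈ overlap x p := ⟨hy, mem_chart_source E x⟩
  have e : chartForm η p =ᶠ[nhds y] fun z => (chartForm η x (transition x p z)).compContinuousLinearMap
      (fderiv ℝ (transition x p) z) := by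
    filter_upwards [(isOpen_overlap x p).mem_nhds hy'] with z hz
    exact chartForm_eq_pullback η hz
  rw [e.extDeriv_eq, extDeriv_pullback (r := ∞) _ (contDiffAt_transition hy') two_le_infty]
  · ext v
    change extD η x (fun i => chartSymmD p y (v i)) =
      extDeriv (chartForm η x) (transition x p y) fun i => fderiv ℝ (transition x p) y (v i)
    refine (extD_apply (E := E) η x _).trans (congrArg (extDeriv (chartForm η x) _) (funext fun i => ?_))
    rw [fderiv_transition hy', ← hx, chartD_self]
    rfl
  · exact (h.contDiffAt (mem_extChartAt_target x)).differentiableAt (by simp)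

set_option synthInstance.maxHeartbeats 200000 in
theorem contDiffOn_extDeriv {w : E → E [⋀^Fin n]→L[ℝ] F} {s : Set E} (hs : IsOpen s)
    (h : ContDiffOn ℝ ∞ w s) : ContDiffOn ℝ ∞ (extDeriv w) s :=
  ContDiff.comp_contDiffOn (g := ContinuousAlternatingMap.alternatizeUncurryFinCLM (n := n) ℝ E F)
    (ContinuousLinearMap.contDiff _) (h.fderiv_of_isOpen (m := ∞) hs le_rfl)

theorem IsSmoothForm.extD {η : Form E M n F} (h : IsSmoothForm η) : IsSmoothForm (extD η) :=
  fun p => (contDiffOn_extDeriv (isOpen_target p) (h p)).congr fun _ hy => h.chartForm_extD hy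

theorem IsSmoothForm.extD_extD {η : Form E M n F} (h : IsSmoothForm η) :
    GenKahler.extD (GenKahler.extD η) = 0 := by
  funext p
  ext v
  refine (extD_apply (E := E) _ p v).trans ?_
  have e : chartForm (GenKahler.extD η) p =ᶠ[nhds (extChartAt 𝓘(ℝ, E) p p)]
      extDeriv (chartForm η p) := by
    filter_upwards [(isOpen_target p).mem_nhds (mem_extChartAt_target p)] with y hy
    exact h.chartForm_extD hy
  rw [e.extDeriv_eq, extDeriv_extDeriv_apply (r := ∞) (h.contDiffAt (mem_extChartAt_target p))
    two_le_infty]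
  rfl

theorem chartForm_sub (η θ : Form E M n F) (p : M) :
    chartForm (η - θ) p = chartForm η p - chartForm θ p := by
  funext y; ext v; rfl

theorem chartForm_neg (η : Form E M n F) (p : M) : chartForm (-η) p = -chartForm η p := by
  funext y; ext v; rfl

theorem chartForm_zero (p : M) : chartForm (0 : Form E M n F) p = 0 := by
  funext y; ext v; rfl

theorem extDeriv_neg (w : E → E [⋀^Fin n]→L[ℝ] F) (x : E) : extDeriv (-w) x = -extDeriv w x := by
  have := extDeriv_smul (𝕜 := ℝ) (x := x) (-1 : ℝ) w
  simpa using this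

theorem extD_neg (η : Form E M n F) : extD (-η) = -extD η := by
  funext p
  ext v
  refine (extD_apply (E := E) _ p v).trans ?_
  rw [chartForm_neg, extDeriv_neg]
  exact congrArg Neg.neg (extD_apply (E := E) η p v).symm

theorem IsClosedForm.zero : IsClosedForm (0 : Form E M n F) := by
  refine ⟨fun p => ?_, ?_⟩
  · rw [chartForm_zero]; exact contDiffOn_const
  · funext p
    ext v
    refine (extD_apply (E := E) _ p v).trans ?_
    rw [chartForm_zero]
    have : (0 : E → E [⋀^Fin n]→L[ℝ] F) = fun _ => 0 := rfl
    rw [extDeriv, this, fderiv_fun_const]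
    exact DFunLike.congr_fun (ContinuousAlternatingMap.alternatizeUncurryFinCLM ℝ E F).map_zero v

theorem IsSmoothForm.isClosedForm_extD {η : Form E M n F} (h : IsSmoothForm η) :
    IsClosedForm (GenKahler.extD η) := ⟨h.extD, h.extD_extD⟩

theorem IsClosedForm.sub {η θ : Form E M n F} (hη : IsClosedForm η) (hθ : IsClosedForm θ) :
    IsClosedForm (η - θ) := by
  refine ⟨fun p => ?_, ?_⟩
  · rw [chartForm_sub]; exact (hη.1 p).sub (hθ.1 p)
  · funext p
    ext v
    have e : ∀ {η : Form E M n F}, IsClosedForm η →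
        extDeriv (chartForm η p) (extChartAt 𝓘(ℝ, E) p p) (v : Fin (n + 1) → E) = 0 :=
      fun {η} h => (extD_apply (E := E) η p v).symm.trans (by rw [h.2]; rfl)
    have d : ∀ {η : Form E M n F}, IsClosedForm η →
        DifferentiableAt ℝ (chartForm η p) (extChartAt 𝓘(ℝ, E) p p) := fun h =>
      (h.1.contDiffAt (mem_extChartAt_target p)).differentiableAt (by simp)
    refine (extD_apply (E := E) _ p v).trans ?_
    rw [chartForm_sub, sub_eq_add_neg, extDeriv_add (d hη) (d hθ).neg, extDeriv_neg]
    refine (congrArg₂ (fun a b => a + -b) (e hη) (e hθ)).trans ?_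
    rw [neg_zero, add_zero]; rfl

end Forms

end Transition

/-! ### Extending local data by bump functions; smoothness of bundle maps. -/

section Extension

variable {E : Type*} [NormedAddCommGroup E] [NormedSpace ℝ E]
  {M : Type*} [TopologicalSpace M] [ChartedSpace E M] [IsManifold 𝓘(ℝ, E) ∞ M]

theorem isSmoothForm_oneForm_iff {α : ∀ x : M, TangentSpace 𝓘(ℝ, E) x →L[ℝ] ℝ} :
    IsSmoothForm (oneForm α) ↔
      ∀ p, ContDiffOn ℝ ∞ (chartCovector α p) (extChartAt 𝓘(ℝ, E) p).target := by
  have e : ∀ p, chartForm (oneForm α) p =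
      (ContinuousAlternatingMap.ofSubsingletonLIE (𝕜 := ℝ) (E := E) (F := ℝ)
        (0 : Fin 1)).toContinuousLinearEquiv ∘ chartCovector α p :=
    fun p => funext (chartForm_oneForm α p)
  simp only [IsSmoothForm, e, ContinuousLinearEquiv.comp_contDiffOn_iff]

theorem chartD_inverse {p x : M} (hx : x ∈ (chartAt E p).source) (v : E) :
    chartD p x ((chartD p x).inverse v) = v := by
  obtain ⟨e, he⟩ : (chartD (E := E) p x).IsInvertible :=
    isInvertible_mfderiv_extChartAt (I := 𝓘(ℝ, E)) (x := p) (y := x) (by simpa using hx)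
  rw [← he, ContinuousLinearMap.inverse_equiv]
  exact e.apply_symm_apply v

variable [FiniteDimensional ℝ E] [T2Space M]

theorem exists_bump {p : M} {y : E} (hy : y ∈ (extChartAt 𝓘(ℝ, E) p).target) :
    ∃ f : M → ℝ, ContMDiff 𝓘(ℝ, E) 𝓘(ℝ, ℝ) ∞ f ∧ tsupport f ⊆ (chartAt E p).source ∧
      ∀ᶠ z in nhds y, f ((extChartAt 𝓘(ℝ, E) p).symm z) = 1 := by
  set x := (extChartAt 𝓘(ℝ, E) p).symm y with hx
  have hs : x ∈ (chartAt E p).source := by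
    rw [← extChartAt_source 𝓘(ℝ, E) p]
    exact (extChartAt 𝓘(ℝ, E) p).map_target hy
  obtain ⟨f, hf, -⟩ := (SmoothBumpFunction.nhds_basis_support (I := 𝓘(ℝ, E))
    ((chartAt E p).open_source.mem_nhds hs)).mem_iff.1 Filter.univ_mem
  refine ⟨f, f.contMDiff, hf, ?_⟩
  have hc : ContinuousAt (extChartAt 𝓘(ℝ, E) p).symm y :=
    (continuousOn_extChartAt_symm p).continuousAt ((isOpen_target p).mem_nhds hy)
  exact hc.eventually f.eventuallyEq_one

/-- A smooth vector field which is constant near a given point of a chart. -/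
theorem exists_chartField {p : M} {y : E} (hy : y ∈ (extChartAt 𝓘(ℝ, E) p).target) (v : E) :
    ∃ X : ∀ x : M, TangentSpace 𝓘(ℝ, E) x, IsSmoothField X ∧
      ∀ᶠ z in nhds y, chartField X p z = v := by
  obtain ⟨f, hf, hsupp, hone⟩ := exists_bump hy
  refine ⟨fun x => f x • (chartD p x).inverse v, ?_, ?_⟩
  · refine ContMDiffOn.smul_section_of_tsupport (u := (chartAt E p).source)
      (s := fun x => (chartD p x).inverse v) hf.contMDiffOn (chartAt E p).open_source hsupp ?_
    refine ((trivializationAt E (TangentSpace 𝓘(ℝ, E)) p).contMDiffOn_section_iff (n := ∞)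
      (s := fun x => (chartD p x).inverse v) (chartAt E p).open_source (by simp)).2 ?_
    refine contMDiffOn_const (c := v) |>.congr fun x hx => ?_
    refine (Trivialization.continuousLinearMapAt_apply_of_mem (R := ℝ)
      (trivializationAt E (TangentSpace 𝓘(ℝ, E)) p) (by simpa using hx) _).symm.trans ?_
    rw [TangentBundle.continuousLinearMapAt_trivializationAt hx]
    exact chartD_inverse hx v
  · filter_upwards [hone, (isOpen_target p).mem_nhds hy] with z hz hzt
    rw [chartField, map_smul, hz, chartD_inverse, one_smul]
    simpa using (extChartAt 𝓘(ℝ, E) p).map_target hzt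

/-- A smooth 1-form which is constant near a given point of a chart. -/
theorem exists_chartCovector {p : M} {y : E} (hy : y ∈ (extChartAt 𝓘(ℝ, E) p).target)
    (a : E →L[ℝ] ℝ) :
    ∃ α : ∀ x : M, TangentSpace 𝓘(ℝ, E) x →L[ℝ] ℝ, IsSmoothForm (oneForm α) ∧
      ∀ᶠ z in nhds y, chartCovector α p z = a := by
  obtain ⟨f, hf, hsupp, hone⟩ := exists_bump hy
  refine ⟨fun x => f x • a.comp (chartD p x), isSmoothForm_oneForm_iff.2 fun q z hz => ?_, ?_⟩
  · have hc : ContinuousAt (extChartAt 𝓘(ℝ, E) q).symm z :=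
      (continuousOn_extChartAt_symm q).continuousAt ((isOpen_target q).mem_nhds hz)
    by_cases h : (extChartAt 𝓘(ℝ, E) q).symm z ∈ (chartAt E p).source
    · have hz' : z ∈ overlap p q := ⟨hz, h⟩
      have h1 : ContDiffAt ℝ ∞ (fun w => f ((extChartAt 𝓘(ℝ, E) q).symm w)) z := by
        rw [← contMDiffAt_iff_contDiffAt]
        exact hf.contMDiffAt.comp z ((contMDiffOn_extChartAt_symm q).contMDiffAt
          ((isOpen_target q).mem_nhds hz))
      have h2 : ContDiffAt ℝ ∞ (fun w => a.comp (fderiv ℝ (transition p q) w)) z :=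
        contDiffAt_const.clm_comp ((contDiffAt_transition hz').fderiv_right (m := ∞) le_rfl)
      refine ((h1.smul h2).congr_of_eventuallyEq ?_).contDiffWithinAt
      filter_upwards [(isOpen_overlap p q).mem_nhds hz'] with w hw
      ext v
      change f _ • a (chartD p _ (chartSymmD q w v)) = f _ • a (fderiv ℝ (transition p q) w v)
      rw [fderiv_transition hw]
    -- Outside the chart domain the point also avoids the closed support of `f`, so the form
    -- vanishes on a whole neighbourhood.
    · have h0 : ∀ᶠ w in nhds z, f ((extChartAt 𝓘(ℝ, E) q).symm w) = 0 := by
        have := hc.eventually ((isClosed_tsupport f).isOpen_compl.mem_nhds fun hm => h (hsupp hm))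
        filter_upwards [this] with w hw
        exact image_eq_zero_of_notMem_tsupport hw
      refine (contDiffAt_const (c := (0 : E →L[ℝ] ℝ))).congr_of_eventuallyEq ?_ |>.contDiffWithinAt
      filter_upwards [h0] with w hw
      ext v
      change f _ • a _ = 0
      rw [hw, zero_smul]
  · filter_upwards [hone, (isOpen_target p).mem_nhds hy] with z hz hzt
    ext v
    change f _ • a (chartD p _ (chartSymmD p z v)) = a v
    rw [hz, one_smul, chartD_chartSymmD hzt]

theorem exists_field (p : M) (v : TangentSpace 𝓘(ℝ, E) p) :
    ∃ X : ∀ x : M, TangentSpace 𝓘(ℝ, E) x, IsSmoothField X ∧ X p = v := by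
  obtain ⟨X, hX, h⟩ := exists_chartField (mem_extChartAt_target (I := 𝓘(ℝ, E)) p) v
  exact ⟨X, hX, (chartField_self X p).symm.trans h.self_of_nhds⟩

theorem exists_covector (p : M) (a : TangentSpace 𝓘(ℝ, E) p →L[ℝ] ℝ) :
    ∃ α : ∀ x : M, TangentSpace 𝓘(ℝ, E) x →L[ℝ] ℝ, IsSmoothForm (oneForm α) ∧ α p = a := by
  obtain ⟨α, hα, h⟩ := exists_chartCovector (mem_extChartAt_target (I := 𝓘(ℝ, E)) p) a
  exact ⟨α, hα, (chartCovector_self α p).symm.trans h.self_of_nhds⟩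

/-! ### Smooth bundle maps -/

/-- A field of bilinear forms which takes smooth vector fields to smooth 1-forms. -/
def IsSmoothBilin
    (B : ∀ x : M, TangentSpace 𝓘(ℝ, E) x →L[ℝ] TangentSpace 𝓘(ℝ, E) x →L[ℝ] ℝ) : Prop :=
  ∀ X : ∀ x : M, TangentSpace 𝓘(ℝ, E) x, IsSmoothField X → IsSmoothForm (oneForm fun x => B x (X x))

/-- A field of endomorphisms which takes smooth vector fields to smooth vector fields. -/
def IsSmoothEndo (I : ∀ x : M, TangentSpace 𝓘(ℝ, E) x →L[ℝ] TangentSpace 𝓘(ℝ, E) x) : Prop :=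
  ∀ X : ∀ x : M, TangentSpace 𝓘(ℝ, E) x, IsSmoothField X → IsSmoothField fun x => I x (X x)

/-- Smoothness of the coordinate matrix is tested on constant vectors, each of which extends to a
global field that is constant near the given point. -/
theorem isSmoothBilin_iff
    {B : ∀ x : M, TangentSpace 𝓘(ℝ, E) x →L[ℝ] TangentSpace 𝓘(ℝ, E) x →L[ℝ] ℝ} :
    IsSmoothBilin B ↔ ∀ p, ContDiffOn ℝ ∞ (chartBilin B p) (extChartAt 𝓘(ℝ, E) p).target := by
  constructor
  · intro h p
    refine contDiffOn_clm_apply.2 fun v y hy => ?_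
    obtain ⟨X, hX, hv⟩ := exists_chartField hy v
    have h1 := (isSmoothForm_oneForm_iff.1 (h X hX) p).contDiffAt ((isOpen_target p).mem_nhds hy)
    refine (h1.congr_of_eventuallyEq ?_).contDiffWithinAt
    filter_upwards [hv, (isOpen_target p).mem_nhds hy] with z hz hzt
    rw [← hz, chartBilin_apply B X hzt]
  · intro h X hX
    refine isSmoothForm_oneForm_iff.2 fun p => ?_
    refine ((h p).clm_apply (isSmoothField_iff.1 hX p)).congr fun y hy => ?_
    rw [chartBilin_apply B X hy]

/-- A field of linear maps from covectors to vectors, in the preferred chart at `p`. -/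
def chartCobilin (P : ∀ x : M, (TangentSpace 𝓘(ℝ, E) x →L[ℝ] ℝ) →L[ℝ] TangentSpace 𝓘(ℝ, E) x)
    (p : M) (y : E) : (E →L[ℝ] ℝ) →L[ℝ] E :=
  (chartD p _).comp ((P ((extChartAt 𝓘(ℝ, E) p).symm y)).comp
    (ContinuousLinearMap.precomp ℝ (chartD p ((extChartAt 𝓘(ℝ, E) p).symm y))))

theorem chartCobilin_apply
    (P : ∀ x : M, (TangentSpace 𝓘(ℝ, E) x →L[ℝ] ℝ) →L[ℝ] TangentSpace 𝓘(ℝ, E) x)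
    (α : ∀ x : M, TangentSpace 𝓘(ℝ, E) x →L[ℝ] ℝ) {p : M} {y : E}
    (hy : y ∈ (extChartAt 𝓘(ℝ, E) p).target) :
    chartCobilin P p y (chartCovector α p y) = chartField (fun x => P x (α x)) p y := by
  have : (chartCovector α p y).comp (chartD p ((extChartAt 𝓘(ℝ, E) p).symm y)) =
      α ((extChartAt 𝓘(ℝ, E) p).symm y) :=
    ContinuousLinearMap.ext fun w => congrArg (α _) (chartSymmD_chartD hy w)
  change chartD p _ (P _ ((chartCovector α p y).comp (chartD p _))) = _
  rw [this]; rfl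

theorem contDiffOn_chartCobilin
    {P : ∀ x : M, (TangentSpace 𝓘(ℝ, E) x →L[ℝ] ℝ) →L[ℝ] TangentSpace 𝓘(ℝ, E) x}
    (h : ∀ α : ∀ x : M, TangentSpace 𝓘(ℝ, E) x →L[ℝ] ℝ, IsSmoothForm (oneForm α) →
      IsSmoothField fun x => P x (α x)) (p : M) :
    ContDiffOn ℝ ∞ (chartCobilin P p) (extChartAt 𝓘(ℝ, E) p).target := by
  refine contDiffOn_clm_apply.2 fun a y hy => ?_
  obtain ⟨α, hα, ha⟩ := exists_chartCovector hy a
  have h1 := (isSmoothField_iff.1 (h α hα) p).contDiffAt ((isOpen_target p).mem_nhds hy)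
  refine (h1.congr_of_eventuallyEq ?_).contDiffWithinAt
  filter_upwards [ha, (isOpen_target p).mem_nhds hy] with z hz hzt
  rw [← hz, chartCobilin_apply P α hzt]

/-- In a chart `g` is the pointwise inverse of a smooth family of invertible maps, and inversion is
smooth at an invertible map. This is how the metric inherits smoothness from `g⁻¹`. -/
theorem isSmoothBilin_of_inverse
    {P : ∀ x : M, (TangentSpace 𝓘(ℝ, E) x →L[ℝ] ℝ) →L[ℝ] TangentSpace 𝓘(ℝ, E) x}
    {g : ∀ x : M, TangentSpace 𝓘(ℝ, E) x →L[ℝ] TangentSpace 𝓘(ℝ, E) x →L[ℝ] ℝ}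
    (h : ∀ α : ∀ x : M, TangentSpace 𝓘(ℝ, E) x →L[ℝ] ℝ, IsSmoothForm (oneForm α) →
      IsSmoothField fun x => P x (α x))
    (hgP : ∀ x α, g x (P x α) = α) (hPg : ∀ x X, P x (g x X) = X) : IsSmoothBilin g := by
  refine isSmoothBilin_iff.2 fun p y hy => ?_
  have key : ∀ z ∈ (extChartAt 𝓘(ℝ, E) p).target, ∃ e : (E →L[ℝ] ℝ) ≃L[ℝ] E,
      (e : (E →L[ℝ] ℝ) →L[ℝ] E) = chartCobilin P p z ∧
      (e.symm : E →L[ℝ] E →L[ℝ] ℝ) = chartBilin g p z := by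
    intro z hz
    have h1 : ∀ v, chartCobilin P p z (chartBilin g p z v) = v := fun v => by
      have e : (ContinuousLinearMap.precomp ℝ (chartD p ((extChartAt 𝓘(ℝ, E) p).symm z)))
          (chartBilin g p z v) = g _ (chartSymmD p z v) :=
        ContinuousLinearMap.ext fun w =>
          congrArg (fun t => g _ (chartSymmD p z v) t) (chartSymmD_chartD hz w)
      change chartD p _ (P _ (ContinuousLinearMap.precomp ℝ _ (chartBilin g p z v))) = v
      rw [e, hPg, chartD_chartSymmD hz]
    have h2 : ∀ a, chartBilin g p z (chartCobilin P p z a) = a := fun a => by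
      ext w
      change g _ (chartSymmD p z (chartD p _ (P _ (ContinuousLinearMap.precomp ℝ
        (chartD p _) a)))) (chartSymmD p z w) = a w
      rw [chartSymmD_chartD hz, hgP]
      exact congrArg a (chartD_chartSymmD hz w)
    exact ⟨ContinuousLinearEquiv.equivOfInverse _ _ h2 h1, rfl, rfl⟩
  obtain ⟨e, he, -⟩ := key y hy
  have h1 := (contDiffOn_chartCobilin h p).contDiffAt ((isOpen_target p).mem_nhds hy)
  have h2 : ContDiffAt ℝ ∞ ContinuousLinearMap.inverse (chartCobilin P p y) := by
    rw [← he]; exact contDiffAt_map_inverse e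
  refine ((h2.comp y h1).congr_of_eventuallyEq ?_).contDiffWithinAt
  filter_upwards [(isOpen_target p).mem_nhds hy] with z hz
  obtain ⟨e, he, he'⟩ := key z hz
  rw [Function.comp, ← he, ContinuousLinearMap.inverse_equiv, he']

end Extension

/-! ### Coordinate formulas for brackets and exterior derivatives. -/

section CourantInChart

variable {E : Type*} [NormedAddCommGroup E] [NormedSpace ℝ E]
  {M : Type*} [TopologicalSpace M] [ChartedSpace E M] [IsManifold 𝓘(ℝ, E) ∞ M]

theorem target_mem_nhds (p : M) :
    (extChartAt 𝓘(ℝ, E) p).target ∈ nhds (extChartAt 𝓘(ℝ, E) p p) :=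
  (isOpen_target p).mem_nhds (mem_extChartAt_target p)

theorem IsSmoothField.contDiffAt {X : ∀ x : M, TangentSpace 𝓘(ℝ, E) x} (hX : IsSmoothField X)
    (p : M) : ContDiffAt ℝ ∞ (chartField X p) (extChartAt 𝓘(ℝ, E) p p) :=
  (isSmoothField_iff.1 hX p).contDiffAt (target_mem_nhds p)

theorem IsSmoothField.differentiableAt {X : ∀ x : M, TangentSpace 𝓘(ℝ, E) x}
    (hX : IsSmoothField X) (p : M) :
    DifferentiableAt ℝ (chartField X p) (extChartAt 𝓘(ℝ, E) p p) :=
  (hX.contDiffAt p).differentiableAt (by simp)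

theorem differentiableAt_chartCovector {α : ∀ x : M, TangentSpace 𝓘(ℝ, E) x →L[ℝ] ℝ}
    (hα : IsSmoothForm (oneForm α)) (p : M) :
    DifferentiableAt ℝ (chartCovector α p) (extChartAt 𝓘(ℝ, E) p p) :=
  ((isSmoothForm_oneForm_iff.1 hα p).contDiffAt (target_mem_nhds p)).differentiableAt (by simp)

theorem mlieBracket_eq (X Y : ∀ x : M, TangentSpace 𝓘(ℝ, E) x) (p : M) :
    VectorField.mlieBracket 𝓘(ℝ, E) X Y p =
      VectorField.lieBracket ℝ (chartField X p) (chartField Y p) (extChartAt 𝓘(ℝ, E) p p) := by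
  have key : ∀ Z : ∀ x : M, TangentSpace 𝓘(ℝ, E) x,
      VectorField.mpullbackWithin 𝓘(ℝ, E) 𝓘(ℝ, E) (extChartAt 𝓘(ℝ, E) p).symm Z Set.univ
        =ᶠ[nhds (extChartAt 𝓘(ℝ, E) p p)] chartField Z p := fun Z => by
    filter_upwards [target_mem_nhds p] with y hy
    obtain ⟨e, he⟩ : (chartSymmD p y).IsInvertible := by
      have := isInvertible_mfderivWithin_extChartAt_symm (I := 𝓘(ℝ, E)) hy
      rwa [modelWithCornersSelf_coe, Set.range_id, mfderivWithin_univ] at this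
    rw [VectorField.mpullbackWithin_apply, mfderivWithin_univ]
    change (chartSymmD p y).inverse (Z _) = chartD p _ (Z _)
    rw [← he, ContinuousLinearMap.inverse_equiv]
    have h := chartD_chartSymmD hy (e.symm (Z ((extChartAt 𝓘(ℝ, E) p).symm y)))
    rw [← he] at h
    refine h.symm.trans ?_
    exact congrArg (chartD p _) (e.apply_symm_apply _)
  have h : ∀ V W : E → E, V =ᶠ[nhds (extChartAt 𝓘(ℝ, E) p p)] chartField X p →
      W =ᶠ[nhds (extChartAt 𝓘(ℝ, E) p p)] chartField Y p →
      (chartD p p).inverse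
        (VectorField.lieBracketWithin ℝ V W Set.univ (extChartAt 𝓘(ℝ, E) p p)) =
      VectorField.lieBracket ℝ (chartField X p) (chartField Y p) (extChartAt 𝓘(ℝ, E) p p) :=
    fun V W hV hW => by
      rw [VectorField.lieBracketWithin_univ, hV.lieBracket_vectorField_eq hW, chartD_self]
      exact DFunLike.congr_fun ContinuousLinearMap.inverse_id _
  rw [VectorField.mlieBracket, VectorField.mlieBracketWithin_apply, modelWithCornersSelf_coe,
    Set.range_id, Set.preimage_univ, Set.univ_inter]
  exact h _ _ (key X) (key Y)

theorem mvfderiv_eq {f : M → ℝ} {p : M} {g : E → ℝ}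
    (hg : DifferentiableAt ℝ g (extChartAt 𝓘(ℝ, E) p p))
    (h : ∀ᶠ y in nhds (extChartAt 𝓘(ℝ, E) p p), g y = f ((extChartAt 𝓘(ℝ, E) p).symm y)) (v : E) :
    mvfderiv 𝓘(ℝ, E) f p v = fderiv ℝ g (extChartAt 𝓘(ℝ, E) p p) v := by
  have h1 : f =ᶠ[nhds p] g ∘ extChartAt 𝓘(ℝ, E) p := by
    filter_upwards [(continuousAt_extChartAt p).eventually h,
      (chartAt E p).open_source.mem_nhds (mem_chart_source E p)] with x hx hxs
    rw [Function.comp, hx, (extChartAt 𝓘(ℝ, E) p).left_inv (by simpa using hxs)]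
  have h2 := (hg.hasFDerivAt.hasMFDerivAt).comp p
    (mdifferentiableAt_extChartAt (I := 𝓘(ℝ, E)) (mem_chart_source E p)).hasMFDerivAt
  have h3 := (h2.congr_of_eventuallyEq h1).mfderiv
  rw [mvfderiv, h3]
  change fderiv ℝ g _ (chartD p p v) = _
  rw [chartD_self]; rfl

theorem fderiv_clm_apply_apply {F G : Type*} [NormedAddCommGroup F] [NormedSpace ℝ F]
    [NormedAddCommGroup G] [NormedSpace ℝ G] {c : E → F →L[ℝ] G} {u : E → F} {x : E}
    (hc : DifferentiableAt ℝ c x) (hu : DifferentiableAt ℝ u x) (v : E) :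
    fderiv ℝ (fun y => c y (u y)) x v = fderiv ℝ c x v (u x) + c x (fderiv ℝ u x v) := by
  rw [fderiv_clm_apply hc hu, add_comm]
  rfl

theorem fderiv_clm_apply_const {F G : Type*} [NormedAddCommGroup F] [NormedSpace ℝ F]
    [NormedAddCommGroup G] [NormedSpace ℝ G] {c : E → F →L[ℝ] G} {x : E}
    (hc : DifferentiableAt ℝ c x) (w : F) (v : E) :
    fderiv ℝ (fun y => c y w) x v = fderiv ℝ c x v w := by
  rw [fderiv_clm_apply_apply hc (differentiableAt_const w), fderiv_fun_const]
  simp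

theorem contract₂_apply {x : M} (η : TangentSpace 𝓘(ℝ, E) x [⋀^Fin 2]→L[ℝ] ℝ)
    (X Y : TangentSpace 𝓘(ℝ, E) x) : contract₂ η X Y = η ![X, Y] := by
  change η (Function.update ![X, 0] 1 Y) = _
  congr 1; ext k; fin_cases k <;> rfl

theorem contract₃_apply {x : M} (η : TangentSpace 𝓘(ℝ, E) x [⋀^Fin 3]→L[ℝ] ℝ)
    (X Y Z : TangentSpace 𝓘(ℝ, E) x) : contract₃ η X Y Z = η ![Y, X, Z] := by
  change η (Function.update ![Y, X, 0] 2 Z) = _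
  congr 1; ext k; fin_cases k <;> rfl

theorem extD_oneForm_apply {α : ∀ x : M, TangentSpace 𝓘(ℝ, E) x →L[ℝ] ℝ}
    (hα : IsSmoothForm (oneForm α)) (p : M) (v w : E) :
    extD (oneForm α) p ![v, w] =
      fderiv ℝ (chartCovector α p) (extChartAt 𝓘(ℝ, E) p p) v w -
        fderiv ℝ (chartCovector α p) (extChartAt 𝓘(ℝ, E) p p) w v := by
  refine (extD_apply (E := E) _ p ![v, w]).trans ?_
  rw [extDeriv_apply ((hα.contDiffAt (mem_extChartAt_target p)).differentiableAt (by simp)),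
    Fin.sum_univ_two]
  have e : ∀ u : Fin 1 → E, ∀ a : E,
      fderiv ℝ (fun y => chartForm (oneForm α) p y u) (extChartAt 𝓘(ℝ, E) p p) a =
        fderiv ℝ (chartCovector α p) (extChartAt 𝓘(ℝ, E) p p) a (u 0) := fun u a => by
    change fderiv ℝ (fun y => chartCovector α p y (u 0)) _ a = _
    exact fderiv_clm_apply_const (differentiableAt_chartCovector hα p) _ _
  rw [e, e]
  simp [Fin.removeNth]
  ring

theorem courant_fst (H : Form E M 3 ℝ) (s t : GSection E M) (p : M) :
    (courant H s t p).1 = VectorField.lieBracket ℝ (chartField (fun x => (s x).1) p)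
      (chartField (fun x => (t x).1) p) (extChartAt 𝓘(ℝ, E) p p) :=
  mlieBracket_eq _ _ p

/-- The cotangent component of the Courant bracket in the preferred chart. -/
theorem courant_snd (H : Form E M 3 ℝ) {X Y : ∀ x : M, TangentSpace 𝓘(ℝ, E) x}
    {α β : ∀ x : M, TangentSpace 𝓘(ℝ, E) x →L[ℝ] ℝ} (hX : IsSmoothField X)
    (hα : IsSmoothForm (oneForm α)) (hβ : IsSmoothForm (oneForm β)) (p : M) (z : E) :
    (courant H (fun x => (X x, α x)) (fun x => (Y x, β x)) p).2 z =
      fderiv ℝ (chartCovector β p) (extChartAt 𝓘(ℝ, E) p p) (X p) z +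
      β p (fderiv ℝ (chartField X p) (extChartAt 𝓘(ℝ, E) p p) z) -
      fderiv ℝ (chartCovector α p) (extChartAt 𝓘(ℝ, E) p p) (Y p) z +
      fderiv ℝ (chartCovector α p) (extChartAt 𝓘(ℝ, E) p p) z (Y p) +
      H p ![Y p, X p, z] := by
  have dβ := differentiableAt_chartCovector hβ p
  have dX := hX.differentiableAt p
  change mvfderiv 𝓘(ℝ, E) (fun y => β y (X y)) p z + contract₂ (extD (oneForm β) p) (X p) z -
    contract₂ (extD (oneForm α) p) (Y p) z + contract₃ (H p) (X p) (Y p) z = _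
  have e1 : mvfderiv 𝓘(ℝ, E) (fun y => β y (X y)) p z =
      fderiv ℝ (chartCovector β p) (extChartAt 𝓘(ℝ, E) p p) z (X p) +
        β p (fderiv ℝ (chartField X p) (extChartAt 𝓘(ℝ, E) p p) z) := by
    refine (mvfderiv_eq (g := fun y => chartCovector β p y (chartField X p y))
      (dβ.clm_apply dX) ?_ z).trans ?_
    rotate_left
    · rw [fderiv_clm_apply_apply dβ dX, chartField_self, chartCovector_self]
      rfl
    · filter_upwards [target_mem_nhds p] with y hy
      exact chartCovector_apply β X hy
  have e2 := (contract₂_apply (extD (oneForm β) p) (X p) z).trans (extD_oneForm_apply hβ p (X p) z)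
  have e3 := (contract₂_apply (extD (oneForm α) p) (Y p) z).trans (extD_oneForm_apply hα p (Y p) z)
  have e4 := contract₃_apply (H p) (X p) (Y p) z
  have key : ∀ {a b c d a' b' c' d' : ℝ}, a = a' → b = b' → c = c' → d = d' →
      a + b - c + d = a' + b' - c' + d' := by rintro _ _ _ _ _ _ _ _ rfl rfl rfl rfl; rfl
  refine (key e1 e2 e3 e4).trans ?_
  -- The term `∂_z β(X)` cancels between `d(ι_X β)` and `ι_X dβ`.
  ring

section TwoForms

variable [FiniteDimensional ℝ E]

theorem contDiff_of_additive {F G : Type*} [NormedAddCommGroup F] [NormedSpace ℝ F]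
    [FiniteDimensional ℝ F] [NormedAddCommGroup G] [NormedSpace ℝ G] {f : F → G}
    (add : ∀ x y, f (x + y) = f x + f y) (smul : ∀ (c : ℝ) x, f (c • x) = c • f x) :
    ContDiff ℝ ∞ f :=
  ContinuousLinearMap.contDiff (LinearMap.toContinuousLinearMap (⟨⟨f, add⟩, smul⟩ : F →ₗ[ℝ] G))

theorem contDiff_twoForm :
    ContDiff ℝ ∞ (fun B : E →L[ℝ] E →L[ℝ] ℝ => (twoForm B : E [⋀^Fin 2]→L[ℝ] ℝ)) := by
  refine contDiff_of_additive (fun B C => ?_) fun c B => ?_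
  · ext v
    change (1 / 2 : ℝ) * ((B (v 0) (v 1) + C (v 0) (v 1)) - (B (v 1) (v 0) + C (v 1) (v 0))) =
      (1 / 2) * (B (v 0) (v 1) - B (v 1) (v 0)) + (1 / 2) * (C (v 0) (v 1) - C (v 1) (v 0))
    ring
  · ext v
    change (1 / 2 : ℝ) * (c * B (v 0) (v 1) - c * B (v 1) (v 0)) =
      c * ((1 / 2) * (B (v 0) (v 1) - B (v 1) (v 0)))
    ring

variable [T2Space M]
  {B : ∀ x : M, TangentSpace 𝓘(ℝ, E) x →L[ℝ] TangentSpace 𝓘(ℝ, E) x →L[ℝ] ℝ}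

theorem IsSmoothBilin.twoForm (hB : IsSmoothBilin B) :
    IsSmoothForm (fun x => GenKahler.twoForm (B x)) := fun p =>
  (contDiff_twoForm.comp_contDiffOn (isSmoothBilin_iff.1 hB p)).congr fun y _ =>
    chartForm_twoForm B p y

theorem IsSmoothBilin.differentiableAt (hB : IsSmoothBilin B) (p : M) :
    DifferentiableAt ℝ (chartBilin B p) (extChartAt 𝓘(ℝ, E) p p) :=
  ((isSmoothBilin_iff.1 hB p).contDiffAt (target_mem_nhds p)).differentiableAt (by simp)

theorem fderiv_chartBilin_const (hB : IsSmoothBilin B) (p : M) (u v w : E) :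
    fderiv ℝ (fun y => chartBilin B p y v w) (extChartAt 𝓘(ℝ, E) p p) u =
      fderiv ℝ (chartBilin B p) (extChartAt 𝓘(ℝ, E) p p) u v w := by
  rw [fderiv_clm_apply_const ((hB.differentiableAt p).clm_apply (differentiableAt_const v)),
    fderiv_clm_apply_const (hB.differentiableAt p)]

theorem chartBilin_skew (skew : ∀ x X Y, B x X Y = -B x Y X) (p : M) (y v w : E) :
    chartBilin B p y v w = -chartBilin B p y w v :=
  skew _ (chartSymmD p y v) (chartSymmD p y w)

theorem chartForm_twoForm_apply
    (B : ∀ x : M, TangentSpace 𝓘(ℝ, E) x →L[ℝ] TangentSpace 𝓘(ℝ, E) x →L[ℝ] ℝ) (p : M) (y : E)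
    (t : Fin 2 → E) :
    chartForm (fun x => twoForm (B x)) p y t =
      (1 / 2) * (chartBilin B p y (t 0) (t 1) - chartBilin B p y (t 1) (t 0)) := rfl

theorem extD_twoForm_apply (hB : IsSmoothBilin B) (skew : ∀ x X Y, B x X Y = -B x Y X) (p : M)
    (u v w : E) :
    extD (fun x => twoForm (B x)) p ![u, v, w] =
      fderiv ℝ (chartBilin B p) (extChartAt 𝓘(ℝ, E) p p) u v w -
      fderiv ℝ (chartBilin B p) (extChartAt 𝓘(ℝ, E) p p) v u w +
      fderiv ℝ (chartBilin B p) (extChartAt 𝓘(ℝ, E) p p) w u v := by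
  refine (extD_apply (E := E) _ p ![u, v, w]).trans ?_
  rw [extDeriv_apply ((hB.twoForm.contDiffAt (mem_extChartAt_target p)).differentiableAt (by simp)),
    Fin.sum_univ_three]
  have e : ∀ t : Fin 2 → E, ∀ a : E, fderiv ℝ (fun y => chartForm (fun x => twoForm (B x)) p y t)
      (extChartAt 𝓘(ℝ, E) p p) a =
        fderiv ℝ (chartBilin B p) (extChartAt 𝓘(ℝ, E) p p) a (t 0) (t 1) := fun t a => by
    -- For skew `B` the antisymmetrisation with factor `½` returns `B` itself.
    have : (fun y => chartForm (fun x => twoForm (B x)) p y t) =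
        fun y => chartBilin B p y (t 0) (t 1) := funext fun y => by
      rw [chartForm_twoForm_apply, chartBilin_skew skew p y (t 1)]
      ring
    rw [this, fderiv_chartBilin_const hB]
  rw [e, e, e]
  simp [Fin.removeNth, Fin.succAbove]
  ring

theorem fderiv_chartBilin_skew (hB : IsSmoothBilin B) (skew : ∀ x X Y, B x X Y = -B x Y X) (p : M)
    (u v w : E) :
    fderiv ℝ (chartBilin B p) (extChartAt 𝓘(ℝ, E) p p) u v w =
      -fderiv ℝ (chartBilin B p) (extChartAt 𝓘(ℝ, E) p p) u w v := by
  have e : ∀ v w : E, fderiv ℝ (fun y => chartBilin B p y v w) (extChartAt 𝓘(ℝ, E) p p) u =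
      fderiv ℝ (chartBilin B p) (extChartAt 𝓘(ℝ, E) p p) u v w := fun v w => by
    rw [fderiv_chartBilin_const hB]
  have h : (fun y => chartBilin B p y v w) = -fun y => chartBilin B p y w v :=
    funext fun y => chartBilin_skew skew p y v w
  rw [← e, ← e, h, fderiv_neg, neg_apply]

theorem fderiv_chartCovector_bilin (hB : IsSmoothBilin B)
    {X : ∀ x : M, TangentSpace 𝓘(ℝ, E) x} (hX : IsSmoothField X) (p : M) (v w : E) :
    fderiv ℝ (chartCovector (fun x => B x (X x)) p) (extChartAt 𝓘(ℝ, E) p p) v w =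
      fderiv ℝ (chartBilin B p) (extChartAt 𝓘(ℝ, E) p p) v (X p) w +
        B p (fderiv ℝ (chartField X p) (extChartAt 𝓘(ℝ, E) p p) v) w := by
  have h : chartCovector (fun x => B x (X x)) p =ᶠ[nhds (extChartAt 𝓘(ℝ, E) p p)]
      fun y => chartBilin B p y (chartField X p y) := by
    filter_upwards [target_mem_nhds p] with y hy
    exact (chartBilin_apply B X hy).symm
  rw [h.fderiv_eq, fderiv_clm_apply_apply (hB.differentiableAt p) (hX.differentiableAt p),
    chartField_self, chartBilin_self]
  rfl

end TwoForms

end CourantInChart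

/-! ### Smoothness of the bihermitian tensors. -/

section Smoothness

variable {E : Type*} [NormedAddCommGroup E] [NormedSpace ℝ E]
  {M : Type*} [TopologicalSpace M] [ChartedSpace E M] [IsManifold 𝓘(ℝ, E) ∞ M]

section Fields

variable {X Y : ∀ x : M, TangentSpace 𝓘(ℝ, E) x}

theorem chartField_neg (X : ∀ x : M, TangentSpace 𝓘(ℝ, E) x) (p : M) :
    chartField (fun x => -X x) p = -chartField X p :=
  funext fun _ => map_neg (chartD p _) _

theorem chartField_zero (p : M) :
    chartField (fun x => (0 : TangentSpace 𝓘(ℝ, E) x)) p = 0 :=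
  funext fun _ => map_zero (chartD p _)

theorem IsSmoothField.neg (hX : IsSmoothField X) : IsSmoothField fun x => -X x :=
  isSmoothField_iff.2 fun p => by
    rw [chartField_neg]; exact (isSmoothField_iff.1 hX p).neg

theorem IsSmoothField.zero : IsSmoothField fun x : M => (0 : TangentSpace 𝓘(ℝ, E) x) :=
  isSmoothField_iff.2 fun p => by rw [chartField_zero]; exact contDiffOn_const

end Fields

section Covectors

variable {α β : ∀ x : M, TangentSpace 𝓘(ℝ, E) x →L[ℝ] ℝ}

theorem chartCovector_add (α β : ∀ x : M, TangentSpace 𝓘(ℝ, E) x →L[ℝ] ℝ) (p : M) :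
    chartCovector (fun x => α x + β x) p = chartCovector α p + chartCovector β p := rfl

theorem chartCovector_neg (α : ∀ x : M, TangentSpace 𝓘(ℝ, E) x →L[ℝ] ℝ) (p : M) :
    chartCovector (fun x => -α x) p = -chartCovector α p := rfl

theorem chartCovector_zero (p : M) :
    chartCovector (fun x => (0 : TangentSpace 𝓘(ℝ, E) x →L[ℝ] ℝ)) p = 0 := rfl

variable [FiniteDimensional ℝ E] [T2Space M]

theorem IsSmoothForm.oneForm_add (hα : IsSmoothForm (oneForm α)) (hβ : IsSmoothForm (oneForm β)) :
    IsSmoothForm (oneForm fun x => α x + β x) := isSmoothForm_oneForm_iff.2 fun p => by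
  rw [chartCovector_add]
  exact (isSmoothForm_oneForm_iff.1 hα p).add (isSmoothForm_oneForm_iff.1 hβ p)

theorem IsSmoothForm.oneForm_neg (hα : IsSmoothForm (oneForm α)) :
    IsSmoothForm (oneForm fun x => -α x) := isSmoothForm_oneForm_iff.2 fun p => by
  rw [chartCovector_neg]; exact (isSmoothForm_oneForm_iff.1 hα p).neg

theorem IsSmoothForm.oneForm_zero :
    IsSmoothForm (oneForm fun x : M => (0 : TangentSpace 𝓘(ℝ, E) x →L[ℝ] ℝ)) :=
  isSmoothForm_oneForm_iff.2 fun p => by rw [chartCovector_zero]; exact contDiffOn_const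

end Covectors

variable [FiniteDimensional ℝ E] [T2Space M]

section Sections

variable {s t : GSection E M}

theorem IsSmoothSection.neg (hs : IsSmoothSection s) : IsSmoothSection fun x => -s x :=
  ⟨hs.1.neg, hs.2.oneForm_neg⟩

theorem IsSmoothSection.inl {X : ∀ x : M, TangentSpace 𝓘(ℝ, E) x} (hX : IsSmoothField X) :
    IsSmoothSection fun x => ((X x, 0) : GT E x) := ⟨hX, IsSmoothForm.oneForm_zero⟩

theorem IsSmoothSection.inr {α : ∀ x : M, TangentSpace 𝓘(ℝ, E) x →L[ℝ] ℝ}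
    (hα : IsSmoothForm (oneForm α)) : IsSmoothSection fun x => ((0, α x) : GT E x) :=
  ⟨IsSmoothField.zero, hα⟩

end Sections

section GenKahlerTensors

variable {H : Form E M 3 ℝ} {JA JB : ∀ x : M, GT E x →L[ℝ] GT E x}

theorem IsGenComplex.isOrthComplex {J : ∀ x : M, GT E x →L[ℝ] GT E x} (hJ : IsGenComplex H J)
    (x : M) : IsOrthComplex (J x) := isOrthComplex_of_lagrangian (hJ.sq x) (hJ.lagrangian x)

theorem IsGenKahler.isLinearGenKahler (h : IsGenKahler H JA JB) (x : M) :
    IsLinearGenKahler (JA x) (JB x) :=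
  ⟨h.genComplexA.isOrthComplex x, h.genComplexB.isOrthComplex x, h.comm x, h.pos x⟩

theorem IsGenKahler.smooth_genMetric (h : IsGenKahler H JA JB) {s : GSection E M}
    (hs : IsSmoothSection s) : IsSmoothSection fun x => genMetric (JA x) (JB x) (s x) :=
  (h.genComplexA.smooth _ (h.genComplexB.smooth s hs)).neg

theorem IsGenKahler.smooth_metric (h : IsGenKahler H JA JB) :
    IsSmoothBilin fun x => metric (JA x) (JB x) :=
  isSmoothBilin_of_inverse (P := fun x => metricInv (JA x) (JB x))
    (fun _ hα => (h.smooth_genMetric (IsSmoothSection.inr hα)).1)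
    (fun x => (h.isLinearGenKahler x).metric_metricInv)
    (fun x => (h.isLinearGenKahler x).metricInv_metric)

theorem IsGenKahler.smooth_bField (h : IsGenKahler H JA JB) :
    IsSmoothBilin fun x => bField (JA x) (JB x) := fun _ hX =>
  (h.smooth_metric _ (h.smooth_genMetric (IsSmoothSection.inl hX)).1).oneForm_neg

theorem IsGenKahler.smooth_IPlus (h : IsGenKahler H JA JB) :
    IsSmoothEndo fun x => IPlus (JA x) (JB x) := fun X hX =>
  (h.genComplexA.smooth
    (fun x => (X x, bField (JA x) (JB x) (X x) + metric (JA x) (JB x) (X x)))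
    ⟨hX, (h.smooth_bField X hX).oneForm_add (h.smooth_metric X hX)⟩).1

theorem IsGenKahler.smooth_IMinus (h : IsGenKahler H JA JB) :
    IsSmoothEndo fun x => IMinus (JA x) (JB x) := fun X hX => by
  have := (h.genComplexA.smooth
    (fun x => (X x, bField (JA x) (JB x) (X x) + -metric (JA x) (JB x) (X x)))
    ⟨hX, (h.smooth_bField X hX).oneForm_add (h.smooth_metric X hX).oneForm_neg⟩).1
  simp only [← sub_eq_add_neg] at this
  exact this

theorem IsGenKahler.smooth_omegaPlus (h : IsGenKahler H JA JB) :
    IsSmoothBilin fun x => omegaPlus (JA x) (JB x) := fun X hX =>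
  h.smooth_metric _ (h.smooth_IPlus X hX)

theorem IsGenKahler.smooth_omegaMinus (h : IsGenKahler H JA JB) :
    IsSmoothBilin fun x => -omegaMinus (JA x) (JB x) := fun X hX =>
  (h.smooth_metric _ (h.smooth_IMinus X hX)).oneForm_neg

end GenKahlerTensors

/-! ### Gauge transformations and the Courant bracket. -/

section Gauge

variable {F : ∀ x : M, TangentSpace 𝓘(ℝ, E) x →L[ℝ] TangentSpace 𝓘(ℝ, E) x →L[ℝ] ℝ}

theorem IsSmoothSection.gauge (hF : IsSmoothBilin F) {s : GSection E M} (hs : IsSmoothSection s) :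
    IsSmoothSection fun x => GenKahler.gauge (F x) (s x) :=
  ⟨hs.1, hs.2.oneForm_add (hF _ hs.1)⟩

theorem isSmoothSection_gauge_iff (hF : IsSmoothBilin F) (s : GSection E M) :
    IsSmoothSection s ↔ IsSmoothSection fun x => gauge (F x) (s x) := by
  refine ⟨IsSmoothSection.gauge hF, fun h => ⟨h.1, ?_⟩⟩
  have h2 := h.2.oneForm_add (hF _ h.1).oneForm_neg
  have e : (fun x => (s x).2 + F x (s x).1 + -F x (s x).1) = fun x => (s x).2 :=
    funext fun x => by abel
  exact e ▸ h2

/-- The gauge transformation `e^F` intertwines the Courant brackets of `H - dF` and of `H`. -/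
theorem gauge_courant (hF : IsSmoothBilin F) (skew : ∀ x X Y, F x X Y = -F x Y X)
    (H : Form E M 3 ℝ) {s t : GSection E M} (hs : IsSmoothSection s) (ht : IsSmoothSection t)
    (p : M) :
    gauge (F p) (courant (H - extD fun x => twoForm (F x)) s t p) =
      courant H (fun x => gauge (F x) (s x)) (fun x => gauge (F x) (t x)) p := by
  refine Prod.ext rfl (ContinuousLinearMap.ext fun z => ?_)
  have e1 := courant_snd (Y := fun x => (t x).1) (H - extD fun x => twoForm (F x)) hs.1 hs.2 ht.2 p z
  have e2 := courant_snd (Y := fun x => (t x).1) H hs.1 (hs.2.oneForm_add (hF _ hs.1)) (ht.2.oneForm_add (hF _ ht.1)) p z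
  obtain ⟨L, hL⟩ : ∃ L : E, L = VectorField.lieBracket ℝ (chartField (fun x => (s x).1) p)
      (chartField (fun x => (t x).1) p) (extChartAt 𝓘(ℝ, E) p p) := ⟨_, rfl⟩
  have e3 := (courant_fst (H - extD fun x => twoForm (F x)) s t p).trans hL.symm
  refine (congrArg₂ (· + ·) e1 (congrArg (fun v => F p v z) e3)).trans (Eq.trans ?_ e2.symm)
  have d : ∀ {u : GSection E M}, IsSmoothSection u → ∀ v w : E,
      fderiv ℝ (chartCovector (fun x => (u x).2 + F x (u x).1) p) (extChartAt 𝓘(ℝ, E) p p) v w =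
      fderiv ℝ (chartCovector (fun x => (u x).2) p) (extChartAt 𝓘(ℝ, E) p p) v w +
        (fderiv ℝ (chartBilin F p) (extChartAt 𝓘(ℝ, E) p p) v (u p).1 w +
        F p (fderiv ℝ (chartField (fun x => (u x).1) p) (extChartAt 𝓘(ℝ, E) p p) v) w) :=
    fun {u} hu v w => by
      rw [← fderiv_chartCovector_bilin hF hu.1, chartCovector_add,
        fderiv_add (differentiableAt_chartCovector hu.2 p)
          (differentiableAt_chartCovector (hF _ hu.1) p)]
      rfl
  have a1 := d hs (t p).1 z
  have a2 := d hs z (t p).1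
  have a3 := d ht (s p).1 z
  -- The terms differentiating `F` itself sum to `-dF(Y, X, z)`, which is the change of the 3-form;
  -- those differentiating `X` and `Y` give `F([X, Y], z)`, up to two terms cancelled by skewness.
  have a4 := extD_twoForm_apply hF skew p (t p).1 (s p).1 z
  have a5 : F p L z =
      F p (fderiv ℝ (chartField (fun x => (t x).1) p) (extChartAt 𝓘(ℝ, E) p p) (s p).1) z -
      F p (fderiv ℝ (chartField (fun x => (s x).1) p) (extChartAt 𝓘(ℝ, E) p p) (t p).1) z := by
    rw [VectorField.lieBracket_eq] at hL
    simp only [chartField_self] at hL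
    rw [hL]
    exact DFunLike.congr_fun (map_sub (F p) _ _) z
  have a6 := fderiv_chartBilin_skew hF skew p z (s p).1 (t p).1
  have a7 := skew p (fderiv ℝ (chartField (fun x => (s x).1) p) (extChartAt 𝓘(ℝ, E) p p) z) (t p).1
  have a8 : (H - extD fun x => twoForm (F x)) p ![(t p).1, (s p).1, z] =
      H p ![(t p).1, (s p).1, z] - extD (fun x => twoForm (F x)) p ![(t p).1, (s p).1, z] := rfl
  have a9 : ((t p).2 + F p (t p).1) (fderiv ℝ (chartField (fun x => (s x).1) p)
      (extChartAt 𝓘(ℝ, E) p p) z) = (t p).2 (fderiv ℝ (chartField (fun x => (s x).1) p)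
      (extChartAt 𝓘(ℝ, E) p p) z) + F p (t p).1 (fderiv ℝ (chartField (fun x => (s x).1) p)
      (extChartAt 𝓘(ℝ, E) p p) z) := rfl
  simp only [a1, a2, a3, a5, a8, a9]
  linarith

end Gauge

end Smoothness

/-! ### Vanishing Nijenhuis tensors and the Dirac structures `J(T^*)` and `Gr(-π_J)`. -/

section Integrability

variable {E : Type*} [NormedAddCommGroup E] [NormedSpace ℝ E]
  {M : Type*} [TopologicalSpace M] [ChartedSpace E M] [IsManifold 𝓘(ℝ, E) ∞ M]

theorem contract₂_zero {x : M} (η : TangentSpace 𝓘(ℝ, E) x [⋀^Fin 2]→L[ℝ] ℝ) :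
    contract₂ η 0 = 0 := ContinuousLinearMap.ext fun Y => by
  rw [contract₂_apply]; exact η.map_coord_zero 0 rfl

theorem contract₃_zero_left {x : M} (η : TangentSpace 𝓘(ℝ, E) x [⋀^Fin 3]→L[ℝ] ℝ)
    (Y : TangentSpace 𝓘(ℝ, E) x) : contract₃ η 0 Y = 0 := ContinuousLinearMap.ext fun Z => by
  rw [contract₃_apply]; exact η.map_coord_zero 1 rfl

theorem contract₃_zero_right {x : M} (η : TangentSpace 𝓘(ℝ, E) x [⋀^Fin 3]→L[ℝ] ℝ)
    (X : TangentSpace 𝓘(ℝ, E) x) : contract₃ η X 0 = 0 := ContinuousLinearMap.ext fun Z => by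
  rw [contract₃_apply]; exact η.map_coord_zero 0 rfl

theorem lieDeriv_zero (β : ∀ x : M, TangentSpace 𝓘(ℝ, E) x →L[ℝ] ℝ) (p : M) :
    lieDeriv (fun _ => 0) β p = 0 := by
  simp only [lieDeriv, map_zero, contract₂_zero, add_zero]
  exact mvfderiv_const _

theorem courant_inr_right (H : Form E M 3 ℝ) (s : GSection E M)
    (β : ∀ x : M, TangentSpace 𝓘(ℝ, E) x →L[ℝ] ℝ) (p : M) :
    courant H s (fun x => (0, β x)) p = (0, lieDeriv (fun x => (s x).1) β p) := by
  refine Prod.ext (congrFun VectorField.mlieBracket_zero_right p) ?_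
  change lieDeriv (fun x => (s x).1) β p - contract₂ _ 0 + contract₃ _ _ 0 = _
  rw [contract₂_zero, contract₃_zero_right, sub_zero, add_zero]

theorem courant_inr_left (H : Form E M 3 ℝ) (t : GSection E M)
    (α : ∀ x : M, TangentSpace 𝓘(ℝ, E) x →L[ℝ] ℝ) (p : M) :
    courant H (fun x => (0, α x)) t p = (0, -contract₂ (extD (oneForm α) p) (t p).1) := by
  refine Prod.ext (congrFun VectorField.mlieBracket_zero_left p) ?_
  change lieDeriv (fun _ => 0) _ p - contract₂ _ _ + contract₃ _ 0 _ = _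
  rw [lieDeriv_zero, contract₃_zero_left, zero_sub, add_zero]

variable [FiniteDimensional ℝ E] [T2Space M]

theorem lieBracket_neg_right (V W : E → E) (x : E) :
    VectorField.lieBracket ℝ V (-W) x = -VectorField.lieBracket ℝ V W x := by
  simp only [VectorField.lieBracket_eq, fderiv_neg, Pi.neg_apply, neg_apply, map_neg]
  abel

theorem lieBracket_neg_left (V W : E → E) (x : E) :
    VectorField.lieBracket ℝ (-V) W x = -VectorField.lieBracket ℝ V W x := by
  simp only [VectorField.lieBracket_eq, fderiv_neg, Pi.neg_apply, neg_apply, map_neg]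
  abel

theorem courant_neg_right (H : Form E M 3 ℝ) {s t : GSection E M} (hs : IsSmoothSection s)
    (ht : IsSmoothSection t) (p : M) :
    courant H s (fun x => -t x) p = -courant H s t p := by
  refine Prod.ext ?_ (ContinuousLinearMap.ext fun z => ?_)
  · refine (courant_fst H s (fun x => -t x) p).trans
      (Eq.trans ?_ (congrArg Neg.neg (courant_fst H s t p)).symm)
    have e : chartField (fun x => (-t x).1) p = -chartField (fun x => (t x).1) p :=
      chartField_neg _ p
    rw [e]
    exact lieBracket_neg_right (E := E) _ _ _
  · have e1 := courant_snd (Y := fun x => (-t x).1) H hs.1 hs.2 ht.neg.2 p z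
    have e2 := courant_snd (Y := fun x => (t x).1) H hs.1 hs.2 ht.2 p z
    refine e1.trans (Eq.trans ?_ (congrArg Neg.neg e2).symm)
    have e : chartCovector (fun x => (-t x).2) p = -chartCovector (fun x => (t x).2) p := rfl
    have e3 : H p ![-(t p).1, (s p).1, z] = -H p ![(t p).1, (s p).1, z] :=
      alternating_neg₀ _ _ _ _
    have e4 : ∀ v : E, (-t p).2 v = -(t p).2 v := fun _ => rfl
    have e5 : (-t p).1 = -(t p).1 := rfl
    rw [e, fderiv_neg, e4, e5, e3]
    have e6 : ∀ (A : E →L[ℝ] E →L[ℝ] ℝ) (v w : E), A (-v) w = -A v w := fun A v w => by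
      rw [map_neg, neg_apply]
    have e7 : ∀ (A : E →L[ℝ] E →L[ℝ] ℝ) (v w : E), A v (-w) = -A v w := fun A v w => map_neg _ _
    have e8 : ∀ (A : E →L[ℝ] E →L[ℝ] ℝ) (v w : E), (-A) v w = -A v w := fun A v w => rfl
    refine (congrArg₂ (· + ·) (congrArg₂ (· + ·) (congrArg₂ (· - ·) (congrArg₂ (· + ·)
      (e8 _ _ _) rfl) (e6 _ _ _)) (e7 _ _ _)) rfl).trans ?_
    ring

theorem courant_neg_left (H : Form E M 3 ℝ) {s t : GSection E M} (hs : IsSmoothSection s)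
    (ht : IsSmoothSection t) (p : M) :
    courant H (fun x => -s x) t p = -courant H s t p := by
  refine Prod.ext ?_ (ContinuousLinearMap.ext fun z => ?_)
  · refine (courant_fst H (fun x => -s x) t p).trans
      (Eq.trans ?_ (congrArg Neg.neg (courant_fst H s t p)).symm)
    have e : chartField (fun x => (-s x).1) p = -chartField (fun x => (s x).1) p :=
      chartField_neg _ p
    rw [e]
    exact lieBracket_neg_left (E := E) _ _ _
  · have e1 := courant_snd (X := fun x => (-s x).1) (Y := fun x => (t x).1) H hs.neg.1 hs.neg.2
      ht.2 p z
    have e2 := courant_snd (Y := fun x => (t x).1) H hs.1 hs.2 ht.2 p z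
    refine e1.trans (Eq.trans ?_ (congrArg Neg.neg e2).symm)
    have e : chartCovector (fun x => (-s x).2) p = -chartCovector (fun x => (s x).2) p := rfl
    have e' : chartField (fun x => (-s x).1) p = -chartField (fun x => (s x).1) p :=
      chartField_neg _ p
    have e3 : H p ![(t p).1, -(s p).1, z] = -H p ![(t p).1, (s p).1, z] :=
      alternating_neg₁ _ _ _ _
    have e5 : (-s p).1 = -(s p).1 := rfl
    rw [e, e', fderiv_neg, fderiv_neg, e5, e3]
    have e6 : ∀ (A : E →L[ℝ] E →L[ℝ] ℝ) (v w : E), A (-v) w = -A v w := fun A v w => by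
      rw [map_neg, neg_apply]
    have e7 : ∀ (a : E →L[ℝ] ℝ) (A : E →L[ℝ] E) (v : E), a ((-A) v) = -a (A v) :=
      fun a A v => by rw [neg_apply, map_neg]
    have e8 : ∀ (A : E →L[ℝ] E →L[ℝ] ℝ) (v w : E), (-A) v w = -A v w := fun A v w => rfl
    refine (congrArg₂ (· + ·) (congrArg₂ (· + ·) (congrArg₂ (· - ·) (congrArg₂ (· + ·)
      (e6 _ _ _) (e7 _ _ _)) (e8 _ _ _)) (e8 _ _ _)) rfl).trans ?_
    have key : ∀ a b c d h : ℝ, -a + -b - -c + -d + -h = -(a + b - c + d + h) := by intros; ring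
    exact key _ _ _ _ _

/-- `J` is a smooth orthogonal complex structure on `𝕋M` with vanishing Courant–Nijenhuis tensor. -/
structure IsIntegrable (H : Form E M 3 ℝ) (J : ∀ x : M, GT E x →L[ℝ] GT E x) : Prop where
  orth : ∀ x, IsOrthComplex (J x)
  smooth : ∀ s : GSection E M, IsSmoothSection s → IsSmoothSection fun x => J x (s x)
  nijenhuis : ∀ s t : GSection E M, IsSmoothSection s → IsSmoothSection t → ∀ x,
    J x (courant H (fun y => J y (s y)) (fun y => J y (t y)) x - courant H s t x) =
      -(courant H (fun y => J y (s y)) t x + courant H s (fun y => J y (t y)) x)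

theorem IsGenComplex.isIntegrable {H : Form E M 3 ℝ} {J : ∀ x : M, GT E x →L[ℝ] GT E x}
    (hJ : IsGenComplex H J) : IsIntegrable H J where
  orth := hJ.isOrthComplex
  smooth := hJ.smooth
  nijenhuis s t hs ht x := by
    have mem : ∀ (u : GSection E M) (y : M), (⟨J y (u y), u y⟩ : Cx (GT E y)) ∈ eigenC (J y) :=
      fun u y => mem_eigenC.2 ⟨hJ.sq y _, rfl⟩
    -- The identity is the eigenvalue equation for the complex bracket `[J s + i s, J t + i t]`,
    -- split into real and imaginary parts.
    exact (mem_eigenC.1 (hJ.involutive (fun y => ⟨J y (s y), s y⟩) (fun y => ⟨J y (t y), t y⟩)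
      (hJ.smooth s hs) hs (hJ.smooth t ht) ht (mem s) (mem t) x)).1

namespace IsIntegrable

variable {H : Form E M 3 ℝ} {J K : ∀ x : M, GT E x →L[ℝ] GT E x}

/-- Replacing `J` by `-J` changes the sign of both sides, by bilinearity of the bracket. It is
needed for `K = -J_B`. -/
theorem neg (h : IsIntegrable H J) : IsIntegrable H fun x => -J x where
  orth x := (h.orth x).neg
  smooth s hs := (h.smooth s hs).neg
  nijenhuis s t hs ht x := by
    have hs' := h.smooth s hs
    have ht' := h.smooth t ht
    have e := h.nijenhuis s t hs ht x
    change -(J x (courant H (fun y => -J y (s y)) (fun y => -J y (t y)) x - courant H s t x)) =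
      -(courant H (fun y => -J y (s y)) t x + courant H s (fun y => -J y (t y)) x)
    rw [courant_neg_left H hs' ht'.neg, courant_neg_right H hs' ht', courant_neg_left H hs' ht,
      courant_neg_right H hs ht', neg_neg, e]
    abel

/-- The Courant bracket of `J α` and `J β` for 1-forms `α`, `β`. -/
theorem courant_cotangent (h : IsIntegrable H J) {α β : ∀ x : M, TangentSpace 𝓘(ℝ, E) x →L[ℝ] ℝ}
    (hα : IsSmoothForm (oneForm α)) (hβ : IsSmoothForm (oneForm β)) (x : M) :
    courant H (fun y => J y (0, α y)) (fun y => J y (0, β y)) x =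
      J x (0, lieDeriv (fun y => (J y (0, α y)).1) β x -
        contract₂ (extD (oneForm α) x) (J x (0, β x)).1) := by
  have e := h.nijenhuis _ _ (IsSmoothSection.inr hα) (IsSmoothSection.inr hβ) x
  -- Two 1-forms have zero bracket and the mixed brackets are again 1-forms, so the Nijenhuis
  -- identity determines `[J α, J β]` as `J` of a 1-form.
  have e0 : courant H (fun y => (0, α y)) (fun y => (0, β y)) x = 0 := by
    rw [courant_inr_left, contract₂_zero, neg_zero]; rfl
  rw [e0, sub_zero, courant_inr_left, courant_inr_right] at e
  have e1 := congrArg (J x) e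
  rw [(h.orth x).sq, clm_map_neg, neg_inj] at e1
  rw [e1, sub_eq_add_neg]
  congr 1
  exact Prod.ext (add_zero _) rfl

theorem isDirac_imageCotangent (h : IsIntegrable H J) :
    IsDirac H fun x => imageCotangent (J x) where
  smooth x u hu := by
    obtain ⟨a, rfl⟩ := mem_imageCotangent.1 hu
    obtain ⟨α, hα, rfl⟩ := exists_covector x a
    exact ⟨fun y => J y (0, α y), h.smooth _ (IsSmoothSection.inr hα),
      fun y => mem_imageCotangent.2 ⟨α y, rfl⟩, rfl⟩
  lagrangian x := (h.orth x).isLagrangian_imageCotangent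
  involutive s t hs ht hsJ htJ x := by
    have key : ∀ u : GSection E M, IsSmoothSection u → (∀ y, u y ∈ imageCotangent (J y)) →
        ∃ α : ∀ x : M, TangentSpace 𝓘(ℝ, E) x →L[ℝ] ℝ, IsSmoothForm (oneForm α) ∧
          u = fun y => J y (0, α y) := fun u hu hm => by
      choose α hα using fun y => mem_imageCotangent.1 (hm y)
      refine ⟨α, ?_, funext fun y => (hα y).symm⟩
      -- The covector is recovered from `u = J α` as `-J u`, so it depends smoothly on the point.
      have e : (fun y => (-(J y (u y))).2) = α := funext fun y => by
        rw [← hα y, (h.orth y).sq, neg_neg]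
      rw [← e]
      exact (h.smooth u hu).neg.2
    obtain ⟨α, hα, rfl⟩ := key s hs hsJ
    obtain ⟨β, hβ, rfl⟩ := key t ht htJ
    exact mem_imageCotangent.2 ⟨_, (h.courant_cotangent hα hβ x).symm⟩

/-- The tangent component of `courant_cotangent` is `[π α, π β] = π ξ` with `ξ = L_{πα} β - ι_{πβ}
dα`. It does not involve the twist, so the graph is involutive for the untwisted bracket even when
`H ≠ 0`. -/
theorem isDirac_graph (h : IsIntegrable H J) :
    IsDirac (0 : Form E M 3 ℝ) fun x => graph (-poisson (J x)) where
  smooth x u hu := by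
    obtain ⟨a, rfl⟩ := hu
    obtain ⟨α, hα, rfl⟩ := exists_covector x a
    exact ⟨fun y => (-(J y (0, α y)).1, α y), ⟨(h.smooth _ (IsSmoothSection.inr hα)).1.neg, hα⟩,
      fun y => mem_graph.2 rfl, rfl⟩
  lagrangian x := (h.orth x).isLagrangian_graph
  involutive s t hs ht hsJ htJ x := by
    have key : ∀ u : GSection E M, IsSmoothSection u → (∀ y, u y ∈ graph (-poisson (J y))) →
        ∃ α : ∀ x : M, TangentSpace 𝓘(ℝ, E) x →L[ℝ] ℝ, IsSmoothForm (oneForm α) ∧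
          -- The sign is put on the covector, so that the tangent component is that of `J α` itself.
          u = fun y => ((J y (0, α y)).1, -α y) := fun u hu hm => by
      refine ⟨fun y => -(u y).2, hu.2.oneForm_neg, funext fun y => Prod.ext ?_ (neg_neg _).symm⟩
      have e : ((0, -(u y).2) : GT E y) = -(0, (u y).2) := Prod.ext neg_zero.symm rfl
      rw [e, clm_map_neg]
      exact (mem_graph.1 (hm y)).symm
    obtain ⟨α, hα, rfl⟩ := key s hs hsJ
    obtain ⟨β, hβ, rfl⟩ := key t ht htJ
    have hX := h.smooth _ (IsSmoothSection.inr hα)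
    have e := h.courant_cotangent hα hβ x
    obtain ⟨ξ, hξ⟩ : ∃ ξ, ξ = lieDeriv (fun y => (J y (0, α y)).1) β x -
        contract₂ (extD (oneForm α) x) (J x (0, β x)).1 := ⟨_, rfl⟩
    rw [← hξ] at e
    have e1 : (courant (0 : Form E M 3 ℝ) (fun y => ((J y (0, α y)).1, -α y))
        (fun y => ((J y (0, β y)).1, -β y)) x).1 = (J x (0, ξ)).1 := by
      have : VectorField.mlieBracket 𝓘(ℝ, E) (fun y => (J y (0, α y)).1)
        (fun y => (J y (0, β y)).1) x = (J x (0, ξ)).1 := congrArg Prod.fst e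
      exact this
    have e2 : (courant (0 : Form E M 3 ℝ) (fun y => ((J y (0, α y)).1, -α y))
        (fun y => ((J y (0, β y)).1, -β y)) x).2 = -ξ := by
      have f1 : lieDeriv (fun y => (J y (0, α y)).1) (fun y => -β y) x =
          -lieDeriv (fun y => (J y (0, α y)).1) β x := by
        have := congrArg Prod.snd (courant_neg_right (0 : Form E M 3 ℝ) hX
          (IsSmoothSection.inr hβ) x)
        rw [courant_inr_right] at this
        refine Eq.trans ?_ this
        refine (congrArg Prod.snd (courant_inr_right (0 : Form E M 3 ℝ)
          (fun y => J y (0, α y)) (fun y => -β y) x)).symm.trans ?_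
        congr 2
        funext y
        exact Prod.ext neg_zero.symm rfl
      have f2 : extD (oneForm fun y => -α y) x = -extD (oneForm α) x :=
        congrFun (extD_neg (oneForm α)) x
      rw [hξ]
      change lieDeriv (fun y => (J y (0, α y)).1) (fun y => -β y) x -
        contract₂ (extD (oneForm fun y => -α y) x) (J x (0, β x)).1 +
        contract₃ (0 : TangentSpace 𝓘(ℝ, E) x [⋀^Fin 3]→L[ℝ] ℝ) _ _ = _
      rw [f1, f2]
      have f3 : ∀ X Y : TangentSpace 𝓘(ℝ, E) x,
          contract₃ (0 : TangentSpace 𝓘(ℝ, E) x [⋀^Fin 3]→L[ℝ] ℝ) X Y = 0 := fun X Y =>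
        ContinuousLinearMap.ext fun Z => contract₃_apply _ _ _ _
      have f4 : ∀ (η : TangentSpace 𝓘(ℝ, E) x [⋀^Fin 2]→L[ℝ] ℝ) (X : TangentSpace 𝓘(ℝ, E) x),
          contract₂ (-η) X = -contract₂ η X := fun η X =>
        ContinuousLinearMap.ext fun Z => (contract₂_apply _ _ _).trans
          (congrArg Neg.neg (contract₂_apply η X Z)).symm
      rw [f3, f4]
      abel
    rw [mem_graph, e2, e1]
    have e3 : ((0, -ξ) : GT E x) = -(0, ξ) := Prod.ext neg_zero.symm rfl
    change -(J x (0, -ξ)).1 = _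
    rw [e3, clm_map_neg, Prod.fst_neg, neg_neg]

end IsIntegrable

end Integrability

/-! ### Integrability on the common graph: torsion of `I` and the curvature relation. -/

section Torsion

variable {E : Type*} [NormedAddCommGroup E] [NormedSpace ℝ E] [FiniteDimensional ℝ E]
  {M : Type*} [TopologicalSpace M] [T2Space M] [ChartedSpace E M] [IsManifold 𝓘(ℝ, E) ∞ M]

/-- One of the two halves of a generalized Kähler structure: two integrable complex structures on
`𝕋M` which coincide on the graph of `b - F I`. -/
structure IsBihermitianField (H : Form E M 3 ℝ) (J K : ∀ x : M, GT E x →L[ℝ] GT E x)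
    (I : ∀ x : M, TangentSpace 𝓘(ℝ, E) x →L[ℝ] TangentSpace 𝓘(ℝ, E) x)
    (b F : ∀ x : M, TangentSpace 𝓘(ℝ, E) x →L[ℝ] TangentSpace 𝓘(ℝ, E) x →L[ℝ] ℝ) : Prop where
  fst : IsIntegrable H J
  snd : IsIntegrable H K
  linear : ∀ x, IsBihermitian (J x) (K x) (I x) (b x) (F x)
  smooth_I : IsSmoothEndo I
  smooth_b : IsSmoothBilin b
  smooth_F : IsSmoothBilin F

variable {H : Form E M 3 ℝ} {J K : ∀ x : M, GT E x →L[ℝ] GT E x}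
  {I : ∀ x : M, TangentSpace 𝓘(ℝ, E) x →L[ℝ] TangentSpace 𝓘(ℝ, E) x}
  {b F : ∀ x : M, TangentSpace 𝓘(ℝ, E) x →L[ℝ] TangentSpace 𝓘(ℝ, E) x →L[ℝ] ℝ}

/-- Cartan's formula for the exterior derivative of a 2-form. -/
theorem extD_twoForm_cartan (hF : IsSmoothBilin F) (skew : ∀ x X Y, F x X Y = -F x Y X)
    {X Y Z : ∀ x : M, TangentSpace 𝓘(ℝ, E) x} (hX : IsSmoothField X) (hY : IsSmoothField Y)
    (hZ : IsSmoothField Z) (p : M) :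
    extD (fun x => twoForm (F x)) p ![X p, Y p, Z p] =
      mvfderiv 𝓘(ℝ, E) (fun x => F x (Y x) (Z x)) p (X p) -
      mvfderiv 𝓘(ℝ, E) (fun x => F x (X x) (Z x)) p (Y p) +
      mvfderiv 𝓘(ℝ, E) (fun x => F x (X x) (Y x)) p (Z p) -
      F p (VectorField.mlieBracket 𝓘(ℝ, E) X Y p) (Z p) +
      F p (VectorField.mlieBracket 𝓘(ℝ, E) X Z p) (Y p) -
      F p (VectorField.mlieBracket 𝓘(ℝ, E) Y Z p) (X p) := by
  obtain ⟨D, hD⟩ : ∃ D : (∀ x : M, TangentSpace 𝓘(ℝ, E) x) → E → E,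
      D = fun V v => fderiv ℝ (chartField V p) (extChartAt 𝓘(ℝ, E) p p) v := ⟨_, rfl⟩
  obtain ⟨q, hq⟩ : ∃ q : E → E → E → ℝ, q = fun u v w =>
      fderiv ℝ (chartBilin F p) (extChartAt 𝓘(ℝ, E) p p) u v w := ⟨_, rfl⟩
  obtain ⟨f, hf⟩ : ∃ f : E → E → ℝ, f = fun v w => F p v w := ⟨_, rfl⟩
  have e : ∀ {V W : ∀ x : M, TangentSpace 𝓘(ℝ, E) x}, IsSmoothField V → IsSmoothField W → ∀ v : E,
      mvfderiv 𝓘(ℝ, E) (fun x => F x (V x) (W x)) p v =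
        q v (V p) (W p) + f (D V v) (W p) + f (V p) (D W v) := fun {V W} hV hW v => by
    have dF := hF.differentiableAt p
    have dV := hV.differentiableAt p
    have dW := hW.differentiableAt p
    refine (mvfderiv_eq (g := fun y => chartBilin F p y (chartField V p y) (chartField W p y))
      ((dF.clm_apply dV).clm_apply dW) ?_ v).trans ?_
    · filter_upwards [target_mem_nhds p] with y hy
      rw [chartBilin_apply F V hy]
      exact chartCovector_apply (fun x => F x (V x)) W hy
    · rw [fderiv_clm_apply_apply (dF.clm_apply dV) dW, fderiv_clm_apply_apply dF dV, chartField_self,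
        chartField_self, chartBilin_self]
      subst hq hf hD
      rfl
  have l : ∀ (V W : ∀ x : M, TangentSpace 𝓘(ℝ, E) x) (z : E),
      F p (VectorField.mlieBracket 𝓘(ℝ, E) V W p) z = f (D W (V p)) z - f (D V (W p)) z :=
    fun V W z => by
      have h := mlieBracket_eq V W p
      rw [VectorField.lieBracket_eq] at h
      simp only [chartField_self] at h
      rw [h]
      subst hf hD
      exact DFunLike.congr_fun (map_sub (F p) _ _) z
  have s : ∀ v w, f v w = -f w v := fun v w => by subst hf; exact skew p v w
  have h : extD (fun x => twoForm (F x)) p ![X p, Y p, Z p] =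
      q (X p) (Y p) (Z p) - q (Y p) (X p) (Z p) + q (Z p) (X p) (Y p) := by
    subst hq; exact extD_twoForm_apply hF skew p (X p) (Y p) (Z p)
  have e1 := e hY hZ (X p)
  have e2 := e hX hZ (Y p)
  have e3 := e hX hY (Z p)
  have l1 := l X Y (Z p)
  have l2 := l X Z (Y p)
  have l3 := l Y Z (X p)
  have s1 := s (Y p) (D Z (X p))
  have s2 := s (X p) (D Z (Y p))
  have s3 := s (X p) (D Y (Z p))
  linarith

namespace IsBihermitianField

/-- The integrability of `J` and `K` on the graph of `b - F I`, in terms of `I` and `F`. -/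
theorem courant_graph (h : IsBihermitianField H J K I b F)
    {X Y : ∀ x : M, TangentSpace 𝓘(ℝ, E) x} (hX : IsSmoothField X) (hY : IsSmoothField Y) (p : M)
    {H' : Form E M 3 ℝ} (hH' : H' = H - extD fun x => twoForm (b x))
    {s s' t t' : GSection E M} (hs : s = fun x => (X x, -F x (I x (X x))))
    (hs' : s' = fun x => (I x (X x), F x (X x))) (ht : t = fun x => (Y x, -F x (I x (Y x))))
    (ht' : t' = fun x => (I x (Y x), F x (Y x))) {u : GT E p}
    (hu : u = courant H' s' t' p - courant H' s t p) :
    courant H' s' t p + courant H' s t' p = -(I p u.1, F p u.1) := by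
  have skb : ∀ x X Y, b x X Y = -b x Y X := fun x => (h.linear x).skew_b
  have sm : IsSmoothSection s := hs ▸ ⟨hX, (h.smooth_F _ (h.smooth_I X hX)).oneForm_neg⟩
  have sm' : IsSmoothSection s' := hs' ▸ ⟨h.smooth_I X hX, h.smooth_F X hX⟩
  have tm : IsSmoothSection t := ht ▸ ⟨hY, (h.smooth_F _ (h.smooth_I Y hY)).oneForm_neg⟩
  have tm' : IsSmoothSection t' := ht' ▸ ⟨h.smooth_I Y hY, h.smooth_F Y hY⟩
  -- Here `e^b s` and `e^b t` are sections of the graph of `b - F I`, and `L` sends them to `e^b s'`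
  -- and `e^b t'`. The Nijenhuis identity is pulled back through `e^b`, which turns `H` into `H -
  -- db`.
  have key : ∀ L : ∀ x : M, GT E x →L[ℝ] GT E x, IsIntegrable H L →
      (∀ x X, L x (X, b x X - F x (I x X)) = (I x X, b x (I x X) + F x X)) →
      L p (gauge (b p) u) = -gauge (b p) (courant H' s' t p + courant H' s t' p) := by
    intro L hL hmap
    have e : ∀ Z : ∀ x : M, TangentSpace 𝓘(ℝ, E) x,
        (fun x => L x (gauge (b x) (Z x, -F x (I x (Z x))))) =
          fun x => gauge (b x) (I x (Z x), F x (Z x)) := fun Z => funext fun x => by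
      have f1 : gauge (b x) (Z x, -F x (I x (Z x))) = (Z x, b x (Z x) - F x (I x (Z x))) :=
        Prod.ext rfl (neg_add_eq_sub _ _)
      have f2 : gauge (b x) (I x (Z x), F x (Z x)) = (I x (Z x), b x (I x (Z x)) + F x (Z x)) :=
        Prod.ext rfl (add_comm _ _)
      rw [f1, f2, hmap]
    have e1 : (fun x => L x (gauge (b x) (s x))) = fun x => gauge (b x) (s' x) := by
      subst hs hs'; exact e X
    have e2 : (fun x => L x (gauge (b x) (t x))) = fun x => gauge (b x) (t' x) := by
      subst ht ht'; exact e Y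
    have n := hL.nijenhuis _ _ (sm.gauge h.smooth_b) (tm.gauge h.smooth_b) p
    rw [e1, e2, ← gauge_courant h.smooth_b skb H sm' tm', ← gauge_courant h.smooth_b skb H sm tm,
      ← gauge_courant h.smooth_b skb H sm' tm, ← gauge_courant h.smooth_b skb H sm tm', ← hH',
      ← map_sub, ← map_add, ← hu] at n
    exact n
  have kJ := key J h.fst fun x => (h.linear x).map_fst
  have kK := key K h.snd fun x => (h.linear x).map_snd
  -- `J` and `K` give `e^b u` the same image, so `e^b u` lies in the graph, where the action of `J`
  -- is known explicitly.
  have m := (h.linear p).mem _ (kJ.trans kK.symm)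
  have e : gauge (b p) u = (u.1, b p u.1 - F p (I p u.1)) := Prod.ext rfl m
  rw [e, (h.linear p).map_fst] at kJ
  refine (gauge (b p)).injective ?_
  rw [map_neg, ← neg_eq_iff_eq_neg, ← kJ]
  exact Prod.ext rfl (add_comm _ _)

/-- `I` has vanishing Nijenhuis tensor. -/
theorem mlieBracket (h : IsBihermitianField H J K I b F)
    {X Y : ∀ x : M, TangentSpace 𝓘(ℝ, E) x} (hX : IsSmoothField X) (hY : IsSmoothField Y) (p : M) :
    VectorField.mlieBracket 𝓘(ℝ, E) (fun x => I x (X x)) Y p +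
      VectorField.mlieBracket 𝓘(ℝ, E) X (fun x => I x (Y x)) p =
    -I p (VectorField.mlieBracket 𝓘(ℝ, E) (fun x => I x (X x)) (fun x => I x (Y x)) p -
      VectorField.mlieBracket 𝓘(ℝ, E) X Y p) :=
  congrArg Prod.fst (h.courant_graph hX hY p rfl rfl rfl rfl rfl rfl)

/-- `dF` has no component of type `(3,0)`. -/
theorem extD_eq_of_type (h : IsBihermitianField H J K I b F) (p : M)
    (x y z : TangentSpace 𝓘(ℝ, E) p) :
    extD (fun x => twoForm (F x)) p ![x, y, z] =
      extD (fun x => twoForm (F x)) p ![I p x, I p y, z] +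
      extD (fun x => twoForm (F x)) p ![I p x, y, I p z] +
      extD (fun x => twoForm (F x)) p ![x, I p y, I p z] := by
  obtain ⟨X, hX, rfl⟩ := exists_field p x
  obtain ⟨Y, hY, rfl⟩ := exists_field p y
  obtain ⟨Z, hZ, rfl⟩ := exists_field p z
  have hX' := h.smooth_I X hX
  have hY' := h.smooth_I Y hY
  have hZ' := h.smooth_I Z hZ
  have skew : ∀ x X Y, F x X Y = -F x Y X := fun x => (h.linear x).skew_F
  -- The vanishing torsion of `I` paired with `I w`; invariance of `F` then removes `I` from the
  -- right side. In Cartan's formula this cancels the bracket terms, while `inv` and `inv'` cancel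
  -- the derivative terms.
  have br : ∀ {V W : ∀ x : M, TangentSpace 𝓘(ℝ, E) x}, IsSmoothField V → IsSmoothField W →
      ∀ w : TangentSpace 𝓘(ℝ, E) p,
      F p (VectorField.mlieBracket 𝓘(ℝ, E) (fun x => I x (V x)) W p) (I p w) +
        F p (VectorField.mlieBracket 𝓘(ℝ, E) V (fun x => I x (W x)) p) (I p w) =
      F p (VectorField.mlieBracket 𝓘(ℝ, E) V W p) w -
      F p (VectorField.mlieBracket 𝓘(ℝ, E) (fun x => I x (V x)) (fun x => I x (W x)) p) w :=
    fun {V W} hV hW w => by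
      rw [← add_apply, ← map_add, h.mlieBracket hV hW, map_neg, neg_apply,
        (h.linear p).inv_F, map_sub, sub_apply, neg_sub]
  have inv : ∀ V W : ∀ x : M, TangentSpace 𝓘(ℝ, E) x,
      (fun x => F x (I x (V x)) (I x (W x))) = fun x => F x (V x) (W x) := fun V W =>
    funext fun x => (h.linear x).inv_F _ _
  have inv' : ∀ (V W : ∀ x : M, TangentSpace 𝓘(ℝ, E) x) (v : TangentSpace 𝓘(ℝ, E) p),
      mvfderiv 𝓘(ℝ, E) (fun x => F x (V x) (I x (W x))) p v =
        -mvfderiv 𝓘(ℝ, E) (fun x => F x (I x (V x)) (W x)) p v := fun V W v => by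
    have e : (fun x => F x (V x) (I x (W x))) = -fun x => F x (I x (V x)) (W x) :=
      funext fun x => by
        rw [Pi.neg_apply, ← (h.linear x).inv_F (V x), (h.linear x).sq, map_neg]
    rw [e, mvfderiv_neg, neg_apply]
  have c0 := extD_twoForm_cartan h.smooth_F skew hX hY hZ p
  have c1 := extD_twoForm_cartan h.smooth_F skew hX' hY' hZ p
  have c2 := extD_twoForm_cartan h.smooth_F skew hX' hY hZ' p
  have c3 := extD_twoForm_cartan h.smooth_F skew hX hY' hZ' p
  rw [inv] at c1 c2 c3
  have b1 := br hX hY (Z p)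
  have b2 := br hX hZ (Y p)
  have b3 := br hY hZ (X p)
  have i1 := inv' Y Z (I p (X p))
  have i2 := inv' X Z (I p (Y p))
  have i3 := inv' X Y (I p (Z p))
  linarith

/-- The relation between `H - db` and `dF`. -/
theorem curvature (h : IsBihermitianField H J K I b F) (p : M)
    (x y z : TangentSpace 𝓘(ℝ, E) p) :
    extD (fun x => twoForm (F x)) p ![x, y, z] -
      extD (fun x => twoForm (F x)) p ![I p x, I p y, z] =
    (H - extD fun x => twoForm (b x)) p ![I p x, y, z] +
      (H - extD fun x => twoForm (b x)) p ![x, I p y, z] := by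
  obtain ⟨X, hX, rfl⟩ := exists_field p x
  obtain ⟨Y, hY, rfl⟩ := exists_field p y
  have hX' := h.smooth_I X hX
  have hY' := h.smooth_I Y hY
  have skew : ∀ x X Y, F x X Y = -F x Y X := fun x => (h.linear x).skew_F
  obtain ⟨H', hH'⟩ : ∃ H', H' = H - extD fun x => twoForm (b x) := ⟨_, rfl⟩
  rw [← hH']
  obtain ⟨D, hD⟩ : ∃ D : (∀ x : M, TangentSpace 𝓘(ℝ, E) x) → E → E,
      D = fun V v => fderiv ℝ (chartField V p) (extChartAt 𝓘(ℝ, E) p p) v := ⟨_, rfl⟩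
  obtain ⟨q, hq⟩ : ∃ q : E → E → E → ℝ, q = fun u v w =>
      fderiv ℝ (chartBilin F p) (extChartAt 𝓘(ℝ, E) p p) u v w := ⟨_, rfl⟩
  obtain ⟨f, hf⟩ : ∃ f : E → E → ℝ, f = fun v w => F p v w := ⟨_, rfl⟩
  have d : ∀ {V : ∀ x : M, TangentSpace 𝓘(ℝ, E) x}, IsSmoothField V → ∀ v w : E,
      fderiv ℝ (chartCovector (fun x => F x (V x)) p) (extChartAt 𝓘(ℝ, E) p p) v w =
        q v (V p) w + f (D V v) w := fun {V} hV v w => by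
    subst hq hf hD; exact fderiv_chartCovector_bilin h.smooth_F hV p v w
  have d' : ∀ {V : ∀ x : M, TangentSpace 𝓘(ℝ, E) x}, IsSmoothField V → ∀ v w : E,
      fderiv ℝ (chartCovector (fun x => -F x (V x)) p) (extChartAt 𝓘(ℝ, E) p p) v w =
        -(q v (V p) w + f (D V v) w) := fun {V} hV v w => by
    rw [chartCovector_neg, fderiv_neg, ← d hV]; rfl
  have l : ∀ (V W : ∀ x : M, TangentSpace 𝓘(ℝ, E) x) (z : E),
      F p (VectorField.mlieBracket 𝓘(ℝ, E) V W p) z = f (D W (V p)) z - f (D V (W p)) z :=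
    fun V W z => by
      have h := mlieBracket_eq V W p
      rw [VectorField.lieBracket_eq] at h
      simp only [chartField_self] at h
      rw [h]
      subst hf hD
      exact DFunLike.congr_fun (map_sub (F p) _ _) z
  have s : ∀ v w, f v w = -f w v := fun v w => by subst hf; exact skew p v w
  have e : ∀ V W : TangentSpace 𝓘(ℝ, E) p, extD (fun x => twoForm (F x)) p ![V, W, z] =
      q V W z - q W V z + q z V W := fun V W => by
    subst hq; exact extD_twoForm_apply h.smooth_F skew p V W z
  -- Cotangent component of the integrability identity. In coordinates the derivatives of the vector
  -- fields cancel, leaving derivatives of `F`, which assemble into `dF`, and the values of `H'`.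
  have c := DFunLike.congr_fun (congrArg Prod.snd
    (h.courant_graph hX hY p hH' rfl rfl rfl rfl rfl)) z
  have c1 := courant_snd (Y := Y) H' hX' (h.smooth_F X hX) (h.smooth_F _ hY').oneForm_neg p z
  have c2 := courant_snd (Y := fun x => I x (Y x)) H' hX (h.smooth_F _ hX').oneForm_neg
    (h.smooth_F Y hY) p z
  have c3 : (courant H' (fun x => (I x (X x), F x (X x)))
      (fun x => (Y x, -F x (I x (Y x)))) p).2 z +
      (courant H' (fun x => (X x, -F x (I x (X x)))) (fun x => (I x (Y x), F x (Y x))) p).2 z =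
      -(F p (VectorField.mlieBracket 𝓘(ℝ, E) (fun x => I x (X x)) (fun x => I x (Y x)) p) z -
        F p (VectorField.mlieBracket 𝓘(ℝ, E) X Y p) z) := by
    refine c.trans (congrArg Neg.neg ?_)
    exact DFunLike.congr_fun (map_sub (F p) _ _) z
  rw [c1, c2] at c3
  have g1 : (-F p (I p (Y p))) (fderiv ℝ (chartField (fun x => I x (X x)) p)
      (extChartAt 𝓘(ℝ, E) p p) z) = -f (I p (Y p)) (D (fun x => I x (X x)) z) := by
    subst hf hD; rfl
  have g2 : F p (Y p) (fderiv ℝ (chartField X p) (extChartAt 𝓘(ℝ, E) p p) z) =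
      f (Y p) (D X z) := by
    subst hf hD; rfl
  have l1 := l (fun x => I x (X x)) (fun x => I x (Y x)) z
  have l2 := l X Y z
  have d1 := d hX (Y p) z
  have d2 := d hX z (Y p)
  have d3 := d hY (X p) z
  have d4 := d' hX' (I p (Y p)) z
  have d5 := d' hX' z (I p (Y p))
  have d6 := d' hY' (I p (X p)) z
  beta_reduce at l1 d4 d5 d6
  have a1 := alternating_swap₀₁ (H' p) (Y p) (I p (X p)) z
  have a2 := alternating_swap₀₁ (H' p) (I p (Y p)) (X p) z
  rw [e, e]
  have s1 := s (D X z) (Y p)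
  have s2 := s (D (fun x => I x (X x)) z) (I p (Y p))
  linarith

end IsBihermitianField

end Torsion

/-! ### Transport of Manin triples by gauge transformations. -/

section ManinTriples

variable {E : Type*} [NormedAddCommGroup E] [NormedSpace ℝ E] [FiniteDimensional ℝ E]
  {M : Type*} [TopologicalSpace M] [T2Space M] [ChartedSpace E M] [IsManifold 𝓘(ℝ, E) ∞ M]

theorem mem_of_map_eq {R V : Type*} [Semiring R] [AddCommMonoid V] [Module R V] {e : V ≃ₗ[R] V}
    {L L' : Submodule R V} (h : L.map (e : V →ₗ[R] V) = L') {u : V} : u ∈ L ↔ e u ∈ L' := by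
  rw [← h]
  exact (Function.Injective.mem_set_image e.injective).symm

section Gauge

variable {F : ∀ x : M, TangentSpace 𝓘(ℝ, E) x →L[ℝ] TangentSpace 𝓘(ℝ, E) x →L[ℝ] ℝ}

theorem pairing_gauge (skew : ∀ x X Y, F x X Y = -F x Y X) (x : M) (u v : GT E x) :
    pairing (gauge (F x) u) (gauge (F x) v) = pairing u v := by
  change (v.2 + F x v.1) u.1 + (u.2 + F x u.1) v.1 = v.2 u.1 + u.2 v.1
  rw [add_apply, add_apply, skew x v.1]
  ring

theorem IsDirac.of_gauge (hF : IsSmoothBilin F) (skew : ∀ x X Y, F x X Y = -F x Y X)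
    {H : Form E M 3 ℝ} {L L' : ∀ x : M, Submodule ℝ (GT E x)}
    (hL : ∀ x, (L x).map (gauge (F x) : GT E x →ₗ[ℝ] GT E x) = L' x) (h : IsDirac H L') :
    IsDirac (H - extD fun x => twoForm (F x)) L where
  smooth x u hu := by
    obtain ⟨s, hs, hsL, hsx⟩ := h.smooth x _ ((mem_of_map_eq (hL x)).1 hu)
    refine ⟨fun y => (gauge (F y)).symm (s y), ?_, fun y => ?_, ?_⟩
    · rw [isSmoothSection_gauge_iff hF]
      simpa only [LinearEquiv.apply_symm_apply] using hs
    · rw [mem_of_map_eq (hL y), LinearEquiv.apply_symm_apply]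
      exact hsL y
    · beta_reduce
      rw [hsx, LinearEquiv.symm_apply_apply]
  lagrangian x u := by
    rw [mem_of_map_eq (hL x), h.lagrangian x]
    constructor
    · intro hu v hv
      rw [← pairing_gauge skew]
      exact hu _ ((mem_of_map_eq (hL x)).1 hv)
    · intro hu v hv
      rw [← (gauge (F x)).apply_symm_apply v, pairing_gauge skew]
      refine hu _ ((mem_of_map_eq (hL x)).2 ?_)
      rwa [LinearEquiv.apply_symm_apply]
  involutive s t hs ht hsL htL x := by
    rw [mem_of_map_eq (hL x), gauge_courant hF skew H hs ht]
    exact h.involutive _ _ (hs.gauge hF) (ht.gauge hF) (fun y => (mem_of_map_eq (hL y)).1 (hsL y))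
      (fun y => (mem_of_map_eq (hL y)).1 (htL y)) x

/-- Only the target has to be known to be a Manin triple: closedness, involutivity and
transversality of the source are pulled back along `e^F`. -/
theorem isManinIso_gauge (hF : IsSmoothBilin F) (skew : ∀ x X Y, F x X Y = -F x Y X)
    {S T : RealTriple E M} (hT : IsManinTriple T)
    (hH : S.H = T.H - extD fun x => twoForm (F x))
    (hA : ∀ x, (S.A x).map (gauge (F x) : GT E x →ₗ[ℝ] GT E x) = T.A x)
    (hB : ∀ x, (S.B x).map (gauge (F x) : GT E x →ₗ[ℝ] GT E x) = T.B x) :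
    IsManinIso (fun x => gauge (F x)) S T where
  source :=
    { closed := hH ▸ hT.closed.sub hF.twoForm.isClosedForm_extD
      diracA := hH ▸ IsDirac.of_gauge hF skew hA hT.diracA
      diracB := hH ▸ IsDirac.of_gauge hF skew hB hT.diracB
      compl := fun x => by
        have := hT.compl x
        rw [← hA, ← hB] at this
        exact (Submodule.orderIsoMapComap (gauge (F x))).isCompl_iff.2 this }
  target := hT
  smooth := isSmoothSection_gauge_iff hF
  anchor _ _ := rfl
  pairing := pairing_gauge skew
  bracket s t hs ht x := by rw [hH]; exact gauge_courant hF skew T.H hs ht x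
  mapA := hA
  mapB := hB

end Gauge

namespace IsBihermitianField

variable {H : Form E M 3 ℝ} {J K : ∀ x : M, GT E x →L[ℝ] GT E x}
  {I : ∀ x : M, TangentSpace 𝓘(ℝ, E) x →L[ℝ] TangentSpace 𝓘(ℝ, E) x}
  {b F : ∀ x : M, TangentSpace 𝓘(ℝ, E) x →L[ℝ] TangentSpace 𝓘(ℝ, E) x →L[ℝ] ℝ}

theorem curv_apply (h : IsBihermitianField H J K I b F) (p : M)
    (x y z : TangentSpace 𝓘(ℝ, E) p) :
    ((-2 * Complex.I) • del I F p) ![x, y, z] =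
      ⟨(H - extD fun x => twoForm (b x)) p ![x, y, z],
        -extD (fun x => twoForm (F x)) p ![x, y, z]⟩ := by
  refine GenKahler.curv_apply (h.linear p).sq (fun x y z => ?_) (h.extD_eq_of_type p) x y z
  -- Replacing `x` by `I x` moves one factor of `I` from `H - db` to `dF`, the form required by the
  -- pointwise lemma.
  have e := h.curvature p (I p x) y z
  rw [(h.linear p).sq, alternating_neg₀, alternating_neg₀] at e
  linarith

/-- The holomorphic Manin triple of `J`, `K` over `(M, I)`. -/
def holTriple (J K : ∀ x : M, GT E x →L[ℝ] GT E x)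
    (I : ∀ x : M, TangentSpace 𝓘(ℝ, E) x →L[ℝ] TangentSpace 𝓘(ℝ, E) x)
    (b F : ∀ x : M, TangentSpace 𝓘(ℝ, E) x →L[ℝ] TangentSpace 𝓘(ℝ, E) x →L[ℝ] ℝ) :
    HolTriple E M where
  I := I
  curv x := (-2 * Complex.I) • del I F x
  A x := TT10 (I x) ⊓ (Cx.conjSubmodule (eigenC (J x))).map (gaugeC (-b x) (-F x))
  B x := TT10 (I x) ⊓ (Cx.conjSubmodule (eigenC (K x))).map (gaugeC (-b x) (-F x))

theorem re_H (h : IsBihermitianField H J K I b F) :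
    (holTriple J K I b F).re.H = H - extD fun x => twoForm (b x) := by
  funext p
  ext v
  have e : v = ![v 0, v 1, v 2] := by ext k; fin_cases k <;> rfl
  rw [e]
  exact congrArg Complex.re (h.curv_apply p (v 0) (v 1) (v 2))

theorem im_H (h : IsBihermitianField H J K I b F) :
    (holTriple J K I b F).im.H = 0 - extD fun x => twoForm (F x) := by
  funext p
  ext v
  have e : v = ![v 0, v 1, v 2] := by ext k; fin_cases k <;> rfl
  rw [e, zero_sub]
  exact congrArg Complex.im (h.curv_apply p (v 0) (v 1) (v 2))

theorem isManinIso_re (h : IsBihermitianField H J K I b F) (hH : IsClosedForm H) :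
    IsManinIso (fun x => gauge (b x)) (holTriple J K I b F).re
      ⟨H, fun x => imageCotangent (J x), fun x => imageCotangent (K x)⟩ := by
  refine isManinIso_gauge h.smooth_b (fun x => (h.linear x).skew_b)
    ⟨hH, h.fst.isDirac_imageCotangent, h.snd.isDirac_imageCotangent,
      fun x => (h.linear x).isCompl_imageCotangent⟩ h.re_H (fun x => ?_) fun x => ?_
  · have e := (h.linear x).matchedPair_eq (h.fst.orth x) (h.linear x).map_fst
    exact (congrArg (fun L => (realPart L).map (gauge (b x) : GT E x →ₗ[ℝ] GT E x)) e).trans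
      (map_gauge_realPart (h.fst.orth x))
  · have e := (h.linear x).matchedPair_eq (h.snd.orth x) (h.linear x).map_snd
    exact (congrArg (fun L => (realPart L).map (gauge (b x) : GT E x →ₗ[ℝ] GT E x)) e).trans
      (map_gauge_realPart (h.snd.orth x))

theorem isManinIso_im (h : IsBihermitianField H J K I b F) :
    IsManinIso (fun x => gauge (F x)) (holTriple J K I b F).im
      ⟨0, fun x => graph (-poisson (J x)), fun x => graph (-poisson (K x))⟩ := by
  refine isManinIso_gauge h.smooth_F (fun x => (h.linear x).skew_F)
    ⟨IsClosedForm.zero, h.fst.isDirac_graph, h.snd.isDirac_graph,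
      fun x => (h.linear x).isCompl_graph⟩ h.im_H (fun x => ?_) fun x => ?_
  · have e := (h.linear x).matchedPair_eq (h.fst.orth x) (h.linear x).map_fst
    exact (congrArg (fun L => (imagPart L).map (gauge (F x) : GT E x →ₗ[ℝ] GT E x)) e).trans
      (map_gauge_imagPart (h.fst.orth x))
  · have e := (h.linear x).matchedPair_eq (h.snd.orth x) (h.linear x).map_snd
    exact (congrArg (fun L => (imagPart L).map (gauge (F x) : GT E x →ₗ[ℝ] GT E x)) e).trans
      (map_gauge_imagPart (h.snd.orth x))

end IsBihermitianField

/-- Two Manin triples with the same image under a gauge transformation are isomorphic via the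
identity. -/
theorem IsManinIso.refl_of_gauge
    {b : ∀ x : M, TangentSpace 𝓘(ℝ, E) x →L[ℝ] TangentSpace 𝓘(ℝ, E) x →L[ℝ] ℝ}
    {S S' T : RealTriple E M} (h : IsManinIso (fun x => gauge (b x)) S T)
    (h' : IsManinIso (fun x => gauge (b x)) S' T) (hH : S.H = S'.H) :
    IsManinIso (fun _ => LinearEquiv.refl ℝ _) S S' where
  source := h.source
  target := h'.source
  smooth _ := Iff.rfl
  anchor _ _ := rfl
  pairing _ _ _ := rfl
  bracket s t _ _ x := by rw [hH]; rfl
  mapA x := (Submodule.map_id _).trans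
    (Submodule.map_injective_of_injective (gauge (b x)).injective ((h.mapA x).trans (h'.mapA x).symm))
  mapB x := (Submodule.map_id _).trans
    (Submodule.map_injective_of_injective (gauge (b x)).injective ((h.mapB x).trans (h'.mapB x).symm))

/-! ### The two halves of a generalized Kähler structure. -/

section GeneralizedKahler

variable {H : Form E M 3 ℝ} {JA JB : ∀ x : M, GT E x →L[ℝ] GT E x}

theorem IsGenKahler.isBihermitianField_plus (h : IsGenKahler H JA JB) :
    IsBihermitianField H JA JB (fun x => IPlus (JA x) (JB x)) (fun x => bField (JA x) (JB x))
      (fun x => omegaPlus (JA x) (JB x)) where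
  fst := h.genComplexA.isIntegrable
  snd := h.genComplexB.isIntegrable
  linear x := (h.isLinearGenKahler x).isBihermitian_plus
  smooth_I := h.smooth_IPlus
  smooth_b := h.smooth_bField
  smooth_F := h.smooth_omegaPlus

theorem IsGenKahler.isBihermitianField_minus (h : IsGenKahler H JA JB) :
    IsBihermitianField H JA (fun x => -JB x) (fun x => IMinus (JA x) (JB x))
      (fun x => bField (JA x) (JB x)) (fun x => -omegaMinus (JA x) (JB x)) where
  fst := h.genComplexA.isIntegrable
  snd := h.genComplexB.isIntegrable.neg
  linear x := (h.isLinearGenKahler x).isBihermitian_minus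
  smooth_I := h.smooth_IMinus
  smooth_b := h.smooth_bField
  smooth_F := h.smooth_omegaMinus

theorem twoForm_neg {V : Type*} [AddCommGroup V] [Module ℝ V] [TopologicalSpace V] [T2Space V]
    [IsTopologicalAddGroup V] [ContinuousSMul ℝ V] [FiniteDimensional ℝ V]
    (B : V →L[ℝ] V →L[ℝ] ℝ) : twoForm (-B) = -twoForm B := by
  ext v
  change (1 / 2 : ℝ) * (-B (v 0) (v 1) - -B (v 1) (v 0)) =
    -((1 / 2 : ℝ) * (B (v 0) (v 1) - B (v 1) (v 0)))
  ring

theorem part21_neg {V : Type*} [AddCommGroup V] [Module ℝ V] [TopologicalSpace V]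
    [IsTopologicalAddGroup V] [ContinuousSMul ℝ V] (I : V →L[ℝ] V) (d : V [⋀^Fin 3]→L[ℝ] ℝ) :
    part21 I (Complex.ofRealCLM.compContinuousAlternatingMap (-d)) =
      -part21 I (Complex.ofRealCLM.compContinuousAlternatingMap d) := by
  ext v
  have e : v = ![v 0, v 1, v 2] := by ext k; fin_cases k <;> rfl
  rw [e]
  change _ = -part21 I _ _
  rw [part21_apply, part21_apply]
  apply Complex.ext
  · change (3 * -d _ + -d _ + -d _ + -d _) / 8 = -((3 * d _ + d _ + d _ + d _) / 8)
    ring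
  · change -(-d _ + -d _ + -d _ + 3 * -d _) / 8 = -(-(d _ + d _ + d _ + 3 * d _) / 8)
    ring

theorem del_neg (I : ∀ x : M, TangentSpace 𝓘(ℝ, E) x →L[ℝ] TangentSpace 𝓘(ℝ, E) x)
    (w : ∀ x : M, TangentSpace 𝓘(ℝ, E) x →L[ℝ] TangentSpace 𝓘(ℝ, E) x →L[ℝ] ℝ) (x : M) :
    del I (fun y => -w y) x = -del I w x := by
  have e : (fun y => twoForm (-w y)) = -fun y => twoForm (w y) := funext fun y => twoForm_neg (w y)
  have e' : extD (fun y => twoForm (-w y)) x = -extD (fun y => twoForm (w y)) x := by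
    rw [e, extD_neg]; rfl
  rw [del, e', part21_neg]
  rfl

/-- The three signs match simultaneously: `2i ∂ω_- = -2i ∂(-ω_-)`, `e^{-b+iω_-} = e^{-b-iF}` with `F
= -ω_-`, and `L_B` is the conjugate of the `+i` eigenbundle of `-J_B`. -/
theorem holMinus_eq (JA JB : ∀ x : M, GT E x →L[ℝ] GT E x) :
    holMinus JA JB = IsBihermitianField.holTriple JA (fun x => -JB x)
      (fun x => IMinus (JA x) (JB x)) (fun x => bField (JA x) (JB x))
      (fun x => -omegaMinus (JA x) (JB x)) := by
  have nn : ∀ x, -(-omegaMinus (JA x) (JB x)) = omegaMinus (JA x) (JB x) := fun x =>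
    ContinuousLinearMap.ext fun X => ContinuousLinearMap.ext fun Y =>
      neg_neg (omegaMinus (JA x) (JB x) X Y)
  simp only [holMinus, IsBihermitianField.holTriple, del_neg, conj_eigenC_neg, nn, smul_neg,
    neg_mul, neg_smul, neg_neg]

end GeneralizedKahler

end ManinTriples

end GenKahler

end

theorem mainTheorem11 {E : Type*} [NormedAddCommGroup E] [NormedSpace ℝ E] [FiniteDimensional ℝ E]
    {M : Type*} [TopologicalSpace M] [T2Space M] [SigmaCompactSpace M] [ChartedSpace E M]
    [IsManifold 𝓘(ℝ, E) ∞ M]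
    (H : GenKahler.Form E M 3 ℝ) (hH : GenKahler.IsClosedForm H)
    (JA JB : ∀ x : M, GenKahler.GT E x →L[ℝ] GenKahler.GT E x)
    (hJ : GenKahler.IsGenKahler H JA JB) :
    -- real parts
    (GenKahler.IsManinIso (fun x => GenKahler.gauge (GenKahler.bField (JA x) (JB x)))
        (GenKahler.holPlus JA JB).re
        ⟨H, fun x => GenKahler.imageCotangent (JA x), fun x => GenKahler.imageCotangent (JB x)⟩ ∧
      GenKahler.IsManinIso (fun x => GenKahler.gauge (GenKahler.bField (JA x) (JB x)))
        (GenKahler.holMinus JA JB).re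
        ⟨H, fun x => GenKahler.imageCotangent (JA x), fun x => GenKahler.imageCotangent (JB x)⟩ ∧
      GenKahler.IsManinIso (fun _ => LinearEquiv.refl ℝ _)
        (GenKahler.holPlus JA JB).re (GenKahler.holMinus JA JB).re) ∧
    -- imaginary parts
    (GenKahler.IsManinIso (fun x => GenKahler.gauge (GenKahler.omegaPlus (JA x) (JB x)))
        (GenKahler.holPlus JA JB).im
        ⟨0, fun x => GenKahler.graph (-GenKahler.poisson (JA x)),
          fun x => GenKahler.graph (-GenKahler.poisson (JB x))⟩ ∧
      GenKahler.IsManinIso (fun x => GenKahler.gauge (-GenKahler.omegaMinus (JA x) (JB x)))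
        (GenKahler.holMinus JA JB).im
        ⟨0, fun x => GenKahler.graph (-GenKahler.poisson (JA x)),
          fun x => GenKahler.graph (GenKahler.poisson (JB x))⟩) := by
  have hp := hJ.isBihermitianField_plus
  have hm := hJ.isBihermitianField_minus
  have re_minus := hm.isManinIso_re hH
  have im_minus := hm.isManinIso_im
  have re_H := hp.re_H.trans hm.re_H.symm
  -- Returning from `-J_B` to `J_B`: the image of the cotangent bundle is unchanged, while `Gr(-π)`
  -- becomes `Gr(π_B)`.
  simp only [GenKahler.imageCotangent_neg, GenKahler.poisson_neg, neg_neg,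
    ← GenKahler.holMinus_eq] at re_minus im_minus re_H
  exact ⟨⟨hp.isManinIso_re hH, re_minus, (hp.isManinIso_re hH).refl_of_gauge re_minus re_H⟩,
    hp.isManinIso_im, im_minus⟩
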